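/- Let $L>0$, $R>0$, $\mu>0$, $\mathcal I=(0,L)$, $Q_T=(0,T)\times\mathcal I$, and for $\varepsilon\in(0,1]$ put $a_\varepsilon(s)=\varepsilon+\max\{0,s\}$, $s\in\mathbb R$. For $u,v\in H^1(\mathcal I)$ let $$\mathcal E(u,v)=\frac12\int_{\mathcal I}|\partial_xu|^2+R\,|\partial_x(u+v)|^2\,dx .$$ Let $f_0,g_0\in H^1(\mathcal I)$ be non-negative and let $\varepsilon\in(0,1]$ be fixed. Then there exists a pair of functions $(f,g)$ on $[0,\infty)\times\overline{\mathcal I}$ with the following properties. (i) For every $T>0$, $$f,g\in L_\infty(0,T;H^1(\mathcal I))\cap L_2(0,T;H^3(\mathcal I))\cap\bigcap_{\alpha\in[0,1/2)}C([0,T],C^\alpha(\overline{\mathcal I})),\qquad \partial_tf,\partial_tg\in L_2(0,T;(H^1(\mathcal I))').$$ (ii) For every $T>0$ and every $\xi\in L_2(0,T;H^1(\mathcal I))$, with $\langle\cdot|\cdot\rangle$ the pairing between $(H^1(\mathcal I))'$ and $H^1(\mathcal I)$, $$\int_0^T\langle\partial_tf|\xi\rangle\,dt=\int_{Q_T}H_f\,\partial_x\xi\,dx\,dt,\qquad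 \int_0^T\langle\partial_tg|\xi\rangle\,dt=\int_{Q_T}H_g\,\partial_x\xi\,dx\,dt,$$ where $$H_f=a_\varepsilon^3(f)\,\partial_x^3f+\frac R2\big(2a_\varepsilon^3(f)+3a_\varepsilon^2(f)a_\varepsilon(g)\big)\partial_x^3(f+g),$$ $$H_g=\frac32a_\varepsilon^2(f)a_\varepsilon(g)\,\partial_x^3f+\frac R2\big(2\mu a_\varepsilon^3(g)+3a_\varepsilon^2(f)a_\varepsilon(g)+6a_\varepsilon(f)a_\varepsilon^2(g)\big)\partial_x^3(f+g).$$ (iii) $f(0)=f_0$ and $g(0)=g_0$; $\int_{\mathcal I}f(T)\,dx=\|f_0\|_{L_1}$ and $\int_{\mathcal I}g(T)\,dx=\|g_0\|_{L_1}$ for all $T\ge0$; and $\partial_xf(T)=\partial_xg(T)=0$ at $x=0$ and $x=L$ for almost all $T>0$. (iv) For almost all $T>0$, $$\mathcal E(f(T),g(T))+\int_{Q_T}a_\varepsilon(f)\Big|a_\varepsilon(f)\partial_x^3f+\frac R2\big(2a_\varepsilon(f)+3a_\varepsilon(g)\big)\partial_x^3(f+g)\Big|^2dx\,dt$$ $$+\mu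 R^2\int_{Q_T}a_\varepsilon^3(g)\,|\partial_x^3(f+g)|^2\,dx\,dt+\frac{3R^2}4\int_{Q_T}a_\varepsilon(f)a_\varepsilon^2(g)\,|\partial_x^3(f+g)|^2\,dx\,dt\le\mathcal E(f_0,g_0).$$ (v) The pair is a limit of cosine-Galerkin approximations. Let $\phi_0=\sqrt{1/L}$ and $\phi_k(x)=\sqrt{2/L}\cos(k\pi x/L)$ for $k\ge1$. For every $n\in\mathbb N$ there are functions $f^n(t,x)=\sum_{k=0}^np_k^n(t)\phi_k(x)$ and $g^n(t,x)=\sum_{k=0}^nq_k^n(t)\phi_k(x)$ with $p_k^n,q_k^n\in C^1([0,\infty))$, $p_k^n(0)=\int_{\mathcal I}f_0\phi_k\,dx$, $q_k^n(0)=\int_{\mathcal I}g_0\phi_k\,dx$, such that for all $t\ge0$ and $0\le j\le n$ $$\int_{\mathcal I}\partial_tf^n\,\phi_j\,dx=\int_{\mathcal I}H_f^n\,\partial_x\phi_j\,dx,\qquad\int_{\mathcal I}\partial_tg^n\,\phi_j\,dx=\int_{\mathcal I}H_g^n\,\partial_x\phi_j\,dx,$$ where $H_f^n,H_g^n$ are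 given by the formulas in (ii) with $(f^n,g^n)$ in place of $(f,g)$; and there is one subsequence along which $f^n\to f$ and $g^n\to g$ in $C([0,T],C^\alpha(\overline{\mathcal I}))$ for all $T>0$ and all $\alpha\in[0,1/2)$. -/

import Mathlib

open MeasureTheory Set Filter Topology
open scoped NNReal ENNReal ContDiff

namespace ThinFilm

noncomputable section

/-- Lebesgue measure on the interval `(0, L)`; used for the space interval and for time intervals. -/
abbrev leb (L : ℝ) : Measure ℝ := volume.restrict (Ioo 0 L)

/-- `C_c^∞(0, L)`. -/
def IsTest (L : ℝ) (φ : ℝ → ℝ) : Prop :=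
  ContDiff ℝ ∞ φ ∧ HasCompactSupport φ ∧ tsupport φ ⊆ Ioo 0 L

/-- `v` is the weak (distributional) derivative of `u` on `(0, L)`. -/
def IsWeakDeriv (L : ℝ) (u v : ℝ → ℝ) : Prop :=
  ∀ φ : ℝ → ℝ, IsTest L φ → ∫ x, u x * deriv φ x ∂(leb L) = -∫ x, v x * φ x ∂(leb L)

theorem IsTest.integrable_mul {L : ℝ} {φ : ℝ → ℝ} (hφ : IsTest L φ) (u : Lp ℝ 2 (leb L)) :
    Integrable (fun x => u x * φ x) (leb L) ∧
      Integrable (fun x => u x * deriv φ x) (leb L) := by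
  have hu : MemLp u 2 (leb L) := Lp.memLp u
  have h1 : MemLp φ 2 (leb L) := hφ.1.continuous.memLp_of_hasCompactSupport hφ.2.1
  have h2 : MemLp (deriv φ) 2 (leb L) :=
    (hφ.1.continuous_deriv (by simp)).memLp_of_hasCompactSupport hφ.2.1.deriv
  exact ⟨hu.integrable_mul h1, hu.integrable_mul h2⟩

/-- The Sobolev space `H^k(0, L)`: an element is the tuple `(u, ∂u, …, ∂^k u)` of `L₂` classes, each
entry being the weak derivative of the preceding one, with the norm
`(∑ j ≤ k, ‖∂^j u‖²)^{1/2}`. -/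
def Sob (L : ℝ) (k : ℕ) : Submodule ℝ (PiLp 2 (fun _ : Fin (k + 1) => Lp ℝ 2 (leb L))) where
  carrier := {U | ∀ j : Fin k, IsWeakDeriv L (U j.castSucc) (U j.succ)}
  zero_mem' := by
    intro j φ _
    have h0 := Lp.coeFn_zero ℝ 2 (leb L)
    have i1 (ψ : ℝ → ℝ) : ∫ x, (0 : Lp ℝ 2 (leb L)) x * ψ x ∂(leb L) = 0 := by
      rw [integral_congr_ae (g := fun _ => (0 : ℝ)), integral_zero]
      filter_upwards [h0] with x hx
      rw [hx, Pi.zero_apply, zero_mul]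
    simp only [PiLp.zero_apply, i1, neg_zero]
  add_mem' := by
    intro U V hU hV j φ hφ
    have e1 := Lp.coeFn_add (U j.castSucc) (V j.castSucc)
    have e2 := Lp.coeFn_add (U j.succ) (V j.succ)
    have i1 : ∫ x, (U + V) j.castSucc x * deriv φ x ∂(leb L)
        = ∫ x, (U j.castSucc x * deriv φ x + V j.castSucc x * deriv φ x) ∂(leb L) := by
      refine integral_congr_ae ?_
      filter_upwards [e1] with x hx
      simp only [PiLp.add_apply, hx, Pi.add_apply, add_mul]
    have i2 : ∫ x, (U + V) j.succ x * φ x ∂(leb L)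
        = ∫ x, (U j.succ x * φ x + V j.succ x * φ x) ∂(leb L) := by
      refine integral_congr_ae ?_
      filter_upwards [e2] with x hx
      simp only [PiLp.add_apply, hx, Pi.add_apply, add_mul]
    rw [i1, i2, integral_add (hφ.integrable_mul _).2 (hφ.integrable_mul _).2,
      integral_add (hφ.integrable_mul _).1 (hφ.integrable_mul _).1, hU j φ hφ, hV j φ hφ]
    ring
  smul_mem' := by
    intro c U hU j φ hφ
    have e1 := Lp.coeFn_smul c (U j.castSucc)
    have e2 := Lp.coeFn_smul c (U j.succ)
    have i1 : ∫ x, (c • U) j.castSucc x * deriv φ x ∂(leb L)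
        = ∫ x, c * (U j.castSucc x * deriv φ x) ∂(leb L) := by
      refine integral_congr_ae ?_
      filter_upwards [e1] with x hx
      simp only [PiLp.smul_apply, hx, Pi.smul_apply, smul_eq_mul, mul_assoc]
    have i2 : ∫ x, (c • U) j.succ x * φ x ∂(leb L)
        = ∫ x, c * (U j.succ x * φ x) ∂(leb L) := by
      refine integral_congr_ae ?_
      filter_upwards [e2] with x hx
      simp only [PiLp.smul_apply, hx, Pi.smul_apply, smul_eq_mul, mul_assoc]
    rw [i1, i2, integral_const_mul, integral_const_mul, hU j φ hφ]
    ring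

/-- `∂_x^j u` as a class in `L₂(0, L)`, for `u ∈ H^k(0, L)` and `j ≤ k`. -/
def dxL2 {L : ℝ} {k : ℕ} (j : Fin (k + 1)) : Sob L k →L[ℝ] Lp ℝ 2 (leb L) :=
  (PiLp.proj 2 (fun _ : Fin (k + 1) => Lp ℝ 2 (leb L)) j).comp (Sob L k).subtypeL

/-- `∂_x^j u` as a function (defined up to null sets), for `u ∈ H^k(0, L)` and `j ≤ k`. -/
def dx {L : ℝ} {k : ℕ} (j : Fin (k + 1)) (u : Sob L k) : ℝ → ℝ := dxL2 j u

/-- The inclusion `H^3(0, L) ⊆ H^1(0, L)`. -/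
def toH1 {L : ℝ} (u : Sob L 3) : Sob L 1 :=
  ⟨WithLp.toLp 2 ![dxL2 0 u, dxL2 1 u], by
    intro j
    obtain rfl : j = 0 := Subsingleton.elim _ _
    exact u.2 0⟩

/-- The embedding `L₂(0, L) → (H^1(0, L))'`, `⟨u | ζ⟩ = ∫ u ζ dx`. -/
def toDual {L : ℝ} (u : Lp ℝ 2 (leb L)) : StrongDual ℝ (Sob L 1) :=
  (innerSL ℝ u).comp (dxL2 0)

/-- `w` is the time derivative on `(0, T)` of `U : (0, T) → L₂(0, L) ⊆ (H^1(0, L))'` in the sense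
of vector-valued distributions. -/
def IsTimeDeriv {L : ℝ} (T : ℝ) (U : ℝ → Lp ℝ 2 (leb L))
    (w : ℝ → StrongDual ℝ (Sob L 1)) : Prop :=
  ∀ θ : ℝ → ℝ, IsTest T θ →
    ∫ t, deriv θ t • toDual (U t) ∂(leb T) = -∫ t, θ t • w t ∂(leb T)

/-- The norm of `C^α([0, L])`: supremum plus Hölder seminorm on `[0, L]`. -/
def holderENorm (L : ℝ) (α : ℝ≥0) (u : ℝ → ℝ) : ℝ≥0∞ :=
  (⨆ x ∈ Icc 0 L, ‖u x‖ₑ) + eHolderNorm α ((Icc 0 L).domRestrict u)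

/-- `f ∈ C([0, T], C^α([0, L]))`. -/
def ContHolder (L T : ℝ) (α : ℝ≥0) (f : ℝ → ℝ → ℝ) : Prop :=
  (∀ t ∈ Icc 0 T, ContinuousOn (f t) (Icc 0 L) ∧ MemHolder α ((Icc 0 L).domRestrict (f t))) ∧
  ∀ t ∈ Icc 0 T, Tendsto (fun s => holderENorm L α (f s - f t)) (𝓝[Icc 0 T] t) (𝓝 0)

/-- The regularity class of the solution: `F t ∈ H^3(0, L)` is the class of `f t` for almost all
`t > 0`, and `w` is `∂_t f`. -/
structure HasRegularity (L : ℝ) (f : ℝ → ℝ → ℝ) (F : ℝ → Sob L 3)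
    (w : ℝ → StrongDual ℝ (Sob L 1)) : Prop where
  represents : ∀ᵐ t ∂(volume.restrict (Ioi (0 : ℝ))), f t =ᵐ[leb L] dx 0 (F t)
  memLp_top_H1 : ∀ T > 0, MemLp (fun t => (toH1 (F t))) ∞ (leb T)
  memLp_two_H3 : ∀ T > 0, MemLp F 2 (leb T)
  contHolder : ∀ T > 0, ∀ α : ℝ≥0, α < 1 / 2 → ContHolder L T α f
  memLp_two_dual : ∀ T > 0, MemLp w 2 (leb T)
  isTimeDeriv : ∀ T > 0, IsTimeDeriv T (fun t => dxL2 0 (F t)) w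

/-- The regularized mobility `a_ε`. -/
def mob (ε s : ℝ) : ℝ := ε + max 0 s

/-- The flux in the first equation; `a, b` stand for `a_ε(f), a_ε(g)` and `p, q` for
`∂_x^3 f, ∂_x^3 g`. -/
def fluxF (R a b p q : ℝ) : ℝ :=
  a ^ 3 * p + R / 2 * (2 * a ^ 3 + 3 * a ^ 2 * b) * (p + q)

/-- The flux in the second equation, with the same conventions. -/
def fluxG (R μ a b p q : ℝ) : ℝ :=
  3 / 2 * a ^ 2 * b * p
    + R / 2 * (2 * μ * b ^ 3 + 3 * a ^ 2 * b + 6 * a * b ^ 2) * (p + q)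

/-- The energy functional on `H^1 × H^1`. -/
def energy {L : ℝ} (R : ℝ) (u v : Sob L 1) : ℝ :=
  1 / 2 * ∫ x, (|dx 1 u x| ^ 2 + R * |dx 1 (u + v) x| ^ 2) ∂(leb L)

/-- The normalized cosines. -/
def cosBasis (L : ℝ) (k : ℕ) (x : ℝ) : ℝ :=
  if k = 0 then √(1 / L) else √(2 / L) * Real.cos (k * Real.pi * x / L)

/-- `(u, v)` is a global Galerkin approximation of order `n`: both functions are combinations of the
first `n + 1` cosines with continuously differentiable coefficients on `[0, ∞)`, they start from the
truncated cosine series of `f₀, g₀`, and they solve the system when it is tested with these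
cosines. -/
def IsGalerkin {L : ℝ} (R μ ε : ℝ) (f₀ g₀ : Sob L 1) (n : ℕ) (u v : ℝ → ℝ → ℝ) : Prop :=
  ∃ p q : ℕ → ℝ → ℝ,
    (∀ k, ContDiffOn ℝ 1 (p k) (Ici 0) ∧ ContDiffOn ℝ 1 (q k) (Ici 0)) ∧
    (∀ t x, u t x = ∑ k ∈ Finset.range (n + 1), p k t * cosBasis L k x) ∧
    (∀ t x, v t x = ∑ k ∈ Finset.range (n + 1), q k t * cosBasis L k x) ∧
    (∀ k ≤ n, p k 0 = ∫ x, dx 0 f₀ x * cosBasis L k x ∂(leb L) ∧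
      q k 0 = ∫ x, dx 0 g₀ x * cosBasis L k x ∂(leb L)) ∧
    ∀ t ≥ 0, ∀ j ≤ n,
      ∫ x, derivWithin (fun s => u s x) (Ici 0) t * cosBasis L j x ∂(leb L)
        = ∫ x, fluxF R (mob ε (u t x)) (mob ε (v t x))
            (iteratedDeriv 3 (u t) x) (iteratedDeriv 3 (v t) x)
              * deriv (cosBasis L j) x ∂(leb L) ∧
      ∫ x, derivWithin (fun s => v s x) (Ici 0) t * cosBasis L j x ∂(leb L)
        = ∫ x, fluxG R μ (mob ε (u t x)) (mob ε (v t x))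
            (iteratedDeriv 3 (u t) x) (iteratedDeriv 3 (v t) x)
              * deriv (cosBasis L j) x ∂(leb L)

end

end ThinFilm

open ThinFilm

namespace ThinFilm

noncomputable section

/-! ### Global solutions of bounded, locally Lipschitz ordinary differential equations -/

/-! The argument is a Galerkin scheme in the cosines, carried out on the level of coefficient
sequences. The cosines are eigenfunctions of `-∂_x²`, so the Galerkin space contains `-∂_x²(f +
R(f+g))` and `-R ∂_x²(f+g)`. Testing the two equations with these functions shows that the energy
decreases at the rate `∫ H_f ∂_x³(f + R(f+g)) + R H_g ∂_x³(f+g)`, and this quadratic form is the sum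
of the three squares in the energy inequality (`dissip_eq_inner`, `sum_wave_sq_mul_flux`). Testing
with the constant function gives conservation of mass. Energy and mass bound every coefficient,
hence the Galerkin system, whose right-hand side is locally Lipschitz, has solutions for all
positive times (`exists_isGalerkinCurve`).

The same two quantities give bounds that are uniform in the order (`exists_galerkin_bounds`). They
control `f` and `g` in `H^1`, therefore in the supremum norm. Since the mobility is at least `ε` and
now also bounded above, the dissipation controls the third derivatives in `L₂(0, T; L₂)`.
Consequently the fluxes are bounded in that space, and each coefficient is Hölder continuous in time
with exponent `1/2`.

Arzelà–Ascoli yields a subsequence along which all coefficients converge locally uniformly in time.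
The bound on `∑ k² c_k²` makes the tails of `∑ (1 + k^α) |c_k|` uniformly small precisely because `∑
k^(2α-2)` converges for `α < 1/2`; so convergence of single coefficients already implies convergence
in `C([0, T], C^α)` (`tendsto_tsum_holderWt`). For almost every time the limit has summable `k⁶
c_k²`, which places its series in `H^3` and lets the Neumann condition be read off termwise.

In the limit of the fluxes the mobilities converge uniformly and the third derivatives weakly
(`tendsto_integral_inner_field`). This gives the equation tested with every cosine, and the density
of cosines in `H^1` gives it in the dual space. The energy inequality follows from the Galerkin
energy identity by weak lower semicontinuity of the dissipation and by truncating the energy to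
finitely many modes. -/

theorem exists_integralCurve_of_bounded {E : Type*} [NormedAddCommGroup E] [NormedSpace ℝ E]
    [ProperSpace E] {v : E → E} (hv : LocallyLipschitz v) {B : ℝ≥0} (hB : ∀ y, ‖v y‖ ≤ B)
    (y₀ : E) : ∃ y : ℝ → E, y 0 = y₀ ∧ ∀ t, HasDerivAt y (v (y t)) t := by
  have lip (r : ℝ) (c : E) : ∃ K, LipschitzOnWith K v (Metric.closedBall c r) :=
    hv.locallyLipschitzOn.exists_lipschitzOnWith_of_compact (isCompact_closedBall c r)
  have ex (m : ℕ) : ∃ y : ℝ → E, y 0 = y₀ ∧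
      ∀ t ∈ Icc (-(m + 1) : ℝ) (m + 1), HasDerivWithinAt y (v (y t)) (Icc (-(m + 1) : ℝ) (m + 1)) t := by
    -- With speed at most `B`, a curve stays within `B * (m + 1)` of its start during time `m + 1`.
    -- The Lipschitz constant of this ball depends on `m`, but Picard–Lindelöf then needs no shorter
    -- interval.
    obtain ⟨K, hK⟩ := lip ((B * (m + 1) : ℝ≥0) : ℝ) y₀
    have h0 : (0 : ℝ) ∈ Icc (-(m + 1) : ℝ) (m + 1) := ⟨by linarith [m.cast_nonneg (α := ℝ)], by positivity⟩
    have hp : IsPicardLindelof (fun _ : ℝ => v) (⟨0, h0⟩ : Icc (-(m + 1) : ℝ) (m + 1)) y₀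
        (B * (m + 1)) 0 B K :=
      IsPicardLindelof.of_time_independent (fun x _ => hB x) hK (by simp)
    exact hp.exists_eq_forall_mem_Icc_hasDerivWithinAt₀
  choose Y hY0 hY using ex
  have hder (m : ℕ) (t : ℝ) (ht : t ∈ Ioo (-(m + 1) : ℝ) (m + 1)) :
      HasDerivAt (Y m) (v (Y m t)) t :=
    (hY m t (Ioo_subset_Icc_self ht)).hasDerivAt (Icc_mem_nhds ht.1 ht.2)
  have uniq (m k : ℕ) (hmk : m ≤ k) : EqOn (Y m) (Y k) (Ioo (-(m + 1) : ℝ) (m + 1)) := by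
    have hmk' : (m : ℝ) ≤ k := by exact_mod_cast hmk
    have hsub : Icc (-(m + 1) : ℝ) (m + 1) ⊆ Icc (-(k + 1) : ℝ) (k + 1) :=
      Icc_subset_Icc (by linarith) (by linarith)
    have c1 : ContinuousOn (Y m) (Icc (-(m + 1) : ℝ) (m + 1)) :=
      fun t ht => (hY m t ht).continuousWithinAt
    have c2 : ContinuousOn (Y k) (Icc (-(m + 1) : ℝ) (m + 1)) :=
      fun t ht => ((hY k t (hsub ht)).mono hsub).continuousWithinAt
    obtain ⟨r1, h1⟩ := (isCompact_Icc.image_of_continuousOn c1).isBounded.subset_closedBall 0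
    obtain ⟨r2, h2⟩ := (isCompact_Icc.image_of_continuousOn c2).isBounded.subset_closedBall 0
    obtain ⟨K, hK⟩ := lip (max r1 r2) 0
    refine ODE_solution_unique_of_mem_Ioo (v := fun _ => v) (K := K)
      (s := fun _ => Metric.closedBall 0 (max r1 r2)) (t₀ := 0) (fun t _ => hK)
      ⟨by linarith [m.cast_nonneg (α := ℝ)], by positivity⟩ (fun t ht => ⟨hder m t ht, ?_⟩)
      (fun t ht => ⟨hder k t ⟨by linarith [ht.1], by linarith [ht.2]⟩, ?_⟩) (by rw [hY0, hY0])
    · exact Metric.closedBall_subset_closedBall (le_max_left _ _)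
        (h1 (mem_image_of_mem _ (Ioo_subset_Icc_self ht)))
    · exact Metric.closedBall_subset_closedBall (le_max_right _ _)
        (h2 (mem_image_of_mem _ (Ioo_subset_Icc_self ht)))
  have key (t : ℝ) (m : ℕ) (hm : |t| < m + 1) : Y ⌈|t|⌉₊ t = Y m t := by
    have hc : |t| < (⌈|t|⌉₊ : ℝ) + 1 := by linarith [Nat.le_ceil |t|]
    rcases le_total ⌈|t|⌉₊ m with h | h
    · exact uniq _ _ h (abs_lt.1 hc)
    · exact (uniq _ _ h (abs_lt.1 hm)).symm
  -- By uniqueness any interval that contains `t` in its interior gives the same value; `|t| <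
  -- ⌈|t|⌉₊ + 1` selects one.
  refine ⟨fun t => Y ⌈|t|⌉₊ t, by simp [hY0], fun t => ?_⟩
  have hc : |t| < ((⌈|t|⌉₊ + 1 : ℕ) : ℝ) := by push_cast; linarith [Nat.le_ceil |t|]
  have hev : (fun s => Y ⌈|s|⌉₊ s) =ᶠ[𝓝 t] Y (⌈|t|⌉₊ + 1) := by
    filter_upwards [continuous_abs.continuousAt.eventually_lt_const hc] with s hs
    exact key s _ (by linarith)
  have he : Y ⌈|t|⌉₊ t = Y (⌈|t|⌉₊ + 1) t := hev.eq_of_nhds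
  change HasDerivAt _ (v (Y ⌈|t|⌉₊ t)) t
  rw [he]
  exact (hder _ t (abs_lt.1 (by linarith))).congr_of_eventuallyEq hev

/-! ### Extraction of a locally uniformly convergent subsequence -/

/-- With the discrete topology on `ι`, the family becomes equicontinuous and pointwise bounded on `ι
× ℝ`. A single application of Arzelà–Ascoli there replaces a diagonal argument over the indices. -/
theorem exists_subseq_tendsto_of_modulus {ι : Type*} [Countable ι] (Q : ℕ → ι → ℝ → ℝ)
    (B : ι → ℝ) (hB : ∀ n k t, |Q n k t| ≤ B k) (C : ι → ℝ)
    (hC : ∀ n k s t, |Q n k t - Q n k s| ≤ C k * √|t - s|) :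
    ∃ (ν : ℕ → ℕ) (q : ι → ℝ → ℝ), StrictMono ν ∧ (∀ k, Continuous (q k)) ∧
      ∀ k, TendstoLocallyUniformly (fun n => Q (ν n) k) (q k) atTop := by
  let _ : TopologicalSpace ι := ⊥
  have : DiscreteTopology ι := ⟨rfl⟩
  have hmod (k : ι) (s : ℝ) : Tendsto (fun t => C k * √|t - s|) (𝓝 s) (𝓝 0) := by
    have : Continuous fun t => C k * √|t - s| := by fun_prop
    simpa using this.tendsto s
  have eqc (S : Type) (F : S → ι × ℝ → ℝ) (hF : ∀ a k s t, |F a (k, t) - F a (k, s)| ≤ C k * √|t - s|) :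
      Equicontinuous F := by
    rintro ⟨k, s⟩
    rw [Metric.equicontinuousAt_iff_right]
    intro e he
    rw [nhds_prod_eq, nhds_discrete, pure_prod, eventually_map]
    filter_upwards [(hmod k s).eventually_lt_const he] with t ht a
    rw [dist_comm, Real.dist_eq]
    exact (hF a k s t).trans_lt ht
  have hQc (n : ℕ) : Continuous fun z : ι × ℝ => Q n z.1 z.2 :=
    (eqc ℕ (fun n z => Q n z.1 z.2) fun n k s t => hC n k s t).continuous n
  let S : Set C(ι × ℝ, ℝ) := {h | (∀ k t, h (k, t) ∈ Icc (-B k) (B k)) ∧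
    ∀ k s t, |h (k, t) - h (k, s)| ≤ C k * √|t - s|}
  have hScomp : IsCompact S := by
    have himg : ContinuousMap.toFun '' S = {h : ι × ℝ → ℝ | (∀ k t, h (k, t) ∈ Icc (-B k) (B k)) ∧
        ∀ k s t, |h (k, t) - h (k, s)| ≤ C k * √|t - s|} := by
      ext h
      constructor
      · rintro ⟨h, hh, rfl⟩
        exact hh
      · intro hh
        exact ⟨⟨h, (eqc Unit (fun _ => h) fun _ => hh.2).continuous ()⟩, hh, rfl⟩
    refine ArzelaAscoli.isCompact_of_equicontinuous S ?_ ?_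
    · rw [himg]
      refine (isCompact_univ_pi fun z : ι × ℝ => isCompact_Icc (a := -B z.1) (b := B z.1)).of_isClosed_subset
        ?_ fun h hh z _ => hh.1 z.1 z.2
      simp only [ofPred_and, ofPred_forall]
      refine IsClosed.inter (isClosed_iInter fun k => isClosed_iInter fun t =>
        isClosed_Icc.preimage (continuous_apply _)) (isClosed_iInter fun k =>
          isClosed_iInter fun s => isClosed_iInter fun t => isClosed_le ?_ continuous_const)
      fun_prop
    · rintro ⟨k, s⟩
      rw [Metric.equicontinuousAt_iff_right]
      intro e he
      rw [nhds_prod_eq, nhds_discrete, pure_prod, eventually_map]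
      filter_upwards [(hmod k s).eventually_lt_const he] with t ht a
      rw [dist_comm, Real.dist_eq]
      exact (a.2.2 k s t).trans_lt ht
  let x : ℕ → C(ι × ℝ, ℝ) := fun n => ⟨fun z => Q n z.1 z.2, hQc n⟩
  obtain ⟨h, -, ν, hν, hlim⟩ := hScomp.tendsto_subseq (x := x)
    fun n => ⟨fun k t => abs_le.1 (hB n k t), fun k s t => hC n k s t⟩
  refine ⟨ν, fun k t => h (k, t), hν, fun k => by fun_prop, fun k => ?_⟩
  have h2 := (ContinuousMap.tendsto_iff_tendstoLocallyUniformly.1 hlim)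
  exact h2.comp (fun t : ℝ => (k, t)) (by fun_prop)

end

end ThinFilm

/-! ### Inner products in `L₂(0, L)`, multiplication operators, sines and cosines -/

namespace ThinFilm

noncomputable section

variable {L : ℝ}

theorem inner_eq_integral (u v : Lp ℝ 2 (leb L)) : inner ℝ u v = ∫ x, u x * v x ∂(leb L) := by
  rw [L2.inner_def]
  exact integral_congr_ae (Eventually.of_forall fun x => by simp [mul_comm])

theorem ae_mem_Ioo (L : ℝ) : ∀ᵐ x ∂(leb L), x ∈ Ioo 0 L := ae_restrict_mem measurableSet_Ioo

/-- The wave numbers. -/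
def wave (L : ℝ) (k : ℕ) : ℝ := k * Real.pi / L

theorem wave_zero : wave L 0 = 0 := by simp [wave]

/-- The normalized sines. -/
def sinBasis (L : ℝ) (k : ℕ) (x : ℝ) : ℝ := √(2 / L) * Real.sin (wave L k * x)

theorem cosBasis_of_ne {k : ℕ} (hk : k ≠ 0) (x : ℝ) :
    cosBasis L k x = √(2 / L) * Real.cos (wave L k * x) := by
  rw [cosBasis, if_neg hk, wave, div_mul_eq_mul_div]

theorem sinBasis_zero (k : ℕ) : sinBasis L k 0 = 0 := by simp [sinBasis]

theorem abs_sinBasis_le (k : ℕ) (x : ℝ) : |sinBasis L k x| ≤ √(2 / L) := by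
  rw [sinBasis, abs_mul, abs_of_nonneg (Real.sqrt_nonneg _)]
  exact mul_le_of_le_one_right (Real.sqrt_nonneg _) (Real.abs_sin_le_one _)

theorem hasDerivAt_cosBasis (k : ℕ) (x : ℝ) :
    HasDerivAt (cosBasis L k) (-(wave L k) * sinBasis L k x) x := by
  by_cases hk : k = 0
  · subst hk
    rw [wave_zero, neg_zero, zero_mul]
    exact (hasDerivAt_const x (√(1 / L))).congr_of_eventuallyEq
      (Eventually.of_forall fun y => if_pos rfl)
  · have h := (((hasDerivAt_id x).const_mul (wave L k)).cos).const_mul (√(2 / L))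
    refine (h.congr_of_eventuallyEq (Eventually.of_forall fun y => cosBasis_of_ne hk y)).congr_deriv ?_
    simp only [sinBasis, id]; ring

theorem hasDerivAt_sinBasis (k : ℕ) (x : ℝ) :
    HasDerivAt (sinBasis L k) (wave L k * cosBasis L k x) x := by
  have h := (((hasDerivAt_id x).const_mul (wave L k)).sin).const_mul (√(2 / L))
  refine h.congr_deriv ?_
  by_cases hk : k = 0
  · subst hk; simp [wave_zero]
  · rw [cosBasis_of_ne hk]; simp only [id]; ring

theorem continuous_cosBasis (k : ℕ) : Continuous (cosBasis L k) :=
  continuous_iff_continuousAt.2 fun x => (hasDerivAt_cosBasis k x).continuousAt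

theorem continuous_sinBasis (k : ℕ) : Continuous (sinBasis L k) :=
  continuous_iff_continuousAt.2 fun x => (hasDerivAt_sinBasis k x).continuousAt

theorem deriv_cosBasis (k : ℕ) (x : ℝ) :
    deriv (cosBasis L k) x = -(wave L k) * sinBasis L k x := (hasDerivAt_cosBasis k x).deriv

/-! ### Multiplication by continuous functions on `L₂(0, L)` -/

variable [hL : Fact (0 < L)]

/-- Extension of a continuous function on `[0, L]` to the real line, constant on both sides. -/
def ext (c : C(Icc 0 L, ℝ)) : ℝ → ℝ := IccExtend hL.out.le c

theorem ext_of_mem (c : C(Icc 0 L, ℝ)) {x : ℝ} (hx : x ∈ Icc 0 L) : ext c x = c ⟨x, hx⟩ :=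
  IccExtend_of_mem _ _ hx

theorem continuous_ext (c : C(Icc 0 L, ℝ)) : Continuous (ext c) :=
  c.continuous.Icc_extend'

theorem abs_ext_le (c : C(Icc 0 L, ℝ)) (x : ℝ) : |ext c x| ≤ ‖c‖ := c.norm_coe_le_norm _

theorem memLp_ext_mul (c : C(Icc 0 L, ℝ)) (u : Lp ℝ 2 (leb L)) :
    MemLp (fun x => ext c x * u x) 2 (leb L) :=
  (Lp.memLp u).of_le_mul (c := ‖c‖)
    ((continuous_ext c).aestronglyMeasurable.mul (Lp.memLp u).1)
    (Eventually.of_forall fun x => by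
      rw [norm_mul]
      exact mul_le_mul_of_nonneg_right (abs_ext_le c x) (norm_nonneg _))

/-- Multiplication of a class in `L₂(0, L)` by a continuous function on `[0, L]`. -/
def mulOp : C(Icc 0 L, ℝ) →L[ℝ] Lp ℝ 2 (leb L) →L[ℝ] Lp ℝ 2 (leb L) :=
  LinearMap.mkContinuous₂
    (LinearMap.mk₂ ℝ (fun c u => (memLp_ext_mul c u).toLp _)
      (fun c d u => by
        ext1
        filter_upwards [(memLp_ext_mul (c + d) u).coeFn_toLp, (memLp_ext_mul c u).coeFn_toLp,
          (memLp_ext_mul d u).coeFn_toLp, Lp.coeFn_add ((memLp_ext_mul c u).toLp _)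
          ((memLp_ext_mul d u).toLp _)] with x h1 h2 h3 h4
        rw [h1, h4, Pi.add_apply, h2, h3, ← add_mul]; rfl)
      (fun r c u => by
        ext1
        filter_upwards [(memLp_ext_mul (r • c) u).coeFn_toLp, (memLp_ext_mul c u).coeFn_toLp,
          Lp.coeFn_smul r ((memLp_ext_mul c u).toLp _)] with x h1 h2 h4
        rw [h1, h4, Pi.smul_apply, h2, smul_eq_mul, ← mul_assoc]; rfl)
      (fun c u v => by
        ext1
        filter_upwards [(memLp_ext_mul c (u + v)).coeFn_toLp, (memLp_ext_mul c u).coeFn_toLp,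
          (memLp_ext_mul c v).coeFn_toLp, Lp.coeFn_add ((memLp_ext_mul c u).toLp _)
          ((memLp_ext_mul c v).toLp _), Lp.coeFn_add u v] with x h1 h2 h3 h4 h5
        rw [h1, h4, Pi.add_apply, h2, h3, h5, Pi.add_apply, mul_add])
      (fun r c u => by
        ext1
        filter_upwards [(memLp_ext_mul c (r • u)).coeFn_toLp, (memLp_ext_mul c u).coeFn_toLp,
          Lp.coeFn_smul r ((memLp_ext_mul c u).toLp _), Lp.coeFn_smul r u] with x h1 h2 h4 h5
        rw [h1, h4, Pi.smul_apply, h2, h5, Pi.smul_apply, smul_eq_mul, smul_eq_mul]; ring)) 1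
    (fun c u => by
      rw [one_mul]
      refine Lp.norm_le_mul_norm_of_ae_le_mul ?_
      filter_upwards [(memLp_ext_mul c u).coeFn_toLp] with x h1
      rw [LinearMap.mk₂_apply, h1, norm_mul]
      exact mul_le_mul_of_nonneg_right (abs_ext_le c x) (norm_nonneg _))

theorem mulOp_coeFn (c : C(Icc 0 L, ℝ)) (u : Lp ℝ 2 (leb L)) :
    mulOp c u =ᵐ[leb L] fun x => ext c x * u x :=
  (memLp_ext_mul c u).coeFn_toLp

theorem norm_mulOp_le (c : C(Icc 0 L, ℝ)) (u : Lp ℝ 2 (leb L)) : ‖mulOp c u‖ ≤ ‖c‖ * ‖u‖ := by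
  refine Lp.norm_le_mul_norm_of_ae_le_mul ?_
  filter_upwards [mulOp_coeFn c u] with x h1
  rw [h1, norm_mul]
  exact mul_le_mul_of_nonneg_right (abs_ext_le c x) (norm_nonneg _)

theorem inner_mulOp (c : C(Icc 0 L, ℝ)) (u v : Lp ℝ 2 (leb L)) :
    inner ℝ (mulOp c u) v = inner ℝ u (mulOp c v) := by
  rw [inner_eq_integral, inner_eq_integral]
  refine integral_congr_ae ?_
  filter_upwards [mulOp_coeFn c u, mulOp_coeFn c v] with x h1 h2
  rw [h1, h2]; ring

/-- The class in `L₂(0, L)` of a continuous function on `[0, L]`. -/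
def ofC : C(Icc 0 L, ℝ) →L[ℝ] Lp ℝ 2 (leb L) :=
  (ContinuousLinearMap.apply ℝ _ (Lp.const 2 (leb L) (1 : ℝ))).comp mulOp

theorem ofC_coeFn (c : C(Icc 0 L, ℝ)) : ofC c =ᵐ[leb L] ext c := by
  filter_upwards [mulOp_coeFn c (Lp.const 2 (leb L) (1 : ℝ)), Lp.coeFn_const (p := 2) (leb L) (1 : ℝ)]
    with x h1 h2
  change mulOp c (Lp.const 2 (leb L) (1 : ℝ)) x = _
  rw [h1, h2]; simp

theorem mulOp_ofC (c d : C(Icc 0 L, ℝ)) : mulOp c (ofC d) = ofC (c * d) := by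
  ext1
  filter_upwards [mulOp_coeFn c (ofC d), ofC_coeFn d, ofC_coeFn (c * d)] with x h1 h2 h3
  rw [h1, h2, h3]; rfl

theorem integral_leb (h : ℝ → ℝ) : ∫ x, h x ∂(leb L) = ∫ x in (0 : ℝ)..L, h x := by
  rw [intervalIntegral.integral_of_le hL.out.le, integral_Ioc_eq_integral_Ioo]

/-! ### Sines and cosines -/

theorem wave_nonneg (k : ℕ) : 0 ≤ wave L k := by
  have := hL.out; have := Real.pi_pos; unfold wave; positivity

theorem wave_pos {k : ℕ} (hk : k ≠ 0) : 0 < wave L k := by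
  have := hL.out; have := Real.pi_pos; unfold wave
  have : (0 : ℝ) < k := by exact_mod_cast Nat.pos_of_ne_zero hk
  positivity

theorem sinBasis_right (k : ℕ) : sinBasis L k L = 0 := by
  have := hL.out.ne'
  rw [sinBasis, wave, div_mul_cancel₀ _ this, Real.sin_nat_mul_pi, mul_zero]

theorem abs_cosBasis_le (k : ℕ) (x : ℝ) : |cosBasis L k x| ≤ √(2 / L) := by
  have := hL.out
  by_cases hk : k = 0
  · subst hk
    rw [cosBasis, if_pos rfl, abs_of_nonneg (Real.sqrt_nonneg _)]
    gcongr; norm_num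
  · rw [cosBasis_of_ne hk, abs_mul, abs_of_nonneg (Real.sqrt_nonneg _)]
    exact mul_le_of_le_one_right (Real.sqrt_nonneg _) (Real.abs_cos_le_one _)

/-- The cosines as elements of `C([0, L])`. -/
def cosC (k : ℕ) : C(Icc 0 L, ℝ) := ⟨fun x => cosBasis L k x, (continuous_cosBasis k).comp continuous_subtype_val⟩

/-- The sines as elements of `C([0, L])`. -/
def sinC (k : ℕ) : C(Icc 0 L, ℝ) := ⟨fun x => sinBasis L k x, (continuous_sinBasis k).comp continuous_subtype_val⟩

theorem ext_cosC (k : ℕ) {x : ℝ} (hx : x ∈ Icc 0 L) :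
    ext (cosC k : C(Icc 0 L, ℝ)) x = cosBasis L k x := ext_of_mem _ hx

theorem ext_sinC (k : ℕ) {x : ℝ} (hx : x ∈ Icc 0 L) :
    ext (sinC k : C(Icc 0 L, ℝ)) x = sinBasis L k x := ext_of_mem _ hx

theorem norm_cosC_le (k : ℕ) : ‖(cosC k : C(Icc 0 L, ℝ))‖ ≤ √(2 / L) :=
  (ContinuousMap.norm_le _ (Real.sqrt_nonneg _)).2 fun x => abs_cosBasis_le k x

/-- The cosines as elements of `L₂(0, L)`. -/
def cosE (k : ℕ) : Lp ℝ 2 (leb L) := ofC (cosC k)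

/-- The sines as elements of `L₂(0, L)`. -/
def sinE (k : ℕ) : Lp ℝ 2 (leb L) := ofC (sinC k)

theorem cosE_coeFn (k : ℕ) : (cosE k : Lp ℝ 2 (leb L)) =ᵐ[leb L] cosBasis L k := by
  filter_upwards [ofC_coeFn (cosC k : C(Icc 0 L, ℝ)), ae_mem_Ioo L] with x h1 h2
  rw [cosE, h1, ext_cosC k (Ioo_subset_Icc_self h2)]

theorem sinE_coeFn (k : ℕ) : (sinE k : Lp ℝ 2 (leb L)) =ᵐ[leb L] sinBasis L k := by
  filter_upwards [ofC_coeFn (sinC k : C(Icc 0 L, ℝ)), ae_mem_Ioo L] with x h1 h2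
  rw [sinE, h1, ext_sinC k (Ioo_subset_Icc_self h2)]

theorem integral_cos_wave (k : ℕ) (hk : k ≠ 0) : ∫ x in (0 : ℝ)..L, Real.cos (wave L k * x) = 0 := by
  have h := wave_pos (L := L) hk
  rw [intervalIntegral.integral_comp_mul_left (fun y => Real.cos y) h.ne', integral_cos]
  have : wave L k * L = k * Real.pi := by rw [wave, div_mul_cancel₀ _ hL.out.ne']
  simp [this]

theorem integral_cos_wave_mul (j k : ℕ) (hjk : j ≠ k) :
    ∫ x in (0 : ℝ)..L, Real.cos (wave L j * x) * Real.cos (wave L k * x) = 0 ∧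
    ∫ x in (0 : ℝ)..L, Real.sin (wave L j * x) * Real.sin (wave L k * x) = 0 := by
  wlog h : j < k generalizing j k
  · have := this k j hjk.symm (by omega)
    simpa only [mul_comm] using this
  have e1 : wave L (k - j) = wave L k - wave L j := by
    rw [wave, Nat.cast_sub h.le]; simp only [wave]; ring
  have e2 : wave L (k + j) = wave L k + wave L j := by simp only [wave]; push_cast; ring
  have i1 := integral_cos_wave (L := L) (k - j) (by omega)
  have i2 := integral_cos_wave (L := L) (k + j) (by omega)
  have c1 (m : ℕ) : IntervalIntegrable (fun x => Real.cos (wave L m * x)) volume 0 L :=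
    (by fun_prop : Continuous fun x => Real.cos (wave L m * x)).intervalIntegrable _ _
  constructor
  · calc _ = ∫ x in (0 : ℝ)..L, (1 / 2 : ℝ) * (Real.cos (wave L (k - j) * x) + Real.cos (wave L (k + j) * x)) := by
          congr 1; ext x
          rw [e1, e2, sub_mul, add_mul, Real.cos_sub, Real.cos_add]; ring
      _ = 0 := by
          rw [intervalIntegral.integral_const_mul, intervalIntegral.integral_add (c1 _) (c1 _), i1, i2]; simp
  · calc _ = ∫ x in (0 : ℝ)..L, (1 / 2 : ℝ) * (Real.cos (wave L (k - j) * x) - Real.cos (wave L (k + j) * x)) := by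
          congr 1; ext x
          rw [e1, e2, sub_mul, add_mul, Real.cos_sub, Real.cos_add]; ring
      _ = 0 := by
          rw [intervalIntegral.integral_const_mul, intervalIntegral.integral_sub (c1 _) (c1 _), i1, i2]; simp

theorem integral_cos_sq_wave (k : ℕ) (hk : k ≠ 0) :
    ∫ x in (0 : ℝ)..L, Real.cos (wave L k * x) * Real.cos (wave L k * x) = L / 2 ∧
    ∫ x in (0 : ℝ)..L, Real.sin (wave L k * x) * Real.sin (wave L k * x) = L / 2 := by
  have e2 : wave L (2 * k) = 2 * wave L k := by simp only [wave]; push_cast; ring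
  have i2 := integral_cos_wave (L := L) (2 * k) (by omega)
  have c1 (m : ℕ) : IntervalIntegrable (fun x => Real.cos (wave L m * x)) volume 0 L :=
    (by fun_prop : Continuous fun x => Real.cos (wave L m * x)).intervalIntegrable _ _
  have c0 : IntervalIntegrable (fun _ : ℝ => (1 : ℝ)) volume 0 L := intervalIntegrable_const
  constructor
  · calc _ = ∫ x in (0 : ℝ)..L, (1 / 2 : ℝ) * (1 + Real.cos (wave L (2 * k) * x)) := by
          congr 1; ext x
          rw [e2, mul_assoc, Real.cos_two_mul]; ring
      _ = L / 2 := by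
          rw [intervalIntegral.integral_const_mul, intervalIntegral.integral_add c0 (c1 _), i2]; simp; ring
  · calc _ = ∫ x in (0 : ℝ)..L, (1 / 2 : ℝ) * (1 - Real.cos (wave L (2 * k) * x)) := by
          congr 1; ext x
          rw [e2, mul_assoc, Real.cos_two_mul, Real.cos_sq']; ring
      _ = L / 2 := by
          rw [intervalIntegral.integral_const_mul, intervalIntegral.integral_sub c0 (c1 _), i2]; simp; ring

theorem inner_cosE (j k : ℕ) :
    inner ℝ (cosE j : Lp ℝ 2 (leb L)) (cosE k) = if j = k then 1 else 0 := by
  have hL0 := hL.out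
  have s2 : √(2 / L) * √(2 / L) = 2 / L := Real.mul_self_sqrt (by positivity)
  have s1 : √(1 / L) * √(1 / L) = 1 / L := Real.mul_self_sqrt (by positivity)
  have e : inner ℝ (cosE j : Lp ℝ 2 (leb L)) (cosE k) = ∫ x in (0 : ℝ)..L, cosBasis L j x * cosBasis L k x := by
    rw [inner_eq_integral, ← integral_leb]
    refine integral_congr_ae ?_
    filter_upwards [cosE_coeFn (L := L) j, cosE_coeFn (L := L) k] with x h1 h2
    rw [h1, h2]
  rw [e]
  by_cases hj : j = 0 <;> by_cases hk : k = 0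
  · subst hj hk
    simp only [cosBasis, if_true, s1, intervalIntegral.integral_const, smul_eq_mul]
    field_simp; ring
  · subst hj
    rw [if_neg (Ne.symm hk)]
    have e0 (x : ℝ) : cosBasis L 0 x = √(1 / L) := if_pos rfl
    simp only [cosBasis_of_ne hk, e0, intervalIntegral.integral_const_mul, integral_cos_wave k hk, mul_zero]
  · subst hk
    rw [if_neg hj]
    have e0 (x : ℝ) : cosBasis L 0 x = √(1 / L) := if_pos rfl
    simp only [cosBasis_of_ne hj, e0, intervalIntegral.integral_mul_const,
      intervalIntegral.integral_const_mul, integral_cos_wave j hj, mul_zero, zero_mul]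
  · have e3 (x : ℝ) : cosBasis L j x * cosBasis L k x
        = 2 / L * (Real.cos (wave L j * x) * Real.cos (wave L k * x)) := by
      rw [cosBasis_of_ne hj, cosBasis_of_ne hk]; linear_combination (Real.cos (wave L j * x) * Real.cos (wave L k * x)) * s2
    simp only [e3, intervalIntegral.integral_const_mul]
    split_ifs with h
    · subst h; rw [(integral_cos_sq_wave j hj).1]; field_simp
    · rw [(integral_cos_wave_mul j k h).1, mul_zero]

theorem inner_sinE (j k : ℕ) :
    inner ℝ (sinE j : Lp ℝ 2 (leb L)) (sinE k) = if j = k ∧ j ≠ 0 then 1 else 0 := by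
  have hL0 := hL.out
  have s2 : √(2 / L) * √(2 / L) = 2 / L := Real.mul_self_sqrt (by positivity)
  have e : inner ℝ (sinE j : Lp ℝ 2 (leb L)) (sinE k) =
      ∫ x in (0 : ℝ)..L, 2 / L * (Real.sin (wave L j * x) * Real.sin (wave L k * x)) := by
    rw [inner_eq_integral, ← integral_leb]
    refine integral_congr_ae ?_
    filter_upwards [sinE_coeFn (L := L) j, sinE_coeFn (L := L) k] with x h1 h2
    rw [h1, h2, sinBasis, sinBasis]; linear_combination (Real.sin (wave L j * x) * Real.sin (wave L k * x)) * s2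
  rw [e, intervalIntegral.integral_const_mul]
  split_ifs with h
  · obtain ⟨rfl, h0⟩ := h
    rw [(integral_cos_sq_wave j h0).2]; field_simp
  · by_cases h0 : j = 0
    · subst h0; simp [wave_zero]
    · rw [(integral_cos_wave_mul j k fun hjk => h ⟨hjk, h0⟩).2, mul_zero]

theorem orthonormal_cosE : Orthonormal ℝ (cosE : ℕ → Lp ℝ 2 (leb L)) :=
  orthonormal_iff_ite.2 inner_cosE

theorem orthonormal_sinE : Orthonormal ℝ (fun k => sinE (k + 1) : ℕ → Lp ℝ 2 (leb L)) :=
  orthonormal_iff_ite.2 fun j k => by rw [inner_sinE]; simp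

theorem sinE_zero : (sinE 0 : Lp ℝ 2 (leb L)) = 0 := by
  rw [← inner_self_eq_zero (𝕜 := ℝ), inner_sinE]; simp

end

end ThinFilm

namespace ThinFilm

noncomputable section

/-! ### Completeness of the trigonometric systems -/

section Completeness

variable {L : ℝ} [hL : Fact (0 < L)]

theorem eq_zero_of_inner_ofC (u : Lp ℝ 2 (leb L)) (h : ∀ c : C(Icc 0 L, ℝ), inner ℝ u (ofC c) = 0) :
    u = 0 := by
  refine (BoundedContinuousFunction.toLp_denseRange ℝ (leb L) ℝ (p := 2)
    (by simp)).eq_zero_of_inner_left ℝ fun g => ?_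
  refine Eq.trans ?_ (h (g.toContinuousMap.restrict (Icc 0 L)))
  congr 1
  ext1
  filter_upwards [ofC_coeFn (g.toContinuousMap.restrict (Icc 0 L)), ae_mem_Ioo L,
    BoundedContinuousFunction.coeFn_toLp (p := 2) (leb L) (𝕜 := ℝ) g] with x h1 h2 h3
  rw [h1, h3, ext_of_mem _ (Ioo_subset_Icc_self h2)]
  rfl

/-- Stone–Weierstrass for the algebra generated by the first cosine, which is injective on `[0, L]`
and so separates points. -/
theorem eq_zero_of_inner_cosE (u : Lp ℝ 2 (leb L)) (h : ∀ k, inner ℝ u (cosE k) = 0) : u = 0 := by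
  have hL0 := hL.out
  let c (k : ℕ) : C(Icc 0 L, ℝ) := ⟨fun x => Real.cos (wave L k * x), by fun_prop⟩
  have hc0 : c 0 = 1 := by ext x; simp [c, wave_zero]
  have hck (k : ℕ) : inner ℝ u (ofC (c k)) = 0 := by
    obtain ⟨r, hr⟩ : ∃ r : ℝ, c k = r • cosC k := by
      by_cases hk : k = 0
      · subst hk
        refine ⟨(√(1 / L))⁻¹, ?_⟩
        ext x
        have : √(1 / L) ≠ 0 := by positivity
        simp only [hc0, ContinuousMap.one_apply, ContinuousMap.smul_apply, cosC, ContinuousMap.coe_mk,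
          cosBasis, if_true, smul_eq_mul]
        rw [inv_mul_cancel₀ this]
      · refine ⟨(√(2 / L))⁻¹, ?_⟩
        ext x
        have : √(2 / L) ≠ 0 := by positivity
        simp only [c, ContinuousMap.smul_apply, cosC, ContinuousMap.coe_mk, smul_eq_mul]
        rw [cosBasis_of_ne hk, inv_mul_cancel_left₀ this]
    rw [hr, map_smul, inner_smul_right]
    exact mul_eq_zero_of_right _ (h k)
  have hrec (k : ℕ) : c 1 * c (k + 1) = (1 / 2 : ℝ) • (c (k + 2) + c k) := by
    ext x
    simp only [c, ContinuousMap.mul_apply, ContinuousMap.smul_apply, ContinuousMap.add_apply,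
      ContinuousMap.coe_mk, smul_eq_mul]
    have e1 : wave L (k + 2) * x = wave L (k + 1) * x + wave L 1 * x := by
      simp only [wave]; push_cast; ring
    have e2 : wave L k * x = wave L (k + 1) * x - wave L 1 * x := by
      simp only [wave]; push_cast; ring
    rw [e1, e2, Real.cos_add, Real.cos_sub]; ring
  -- The recurrence keeps products of cosines in the span of cosines, so orthogonality to cosines
  -- extends to all polynomials in `c 1`.
  have hpow (m : ℕ) : ∀ k, inner ℝ u (ofC (c 1 ^ m * c k)) = 0 := by
    induction m with
    | zero => intro k; simpa using hck k
    | succ m ih =>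
      intro k
      cases k with
      | zero => rw [hc0, mul_one, pow_succ]; exact ih 1
      | succ k =>
        rw [pow_succ, mul_assoc, hrec, mul_smul_comm, mul_add, map_smul, map_add, inner_smul_right,
          inner_add_right, ih, ih]; simp
  have hsep : (Algebra.adjoin ℝ {c 1}).SeparatesPoints := by
    intro x y hxy
    refine ⟨c 1, ⟨c 1, Algebra.self_mem_adjoin_singleton ℝ (c 1), rfl⟩, fun he => hxy ?_⟩
    have hw (z : Icc 0 L) : wave L 1 * z ∈ Icc 0 Real.pi := by
      have := Real.pi_pos
      refine ⟨mul_nonneg (wave_nonneg 1) z.2.1, ?_⟩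
      have h1 : wave L 1 * L = Real.pi := by rw [wave, div_mul_cancel₀ _ hL0.ne']; simp
      rw [← h1]
      exact mul_le_mul_of_nonneg_left z.2.2 (wave_nonneg 1)
    have := Real.injOn_cos (hw x) (hw y) he
    exact Subtype.ext (mul_left_cancel₀ (wave_pos one_ne_zero).ne' this)
  have htop := ContinuousMap.subalgebra_topologicalClosure_eq_top_of_separatesPoints _ hsep
  refine eq_zero_of_inner_ofC u fun g => ?_
  have hg : g ∈ closure ((Algebra.adjoin ℝ {c 1} : Subalgebra ℝ C(Icc 0 L, ℝ)) : Set C(Icc 0 L, ℝ)) := by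
    rw [← Subalgebra.topologicalClosure_coe, htop]; trivial
  have hcl : IsClosed {g : C(Icc 0 L, ℝ) | inner ℝ u (ofC g) = 0} :=
    isClosed_eq (by fun_prop) continuous_const
  refine closure_minimal (fun a ha => ?_) hcl hg
  rw [SetLike.mem_coe, Algebra.adjoin_singleton_eq_range_aeval] at ha
  obtain ⟨p, rfl⟩ := ha
  change inner ℝ u (ofC (Polynomial.aeval (c 1) p)) = 0
  rw [Polynomial.aeval_eq_sum_range, map_sum, inner_sum]
  refine Finset.sum_eq_zero fun i _ => ?_
  have := hpow i 0
  rw [hc0, mul_one] at this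
  rw [map_smul, inner_smul_right, this, mul_zero]

/-- The product of the first sine with a cosine is a combination of sines. Hence the first sine
times `u` is orthogonal to all cosines and vanishes, and the first sine is positive inside the
interval. -/
theorem eq_zero_of_inner_sinE (u : Lp ℝ 2 (leb L)) (h : ∀ k, inner ℝ u (sinE k) = 0) : u = 0 := by
  have hL0 := hL.out
  have hw : mulOp (sinC 1) u = 0 := by
    refine eq_zero_of_inner_cosE _ fun k => ?_
    rw [inner_mulOp, cosE, mulOp_ofC]
    cases k with
    | zero =>
      have e : sinC 1 * cosC 0 = √(1 / L) • (sinC 1 : C(Icc 0 L, ℝ)) := by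
        ext x
        simp [sinC, cosC, cosBasis, mul_comm]
      rw [e, map_smul, inner_smul_right]
      exact mul_eq_zero_of_right _ (h 1)
    | succ k =>
      have e : sinC 1 * cosC (k + 1) =
          (√(2 / L) / 2) • (sinC (k + 2) - sinC k : C(Icc 0 L, ℝ)) := by
        ext x
        simp only [sinC, cosC, ContinuousMap.mul_apply, ContinuousMap.smul_apply,
          ContinuousMap.sub_apply, ContinuousMap.coe_mk, smul_eq_mul, sinBasis]
        have e1 : wave L (k + 2) * x = wave L (k + 1) * x + wave L 1 * x := by
          simp only [wave]; push_cast; ring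
        have e2 : wave L k * x = wave L (k + 1) * x - wave L 1 * x := by
          simp only [wave]; push_cast; ring
        rw [cosBasis_of_ne (Nat.succ_ne_zero k), e1, e2, Real.sin_add, Real.sin_sub]; ring
      have h1 := h (k + 2)
      have h2 := h k
      rw [sinE] at h1 h2
      rw [e, map_smul, map_sub, inner_smul_right, inner_sub_right, h1, h2]; simp
  ext1
  filter_upwards [mulOp_coeFn (sinC 1) u, ae_mem_Ioo L, Lp.coeFn_zero ℝ 2 (leb L)] with x h1 h2 h3
  rw [hw, h3, ext_sinC 1 (Ioo_subset_Icc_self h2)] at h1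
  rw [h3]
  have hs : 0 < sinBasis L 1 x := by
    have : wave L 1 * L = Real.pi := by rw [wave, div_mul_cancel₀ _ hL0.ne']; simp
    have hp := wave_pos (L := L) one_ne_zero
    refine mul_pos (by positivity) (Real.sin_pos_of_pos_of_lt_pi (mul_pos hp h2.1) ?_)
    rw [← this]
    exact mul_lt_mul_of_pos_left h2.2 hp
  exact (mul_eq_zero.1 h1.symm).resolve_left hs.ne'

/-- The Hilbert basis of sines. -/
def sinHilbert : HilbertBasis ℕ ℝ (Lp ℝ 2 (leb L)) :=
  HilbertBasis.mkOfOrthogonalEqBot orthonormal_sinE ((Submodule.eq_bot_iff _).2 fun u hu =>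
    eq_zero_of_inner_sinE u fun k => by
      rw [real_inner_comm]
      cases k with
      | zero => rw [sinE_zero, inner_zero_left]
      | succ k => exact hu _ (Submodule.subset_span ⟨k, rfl⟩))

theorem coe_sinHilbert : (sinHilbert : ℕ → Lp ℝ 2 (leb L)) = fun k => sinE (k + 1) :=
  HilbertBasis.coe_mkOfOrthogonalEqBot _ _

end Completeness

/-! ### Weak derivatives and Sobolev spaces -/

section Weak

variable {L : ℝ}

theorem IsWeakDeriv.congr {u v u' v' : ℝ → ℝ} (h : IsWeakDeriv L u v) (hu : u' =ᵐ[leb L] u)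
    (hv : v' =ᵐ[leb L] v) : IsWeakDeriv L u' v' := by
  intro φ hφ
  rw [integral_congr_ae (g := fun x => u x * deriv φ x), integral_congr_ae (f := fun x => v' x * φ x)
    (g := fun x => v x * φ x), h φ hφ]
  · filter_upwards [hv] with x hx; rw [hx]
  · filter_upwards [hu] with x hx; rw [hx]

theorem IsTest.eq_zero_of_notMem {φ : ℝ → ℝ} (h : IsTest L φ) {x : ℝ} (hx : x ∉ Ioo 0 L) : φ x = 0 :=
  image_eq_zero_of_notMem_tsupport fun hx' => hx (h.2.2 hx')

theorem isWeakDeriv_of_hasDerivAt [hL : Fact (0 < L)] {u v : ℝ → ℝ} (h : ∀ x, HasDerivAt u (v x) x)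
    (hv : Continuous v) : IsWeakDeriv L u v := by
  intro φ hφ
  have hd : ContDiff ℝ 1 φ := hφ.1.of_le (by simp)
  rw [integral_leb, integral_leb, intervalIntegral.integral_mul_deriv_eq_deriv_mul (u := u) (v := φ)
    (u' := v) (v' := deriv φ) (fun x _ => h x)
    (fun x _ => (hd.differentiable (by simp) x).hasDerivAt) (hv.intervalIntegrable _ _)
    ((hd.continuous_deriv le_rfl).intervalIntegrable _ _)]
  rw [hφ.eq_zero_of_notMem (x := L) (by simp), hφ.eq_zero_of_notMem (x := 0) (by simp)]
  ring

theorem integral_mul_eq_inner (u : Lp ℝ 2 (leb L)) {φ : ℝ → ℝ} (hφ : MemLp φ 2 (leb L)) :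
    ∫ x, u x * φ x ∂(leb L) = inner ℝ u (hφ.toLp φ) := by
  rw [inner_eq_integral]
  refine integral_congr_ae ?_
  filter_upwards [hφ.coeFn_toLp] with x hx
  rw [hx]

/-- Each test function imposes an equation between two continuous functionals. The resulting
completeness is needed for series in `H^3` and for orthogonal complements in `H^1`. -/
theorem isClosed_Sob (k : ℕ) :
    IsClosed ((Sob L k : Submodule ℝ (PiLp 2 (fun _ : Fin (k + 1) => Lp ℝ 2 (leb L)))) :
      Set (PiLp 2 (fun _ : Fin (k + 1) => Lp ℝ 2 (leb L)))) := by
  have : ((Sob L k : Submodule ℝ (PiLp 2 (fun _ : Fin (k + 1) => Lp ℝ 2 (leb L)))) :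
      Set (PiLp 2 (fun _ : Fin (k + 1) => Lp ℝ 2 (leb L)))) =
      ⋂ (j : Fin k) (φ : ℝ → ℝ) (_ : IsTest L φ),
        {U | ∫ x, U j.castSucc x * deriv φ x ∂(leb L) = -∫ x, U j.succ x * φ x ∂(leb L)} := by
    ext U; simp only [mem_iInter]; exact Iff.rfl
  rw [this]
  refine isClosed_iInter fun j => isClosed_iInter fun φ => isClosed_iInter fun hφ => ?_
  have h1 : MemLp φ 2 (leb L) := hφ.1.continuous.memLp_of_hasCompactSupport hφ.2.1
  have h2 : MemLp (deriv φ) 2 (leb L) :=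
    (hφ.1.continuous_deriv (by simp)).memLp_of_hasCompactSupport hφ.2.1.deriv
  simp only [integral_mul_eq_inner _ h1, integral_mul_eq_inner _ h2]
  exact isClosed_eq (by fun_prop) (by fun_prop)

instance completeSpace_Sob (k : ℕ) : CompleteSpace (Sob L k) := (isClosed_Sob k).completeSpace_coe

/-- Compact support of the test function can be relaxed to vanishing at the endpoints: multiply `w`
by cutoffs. Their derivatives grow like `m` in layers of width of order `1/m`, but there `w` is of
order `1/m`, so the products stay bounded and dominated convergence applies. -/
theorem IsWeakDeriv.integral_mul_deriv {u v w : ℝ → ℝ} (h : IsWeakDeriv L u v)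
    (hu : Integrable u (leb L)) (hv : Integrable v (leb L)) (hw : ContDiff ℝ ∞ w)
    (hw0 : w 0 = 0) (hwL : w L = 0) :
    ∫ x, u x * deriv w x ∂(leb L) = -∫ x, v x * w x ∂(leb L) := by
  let S := Real.smoothTransition
  have hS : ContDiff ℝ ∞ S := Real.smoothTransition.contDiff
  have hS1 (s : ℝ) : |S s| ≤ 1 := by
    rw [abs_of_nonneg (Real.smoothTransition.nonneg s)]; exact Real.smoothTransition.le_one s
  have hSd : Continuous (deriv S) := hS.continuous_deriv (by simp)
  have hwd : Continuous (deriv w) := hw.continuous_deriv (by simp)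
  have hSone (s : ℝ) (hs : 1 < s) : deriv S s = 0 := by
    have : S =ᶠ[𝓝 s] fun _ => 1 := by
      filter_upwards [lt_mem_nhds hs] with r hr
      exact Real.smoothTransition.one_of_one_le hr.le
    rw [this.deriv_eq, deriv_const]
  obtain ⟨B, hB⟩ := isCompact_Icc.exists_bound_of_continuousOn (s := Icc (-1 : ℝ) 1) hSd.continuousOn
  obtain ⟨C, hC⟩ := isCompact_Icc.exists_bound_of_continuousOn (s := Icc 0 L) hwd.continuousOn
  obtain ⟨D, hD⟩ := isCompact_Icc.exists_bound_of_continuousOn (s := Icc 0 L) hw.continuous.continuousOn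
  have hlip {x y : ℝ} (hx : x ∈ Icc 0 L) (hy : y ∈ Icc 0 L) : ‖w y - w x‖ ≤ C * ‖y - x‖ :=
    (convex_Icc 0 L).norm_image_sub_le_of_norm_deriv_le
      (fun z _ => hw.differentiable (by simp) z) hC hx hy
  -- The derivative of the transition function vanishes beyond `1`, so only `s ≤ 2` matters. This is
  -- the bound on distance times cutoff derivative in scaled form.
  have hdecay (s : ℝ) (hs : 0 ≤ s) : s * |deriv S (s - 1)| ≤ 2 * |B| := by
    by_cases h2 : s ≤ 2
    · have h3 := hB (s - 1) ⟨by linarith, by linarith⟩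
      rw [Real.norm_eq_abs] at h3
      exact mul_le_mul h2 (h3.trans (le_abs_self B)) (abs_nonneg _) (by norm_num)
    · rw [hSone _ (by linarith)]; simp
  -- For `m > 0` this vanishes within distance `1/m` of either endpoint and equals `1` at points
  -- whose distance from both is at least `2/m`.
  let η (m x : ℝ) : ℝ := S (m * x - 1) * S (m * (L - x) - 1)
  let φ (m x : ℝ) : ℝ := w x * η m x
  have hφd (m x : ℝ) : HasDerivAt (φ m) (deriv w x * η m x + w x *
      (deriv S (m * x - 1) * m * S (m * (L - x) - 1) + S (m * x - 1) *
        (deriv S (m * (L - x) - 1) * -m))) x := by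
    have d1 : HasDerivAt (fun x => m * x - 1) m x := by
      simpa using ((hasDerivAt_id x).const_mul m).sub_const 1
    have d2 : HasDerivAt (fun x => m * (L - x) - 1) (-m) x := by
      simpa using (((hasDerivAt_id x).const_sub L).const_mul m).sub_const 1
    have hSa (s : ℝ) : HasDerivAt S (deriv S s) s := (hS.differentiable (by simp) s).hasDerivAt
    exact ((hw.differentiable (by simp) x).hasDerivAt).mul
      (((hSa _).comp x d1).mul ((hSa _).comp x d2))
  have hφt (n : ℕ) : IsTest L (φ (n + 1)) := by
    have hm : (0 : ℝ) < n + 1 := by positivity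
    have hsub : Function.support (φ (n + 1)) ⊆ Icc (1 / (n + 1) : ℝ) (L - 1 / (n + 1)) := by
      intro x hx
      by_contra hcon
      refine hx ?_
      rw [mem_Icc, not_and_or, not_le, not_le] at hcon
      rcases hcon with hc | hc
      · have : S ((n + 1) * x - 1) = 0 := Real.smoothTransition.zero_of_nonpos (by
          rw [lt_div_iff₀ hm] at hc; linarith)
        simp [φ, η, this]
      · have : S ((n + 1) * (L - x) - 1) = 0 := Real.smoothTransition.zero_of_nonpos (by
          have : L - x < 1 / (n + 1) := by linarith
          rw [lt_div_iff₀ hm] at this; linarith)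
        simp [φ, η, this]
    refine ⟨?_, HasCompactSupport.of_support_subset_isCompact isCompact_Icc hsub,
      (closure_minimal hsub isClosed_Icc).trans fun x hx => ?_⟩
    · refine hw.mul ((hS.comp ?_).mul (hS.comp ?_)) <;> fun_prop
    · have : (0 : ℝ) < 1 / (n + 1) := by positivity
      exact ⟨by linarith [hx.1], by linarith [hx.2]⟩
  have hη (m x : ℝ) : |η m x| ≤ 1 := by
    rw [abs_mul]; exact mul_le_one₀ (hS1 _) (abs_nonneg _) (hS1 _)
  have hmx (x : ℝ) (hx : 0 < x) : ∀ᶠ n : ℕ in atTop, 1 < ((n : ℝ) + 1) * x - 1 := by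
    have : Tendsto (fun n : ℕ => ((n : ℝ) + 1) * x - 1) atTop atTop :=
      tendsto_atTop_add_const_right _ _ ((tendsto_atTop_add_const_right _ _
        tendsto_natCast_atTop_atTop).atTop_mul_const hx)
    exact this.eventually_gt_atTop 1
  have hlim1 : Tendsto (fun n : ℕ => ∫ x, u x * deriv (φ (n + 1)) x ∂(leb L)) atTop
      (𝓝 (∫ x, u x * deriv w x ∂(leb L))) := by
    -- In the majorant, `C` bounds the term with `w'`, and each of the two endpoint layers
    -- contributes `|C| * (2 * |B|)`.
    refine tendsto_integral_of_dominated_convergence (fun x => |u x| * (C + |C| * (4 * |B|)))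
      (fun n => hu.1.mul ((hφt n).1.continuous_deriv (by simp)).aestronglyMeasurable)
      (hu.abs.mul_const _) (fun n => ?_) ?_
    · filter_upwards [ae_mem_Ioo L] with x hx
      have hx' := Ioo_subset_Icc_self hx
      have hm : (0 : ℝ) < n + 1 := by positivity
      rw [(hφd (n + 1) x).deriv, norm_mul, Real.norm_eq_abs (u x)]
      refine mul_le_mul_of_nonneg_left ?_ (abs_nonneg _)
      have b1 : ‖deriv w x * η (n + 1) x‖ ≤ C := by
        rw [norm_mul]
        exact (mul_le_of_le_one_right (norm_nonneg _) (hη _ _)).trans (hC x hx')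
      have w0 : |w x| ≤ |C| * x := by
        have := hlip (left_mem_Icc.2 (hx.1.trans hx.2).le) hx'
        rw [hw0, sub_zero, sub_zero, Real.norm_eq_abs, Real.norm_eq_abs, abs_of_pos hx.1] at this
        exact this.trans (mul_le_mul_of_nonneg_right (le_abs_self C) hx.1.le)
      have wL : |w x| ≤ |C| * (L - x) := by
        have := hlip (right_mem_Icc.2 (hx.1.trans hx.2).le) hx'
        rw [hwL, sub_zero, Real.norm_eq_abs, Real.norm_eq_abs, abs_sub_comm,
          abs_of_pos (sub_pos.2 hx.2)] at this
        exact this.trans (mul_le_mul_of_nonneg_right (le_abs_self C) (sub_pos.2 hx.2).le)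
      have k1 := hdecay ((n + 1) * x) (mul_nonneg hm.le hx.1.le)
      have k2 := hdecay ((n + 1) * (L - x)) (mul_nonneg hm.le (sub_pos.2 hx.2).le)
      have b2 : ‖w x * (deriv S ((n + 1) * x - 1) * (n + 1) * S ((n + 1) * (L - x) - 1))‖
          ≤ |C| * (2 * |B|) := by
        calc _ = |w x| * (n + 1) * |deriv S ((n + 1) * x - 1)| * |S ((n + 1) * (L - x) - 1)| := by
              rw [Real.norm_eq_abs, abs_mul, abs_mul, abs_mul, abs_of_pos hm]; ring
          _ ≤ |w x| * (n + 1) * |deriv S ((n + 1) * x - 1)| :=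
              mul_le_of_le_one_right (by positivity) (hS1 _)
          _ ≤ |C| * x * (n + 1) * |deriv S ((n + 1) * x - 1)| := by gcongr
          _ = |C| * ((n + 1) * x * |deriv S ((n + 1) * x - 1)|) := by ring
          _ ≤ _ := by gcongr
      have b3 : ‖w x * (S ((n + 1) * x - 1) * (deriv S ((n + 1) * (L - x) - 1) * -(n + 1)))‖
          ≤ |C| * (2 * |B|) := by
        calc _ = |w x| * (n + 1) * |deriv S ((n + 1) * (L - x) - 1)| * |S ((n + 1) * x - 1)| := by
              rw [Real.norm_eq_abs, abs_mul, abs_mul, abs_mul, abs_neg, abs_of_pos hm]; ring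
          _ ≤ |w x| * (n + 1) * |deriv S ((n + 1) * (L - x) - 1)| :=
              mul_le_of_le_one_right (by positivity) (hS1 _)
          _ ≤ |C| * (L - x) * (n + 1) * |deriv S ((n + 1) * (L - x) - 1)| := by gcongr
          _ = |C| * ((n + 1) * (L - x) * |deriv S ((n + 1) * (L - x) - 1)|) := by ring
          _ ≤ _ := by gcongr
      rw [mul_add (w x)]
      refine (norm_add_le _ _).trans ?_
      linarith [norm_add_le (w x * (deriv S ((n + 1) * x - 1) * (n + 1) * S ((n + 1) * (L - x) - 1)))
        (w x * (S ((n + 1) * x - 1) * (deriv S ((n + 1) * (L - x) - 1) * -(n + 1))))]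
    · filter_upwards [ae_mem_Ioo L] with x hx
      refine tendsto_const_nhds.congr' ?_
      filter_upwards [hmx x hx.1, hmx (L - x) (sub_pos.2 hx.2)] with n h1 h2
      have s1 : S ((n + 1) * x - 1) = 1 := Real.smoothTransition.one_of_one_le h1.le
      have s2 : S ((n + 1) * (L - x) - 1) = 1 := Real.smoothTransition.one_of_one_le h2.le
      rw [(hφd (n + 1) x).deriv, hSone _ h1, hSone _ h2]
      simp [η, s1, s2]
  have hlim2 : Tendsto (fun n : ℕ => -∫ x, v x * φ (n + 1) x ∂(leb L)) atTop
      (𝓝 (-∫ x, v x * w x ∂(leb L))) := by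
    refine (tendsto_integral_of_dominated_convergence (fun x => |v x| * D)
      (fun n => hv.1.mul (hφt n).1.continuous.aestronglyMeasurable)
      (hv.abs.mul_const _) (fun n => ?_) ?_).neg
    · filter_upwards [ae_mem_Ioo L] with x hx
      change ‖v x * (w x * η (n + 1) x)‖ ≤ _
      rw [norm_mul, Real.norm_eq_abs (v x), norm_mul]
      refine mul_le_mul_of_nonneg_left ?_ (abs_nonneg _)
      exact (mul_le_of_le_one_right (norm_nonneg _) (hη _ _)).trans (hD x (Ioo_subset_Icc_self hx))
    · filter_upwards [ae_mem_Ioo L] with x hx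
      refine tendsto_const_nhds.congr' ?_
      filter_upwards [hmx x hx.1, hmx (L - x) (sub_pos.2 hx.2)] with n h1 h2
      have s1 : S ((n + 1) * x - 1) = 1 := Real.smoothTransition.one_of_one_le h1.le
      have s2 : S ((n + 1) * (L - x) - 1) = 1 := Real.smoothTransition.one_of_one_le h2.le
      simp [φ, η, s1, s2]
  refine tendsto_nhds_unique hlim1 (hlim2.congr fun n => ?_)
  exact (h _ (hφt n)).symm

end Weak

end

end ThinFilm

/-! ### Orthogonal series and the spaces `H^1(0, L)`, `H^3(0, L)` in cosine coefficients -/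

namespace ThinFilm

noncomputable section

/-- Parseval's identity without normalization, so that it applies to a derivative of every order of
the same cosine series; some of the terms may vanish. -/
theorem hasSum_norm_sq_of_orthogonal {E : Type*} [NormedAddCommGroup E] [InnerProductSpace ℝ E]
    {v : ℕ → E} {u : E} (h : HasSum v u) (ho : ∀ j k, j ≠ k → inner ℝ (v j) (v k) = 0) :
    HasSum (fun k => ‖v k‖ ^ 2) (‖u‖ ^ 2) := by
  have h1 (k : ℕ) : inner ℝ (v k) u = ‖v k‖ ^ 2 := by
    have := (innerSL ℝ (v k)).hasSum h
    simp only [innerSL_apply_apply] at this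
    rw [← this.tsum_eq, tsum_eq_single k fun j hj => ho k j hj.symm, real_inner_self_eq_norm_sq]
  have h2 := (innerSL ℝ u).hasSum h
  simp only [innerSL_apply_apply, real_inner_self_eq_norm_sq] at h2
  refine h2.congr_fun fun k => ?_
  rw [real_inner_comm, h1]

theorem summable_smul_of_orthogonal {E : Type*} [NormedAddCommGroup E] [InnerProductSpace ℝ E]
    [CompleteSpace E] {v : ℕ → E} (ho : ∀ j k, j ≠ k → inner ℝ (v j) (v k) = 0)
    (h0 : ∀ k, v k ≠ 0) {c : ℕ → ℝ} (hs : Summable fun k => ‖v k‖ ^ 2 * c k ^ 2) :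
    Summable fun k => c k • v k := by
  have hn (k : ℕ) : ‖v k‖ ≠ 0 := norm_ne_zero_iff.2 (h0 k)
  have hon : Orthonormal ℝ fun k => ‖v k‖⁻¹ • v k := by
    refine ⟨fun k => ?_, fun j k hjk => ?_⟩
    · rw [norm_smul, norm_inv, norm_norm, inv_mul_cancel₀ (hn k)]
    · change inner ℝ (‖v j‖⁻¹ • v j) (‖v k‖⁻¹ • v k) = 0
      rw [inner_smul_left, inner_smul_right, ho j k hjk]; simp
  have := (hon.orthogonalFamily.summable_iff_norm_sq_summable fun k => c k * ‖v k‖).2 (by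
    refine hs.congr fun k => ?_
    rw [Real.norm_eq_abs, sq_abs]; ring)
  refine this.congr fun k => ?_
  rw [LinearIsometry.toSpanSingleton_apply, smul_smul, mul_assoc, mul_inv_cancel₀ (hn k), mul_one]

section

variable {L : ℝ}

theorem norm_sq_Sob {k : ℕ} (u : Sob L k) : ‖u‖ ^ 2 = ∑ j, ‖dxL2 j u‖ ^ 2 :=
  PiLp.norm_sq_eq_of_L2 _ (u : PiLp 2 fun _ : Fin (k + 1) => Lp ℝ 2 (leb L))

theorem inner_Sob {k : ℕ} (u v : Sob L k) : inner ℝ u v = ∑ j, inner ℝ (dxL2 j u) (dxL2 j v) :=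
  PiLp.inner_apply (u : PiLp 2 fun _ : Fin (k + 1) => Lp ℝ 2 (leb L)) v

theorem dxL2_zero_toH1 (u : Sob L 3) : dxL2 0 (toH1 u) = dxL2 0 u := rfl

theorem dxL2_one_toH1 (u : Sob L 3) : dxL2 1 (toH1 u) = dxL2 1 u := rfl

theorem continuous_toH1 : Continuous (toH1 : Sob L 3 → Sob L 1) := by
  refine Continuous.subtype_mk ((PiLp.continuous_toLp 2 _).comp (continuous_pi fun j => ?_)) _
  fin_cases j
  · exact (dxL2 (k := 3) 0).continuous
  · exact (dxL2 (k := 3) 1).continuous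

theorem toH1_ext {u v : Sob L 1} (h0 : dxL2 0 u = dxL2 0 v) (h1 : dxL2 1 u = dxL2 1 v) : u = v := by
  rw [← sub_eq_zero, ← norm_eq_zero, ← sq_eq_zero_iff, norm_sq_Sob, Fin.sum_univ_two, map_sub, map_sub,
    h0, h1]
  simp

end

variable {L : ℝ} [hL : Fact (0 < L)]

/-! ### The cosines in `H^3(0, L)` -/

/-- The cosines as elements of `H^3(0, L)`. -/
def cosH3 (k : ℕ) : Sob L 3 :=
  ⟨WithLp.toLp 2 ![cosE k, -(wave L k) • sinE k, -(wave L k ^ 2) • cosE k, wave L k ^ 3 • sinE k], by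
    have c1 (r : ℝ) : (r • cosE k : Lp ℝ 2 (leb L)) =ᵐ[leb L] fun x => r * cosBasis L k x := by
      filter_upwards [Lp.coeFn_smul r (cosE k : Lp ℝ 2 (leb L)), cosE_coeFn (L := L) k] with x h1 h2
      rw [h1, Pi.smul_apply, h2, smul_eq_mul]
    have c2 (r : ℝ) : (r • sinE k : Lp ℝ 2 (leb L)) =ᵐ[leb L] fun x => r * sinBasis L k x := by
      filter_upwards [Lp.coeFn_smul r (sinE k : Lp ℝ 2 (leb L)), sinE_coeFn (L := L) k] with x h1 h2
      rw [h1, Pi.smul_apply, h2, smul_eq_mul]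
    have d1 (r s : ℝ) (hrs : s = -r * wave L k) :
        IsWeakDeriv L (fun x => r * cosBasis L k x) (fun x => s * sinBasis L k x) :=
      isWeakDeriv_of_hasDerivAt (fun x => ((hasDerivAt_cosBasis k x).const_mul r).congr_deriv
        (by rw [hrs]; ring)) ((continuous_sinBasis k).const_mul s)
    have d2 (r s : ℝ) (hrs : s = r * wave L k) :
        IsWeakDeriv L (fun x => r * sinBasis L k x) (fun x => s * cosBasis L k x) :=
      isWeakDeriv_of_hasDerivAt (fun x => ((hasDerivAt_sinBasis k x).const_mul r).congr_deriv
        (by rw [hrs]; ring)) ((continuous_cosBasis k).const_mul s)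
    intro j
    fin_cases j
    · refine (d1 1 (-(wave L k)) (by ring)).congr ?_ (c2 _)
      have := c1 1
      rwa [one_smul] at this
    · exact (d2 (-(wave L k)) (-(wave L k ^ 2)) (by ring)).congr (c2 _) (c1 _)
    · exact (d1 (-(wave L k ^ 2)) (wave L k ^ 3) (by ring)).congr (c1 _) (c2 _)⟩

theorem dxL2_zero_cosH3 (k : ℕ) : dxL2 0 (cosH3 k : Sob L 3) = cosE k := rfl
theorem dxL2_one_cosH3 (k : ℕ) : dxL2 1 (cosH3 k : Sob L 3) = -(wave L k) • sinE k := rfl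
theorem dxL2_two_cosH3 (k : ℕ) : dxL2 2 (cosH3 k : Sob L 3) = -(wave L k ^ 2) • cosE k := rfl
theorem dxL2_three_cosH3 (k : ℕ) : dxL2 3 (cosH3 k : Sob L 3) = wave L k ^ 3 • sinE k := rfl

theorem norm_sq_smul_cosE (r : ℝ) (k : ℕ) : ‖r • (cosE k : Lp ℝ 2 (leb L))‖ ^ 2 = r ^ 2 := by
  rw [norm_smul, orthonormal_cosE.1 k, mul_one, Real.norm_eq_abs, sq_abs]

theorem norm_sq_smul_sinE (r : ℝ) (k : ℕ) (hr : k = 0 → r = 0) :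
    ‖r • (sinE k : Lp ℝ 2 (leb L))‖ ^ 2 = r ^ 2 := by
  by_cases hk : k = 0
  · rw [hr hk]; simp
  · rw [← real_inner_self_eq_norm_sq, inner_smul_left, inner_smul_right, inner_sinE, if_pos ⟨rfl, hk⟩]
    simp [sq]

theorem inner_cosH3 (j k : ℕ) (hjk : j ≠ k) (i : Fin 4) :
    inner ℝ (dxL2 i (cosH3 j : Sob L 3)) (dxL2 i (cosH3 k)) = 0 := by
  have h1 : inner ℝ (cosE j : Lp ℝ 2 (leb L)) (cosE k) = 0 := by rw [inner_cosE, if_neg hjk]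
  have h2 : inner ℝ (sinE j : Lp ℝ 2 (leb L)) (sinE k) = 0 := by
    rw [inner_sinE, if_neg fun h => hjk h.1]
  fin_cases i
  · exact h1
  · change inner ℝ (-(wave L j) • sinE j : Lp ℝ 2 (leb L)) (-(wave L k) • sinE k) = 0
    rw [inner_smul_left, inner_smul_right, h2]; simp
  · change inner ℝ (-(wave L j ^ 2) • cosE j : Lp ℝ 2 (leb L)) (-(wave L k ^ 2) • cosE k) = 0
    rw [inner_smul_left, inner_smul_right, h1]; simp
  · change inner ℝ (wave L j ^ 3 • sinE j : Lp ℝ 2 (leb L)) (wave L k ^ 3 • sinE k) = 0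
    rw [inner_smul_left, inner_smul_right, h2]; simp

theorem norm_sq_cosH3 (k : ℕ) :
    ‖(cosH3 k : Sob L 3)‖ ^ 2 = 1 + wave L k ^ 2 + wave L k ^ 4 + wave L k ^ 6 := by
  have hw : k = 0 → wave L k = 0 := fun h => by rw [h, wave_zero]
  rw [norm_sq_Sob, Fin.sum_univ_four, dxL2_zero_cosH3, dxL2_one_cosH3, dxL2_two_cosH3,
    dxL2_three_cosH3, orthonormal_cosE.1 k, norm_sq_smul_cosE,
    norm_sq_smul_sinE _ _ fun h => by rw [hw h, neg_zero],
    norm_sq_smul_sinE _ _ fun h => by rw [hw h]; simp]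
  ring

/-- Poincaré's inequality mode by mode: the wave numbers increase with `k`, so away from the
constant mode lower powers are controlled by higher ones. -/
theorem one_le_mul_wave_pow {k : ℕ} (hk : k ≠ 0) (m : ℕ) : 1 ≤ (wave L 1)⁻¹ ^ m * wave L k ^ m := by
  have h1 := wave_pos (L := L) one_ne_zero
  rw [← mul_pow]
  refine one_le_pow₀ ?_
  rw [inv_mul_eq_div, one_le_div h1, wave, wave]
  have := hL.out; have := Real.pi_pos
  gcongr
  exact_mod_cast Nat.one_le_iff_ne_zero.2 hk

theorem summable_of_wave_pow {m : ℕ} {c : ℕ → ℝ} (h : Summable fun k => wave L k ^ m * c k ^ 2) :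
    Summable fun k => c k ^ 2 := by
  rw [← summable_nat_add_iff 1] at h ⊢
  refine (h.mul_left ((wave L 1)⁻¹ ^ m)).of_nonneg_of_le (fun k => sq_nonneg _) fun k => ?_
  rw [← mul_assoc]
  exact le_mul_of_one_le_left (sq_nonneg _) (one_le_mul_wave_pow (Nat.succ_ne_zero k) m)

/-- Control of the third derivative suffices for convergence in `H^3`: the squared norm of a mode is
at most `3 + 3 w⁶` with `w` its wave number, and the part without `w` is handled by the Poincaré
bound. -/
theorem summable_cosH3 {c : ℕ → ℝ} (h : Summable fun k => wave L k ^ 6 * c k ^ 2) :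
    Summable fun k => c k • (cosH3 k : Sob L 3) := by
  refine summable_smul_of_orthogonal (fun j k hjk => ?_) (fun k hk => ?_) ?_
  · rw [inner_Sob]
    exact Finset.sum_eq_zero fun i _ => inner_cosH3 j k hjk i
  · have := norm_sq_cosH3 (L := L) k
    rw [hk, norm_zero] at this
    have h1 := wave_nonneg (L := L) k
    have : (0 : ℝ) ^ 2 > 0 := by rw [this]; positivity
    norm_num at this
  · refine (((summable_of_wave_pow h).mul_left 3).add (h.mul_left 3)).of_nonneg_of_le
      (fun k => by positivity) fun k => ?_
    rw [norm_sq_cosH3, ← mul_assoc, ← add_mul]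
    refine mul_le_mul_of_nonneg_right ?_ (sq_nonneg _)
    have h1 := wave_nonneg (L := L) k
    nlinarith [sq_nonneg (wave L k ^ 2 - 1), sq_nonneg (wave L k ^ 3 - wave L k), sq_nonneg (wave L k),
      sq_nonneg (wave L k ^ 3), sq_nonneg (wave L k ^ 2), mul_nonneg (sq_nonneg (wave L k)) (sq_nonneg (wave L k ^ 2 - 1)),
      mul_nonneg (add_nonneg zero_le_one (sq_nonneg (wave L k))) (sq_nonneg (wave L k ^ 2 - 1))]

/-- The element of `H^3(0, L)` with given cosine coefficients. -/
def sumH3 (L : ℝ) [Fact (0 < L)] (c : ℕ → ℝ) : Sob L 3 := ∑' k, c k • cosH3 k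

theorem hasSum_sumH3 {c : ℕ → ℝ} (h : Summable fun k => wave L k ^ 6 * c k ^ 2) :
    HasSum (fun k => c k • cosH3 k) (sumH3 L c) := (summable_cosH3 h).hasSum

theorem hasSum_dxL2_sumH3 {c : ℕ → ℝ} (h : Summable fun k => wave L k ^ 6 * c k ^ 2) (i : Fin 4) :
    HasSum (fun k => c k • dxL2 i (cosH3 k : Sob L 3)) (dxL2 i (sumH3 L c)) := by
  simpa only [map_smul] using (dxL2 i).hasSum (hasSum_sumH3 h)

theorem sumH3_add {c d : ℕ → ℝ} (hc : Summable fun k => wave L k ^ 6 * c k ^ 2)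
    (hd : Summable fun k => wave L k ^ 6 * d k ^ 2) :
    sumH3 L (c + d) = sumH3 L c + sumH3 L d := by
  have := ((hasSum_sumH3 hc).add (hasSum_sumH3 hd)).tsum_eq
  rw [← this, sumH3]
  simp only [Pi.add_apply, add_smul]

theorem hasSum_norm_sq_dxL2 {c : ℕ → ℝ} (h : Summable fun k => wave L k ^ 6 * c k ^ 2) (i : Fin 4) :
    HasSum (fun k => ‖dxL2 i (cosH3 k : Sob L 3)‖ ^ 2 * c k ^ 2) (‖dxL2 i (sumH3 L c)‖ ^ 2) := by
  refine (hasSum_norm_sq_of_orthogonal (hasSum_dxL2_sumH3 h i) fun j k hjk => ?_).congr_fun fun k => ?_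
  · rw [inner_smul_left, inner_smul_right, inner_cosH3 j k hjk]; simp
  · rw [norm_smul, mul_pow, Real.norm_eq_abs, sq_abs, mul_comm]

theorem hasSum_norm_sq_dxL2_three {c : ℕ → ℝ} (h : Summable fun k => wave L k ^ 6 * c k ^ 2) :
    HasSum (fun k => wave L k ^ 6 * c k ^ 2) (‖dxL2 3 (sumH3 L c)‖ ^ 2) := by
  refine (hasSum_norm_sq_dxL2 h 3).congr_fun fun k => ?_
  rw [dxL2_three_cosH3, norm_sq_smul_sinE _ _ fun hk => by rw [hk, wave_zero]; simp]; ring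

theorem hasSum_norm_sq_dxL2_one {c : ℕ → ℝ} (h : Summable fun k => wave L k ^ 6 * c k ^ 2) :
    HasSum (fun k => wave L k ^ 2 * c k ^ 2) (‖dxL2 1 (sumH3 L c)‖ ^ 2) := by
  refine (hasSum_norm_sq_dxL2 h 1).congr_fun fun k => ?_
  rw [dxL2_one_cosH3, norm_sq_smul_sinE _ _ fun hk => by rw [hk, wave_zero]; simp]; ring

theorem hasSum_norm_sq_dxL2_zero {c : ℕ → ℝ} (h : Summable fun k => wave L k ^ 6 * c k ^ 2) :
    HasSum (fun k => c k ^ 2) (‖dxL2 0 (sumH3 L c)‖ ^ 2) := by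
  refine (hasSum_norm_sq_dxL2 h 0).congr_fun fun k => ?_
  rw [dxL2_zero_cosH3, orthonormal_cosE.1 k]; ring

theorem inner_sinE_dxL2_three {c : ℕ → ℝ} (h : Summable fun k => wave L k ^ 6 * c k ^ 2) (j : ℕ) :
    inner ℝ (sinE j) (dxL2 3 (sumH3 L c)) = wave L j ^ 3 * c j := by
  have := (innerSL ℝ (sinE j)).hasSum (hasSum_dxL2_sumH3 h 3)
  simp only [innerSL_apply_apply, dxL2_three_cosH3] at this
  rw [← this.tsum_eq, tsum_eq_single j fun k hk => ?_]
  · rw [inner_smul_right, inner_smul_right, inner_sinE]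
    by_cases hj : j = 0
    · subst hj; simp [wave_zero]
    · rw [if_pos ⟨rfl, hj⟩]; ring
  · rw [inner_smul_right, inner_smul_right, inner_sinE, if_neg fun h' => hk h'.1.symm]; ring

/-! ### Sine and cosine coefficients of functions in `H^1(0, L)` -/

/-- The sines vanish at both endpoints, so integration by parts leaves no boundary term although `u`
satisfies no boundary condition. This makes the cosines suitable for all of `H^1`. -/
theorem inner_dxL2_one_sinE (u : Sob L 1) (k : ℕ) :
    inner ℝ (dxL2 1 u) (sinE k) = -wave L k * inner ℝ (dxL2 0 u) (cosE k) := by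
  have hi (v : Lp ℝ 2 (leb L)) : Integrable v (leb L) := (Lp.memLp v).integrable (by norm_num)
  have hs : ContDiff ℝ ∞ (sinBasis L k) := by
    unfold sinBasis; fun_prop
  have hd : deriv (sinBasis L k) = fun x => wave L k * cosBasis L k x :=
    funext fun x => (hasDerivAt_sinBasis k x).deriv
  have h := IsWeakDeriv.integral_mul_deriv (u.2 0) (hi (dxL2 0 u)) (hi (dxL2 1 u)) hs
    (sinBasis_zero k) (sinBasis_right k)
  have e1 : ∫ x, dxL2 0 u x * deriv (sinBasis L k) x ∂(leb L) = wave L k * inner ℝ (dxL2 0 u) (cosE k) := by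
    rw [inner_eq_integral, ← integral_const_mul]
    refine integral_congr_ae ?_
    filter_upwards [cosE_coeFn (L := L) k] with x hx
    rw [hx, hd]; ring
  have e2 : ∫ x, dxL2 1 u x * sinBasis L k x ∂(leb L) = inner ℝ (dxL2 1 u) (sinE k) := by
    rw [inner_eq_integral]
    refine integral_congr_ae ?_
    filter_upwards [sinE_coeFn (L := L) k] with x hx
    rw [hx]
  have h' : ∫ x, dxL2 0 u x * deriv (sinBasis L k) x ∂(leb L)
      = -∫ x, dxL2 1 u x * sinBasis L k x ∂(leb L) := h
  rw [e1, e2] at h'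
  linarith

/-- Bessel's inequality for `∂_x u` in the sine system; truncating the initial data therefore does
not raise the energy. -/
theorem sum_wave_sq_coeff_le (u : Sob L 1) (n : ℕ) :
    ∑ k ∈ Finset.range n, wave L k ^ 2 * (inner ℝ (dxL2 0 u) (cosE k)) ^ 2 ≤ ‖dxL2 1 u‖ ^ 2 := by
  have h := orthonormal_sinE.sum_inner_products_le (dxL2 1 u) (s := Finset.range n)
  refine le_trans ?_ h
  have e (k : ℕ) : wave L k ^ 2 * (inner ℝ (dxL2 0 u) (cosE k)) ^ 2 = (inner ℝ (dxL2 1 u) (sinE k)) ^ 2 := by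
    rw [inner_dxL2_one_sinE]; ring
  simp only [e]
  have e0 : inner ℝ (dxL2 1 u) (sinE 0) ^ 2 = 0 := by rw [sinE_zero, inner_zero_right]; norm_num
  calc ∑ k ∈ Finset.range n, inner ℝ (dxL2 1 u) (sinE k) ^ 2
      ≤ ∑ k ∈ Finset.range (n + 1), inner ℝ (dxL2 1 u) (sinE k) ^ 2 := by
        rw [Finset.sum_range_succ]; linarith [sq_nonneg (inner ℝ (dxL2 1 u) (sinE n))]
    _ = ∑ k ∈ Finset.range n, ‖inner ℝ (sinE (k + 1)) (dxL2 1 u)‖ ^ 2 := by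
        rw [Finset.sum_range_succ', e0, add_zero]
        refine Finset.sum_congr rfl fun k _ => ?_
        rw [Real.norm_eq_abs, sq_abs, real_inner_comm]

/-- If `u` is orthogonal in `H^1` to a cosine of wave number `w`, integration by parts shows that `1
+ w²` times its coefficient vanishes. Completeness of cosines and sines then kills `u` and its
derivative. -/
theorem dense_span_cosH1 :
    (Submodule.span ℝ (range fun k => toH1 (cosH3 k : Sob L 3))).topologicalClosure = ⊤ := by
  rw [Submodule.topologicalClosure_eq_top_iff, Submodule.eq_bot_iff]
  intro u hu
  have h0 (k : ℕ) : inner ℝ (dxL2 0 u) (cosE k) = 0 := by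
    have := hu _ (Submodule.subset_span ⟨k, rfl⟩)
    rw [real_inner_comm, inner_Sob, Fin.sum_univ_two, dxL2_zero_toH1, dxL2_one_toH1, dxL2_zero_cosH3,
      dxL2_one_cosH3, inner_smul_right, inner_dxL2_one_sinE] at this
    have h1 : (1 + wave L k ^ 2) * inner ℝ (dxL2 0 u) (cosE k) = 0 := by linarith
    exact (mul_eq_zero.1 h1).resolve_left (by positivity)
  refine toH1_ext ?_ ?_
  · rw [map_zero]; exact eq_zero_of_inner_cosE _ h0
  · rw [map_zero]
    exact eq_zero_of_inner_sinE _ fun k => by rw [inner_dxL2_one_sinE, h0, mul_zero]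

end

end ThinFilm

namespace ThinFilm

noncomputable section

variable {L : ℝ} [hL : Fact (0 < L)]

/-! ### Weighted sums of coefficients -/

/-- The weights that control the Hölder norm of a cosine series. -/
def holderWt (α : ℝ) (k : ℕ) : ℝ := 1 + (k : ℝ) ^ α

theorem holderWt_nonneg (α : ℝ) (k : ℕ) : 0 ≤ holderWt α k := by unfold holderWt; positivity

theorem one_le_holderWt (α : ℝ) (k : ℕ) : 1 ≤ holderWt α k := by
  have : (0 : ℝ) ≤ (k : ℝ) ^ α := by positivity
  unfold holderWt; linarith

/-- The source of the threshold for `α`: the terms decay like `k^(2α-2)`, and `2 - 2α > 1` is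
needed. -/
theorem summable_holderWt_div_sq {α : ℝ} (h0 : 0 ≤ α) (h1 : α < 1 / 2) :
    Summable fun k => (holderWt α k / wave L k) ^ 2 := by
  have hs : Summable fun k : ℕ => ((k : ℝ) ^ (2 - 2 * α))⁻¹ :=
    Real.summable_nat_rpow_inv.2 (by linarith)
  have hL0 := hL.out
  have hpi := Real.pi_pos
  refine (hs.mul_left (4 * (L / Real.pi) ^ 2)).of_nonneg_of_le (fun k => sq_nonneg _) fun k => ?_
  by_cases hk : k = 0
  · subst hk; rw [wave_zero, div_zero, zero_pow two_ne_zero]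
    have : (0 : ℝ) ≤ ((0 : ℕ) : ℝ) ^ (2 - 2 * α) := Real.rpow_nonneg (by simp) _
    positivity
  · have hk1 : (1 : ℝ) ≤ k := by exact_mod_cast Nat.one_le_iff_ne_zero.2 hk
    have hk0 : (0 : ℝ) < k := by linarith
    have hw : holderWt α k ≤ 2 * (k : ℝ) ^ α := by
      have := Real.one_le_rpow hk1 h0
      unfold holderWt; linarith
    have e : ((k : ℝ) ^ (2 - 2 * α))⁻¹ = ((k : ℝ) ^ α / k) ^ 2 := by
      rw [Real.rpow_sub hk0, inv_div, div_pow]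
      congr 1
      · rw [mul_comm, Real.rpow_mul hk0.le, Real.rpow_ofNat]
      · rw [Real.rpow_ofNat]
    rw [e]
    calc (holderWt α k / wave L k) ^ 2 ≤ (2 * (k : ℝ) ^ α / wave L k) ^ 2 := by
          have := holderWt_nonneg α k
          have := wave_pos (L := L) hk
          gcongr
      _ = 4 * (L / Real.pi) ^ 2 * ((k : ℝ) ^ α / k) ^ 2 := by
          rw [wave]; field_simp; norm_num

/-- Young's inequality. A small `δ` is put on the factor that is merely bounded by the energy, while
the other factor has a small tail. -/
theorem holderWt_mul_abs_le {α : ℝ} {k : ℕ} (hk : k ≠ 0) {δ : ℝ} (hδ : 0 < δ) (r : ℝ) :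
    holderWt α k * |r| ≤ (2 * δ)⁻¹ * (holderWt α k / wave L k) ^ 2 + δ / 2 * (wave L k ^ 2 * r ^ 2) := by
  have hw := wave_pos (L := L) hk
  have e : holderWt α k * |r| = (holderWt α k / wave L k) * (wave L k * |r|) := by field_simp
  have e2 : wave L k ^ 2 * r ^ 2 = (wave L k * |r|) ^ 2 := by rw [mul_pow, sq_abs]
  rw [e, e2]
  set a := holderWt α k / wave L k
  set b := wave L k * |r|
  have h : 0 ≤ (2 * δ)⁻¹ * (a - δ * b) ^ 2 := by positivity
  have h2 : (2 * δ)⁻¹ * (a - δ * b) ^ 2 = (2 * δ)⁻¹ * a ^ 2 - a * b + δ / 2 * b ^ 2 := by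
    field_simp; ring
  linarith

theorem summable_holderWt_mul {α : ℝ} (h0 : 0 ≤ α) (h1 : α < 1 / 2) {c : ℕ → ℝ}
    (hc : Summable fun k => wave L k ^ 2 * c k ^ 2) : Summable fun k => holderWt α k * |c k| := by
  have hs := summable_holderWt_div_sq (L := L) h0 h1
  rw [← summable_nat_add_iff 1] at hs hc ⊢
  refine ((hs.mul_left (2 * 1)⁻¹).add (hc.mul_left (1 / 2))).of_nonneg_of_le
    (fun k => mul_nonneg (holderWt_nonneg _ _) (abs_nonneg _))
    fun k => holderWt_mul_abs_le (Nat.succ_ne_zero k) one_pos _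

/-- The compactness of `H^1` in `C^α`, in coefficients: finitely many modes converge by hypothesis,
and the tail is small uniformly in `i`. An arbitrary filter allows limits in the order, in time, and
uniformly in time. -/
theorem tendsto_tsum_holderWt {ι : Type*} {l : Filter ι} {α : ℝ} (h0 : 0 ≤ α) (h1 : α < 1 / 2)
    {c : ι → ℕ → ℝ} {C : ℝ} (hc : ∀ i, Summable fun k => wave L k ^ 2 * c i k ^ 2)
    (hC : ∀ i, ∑' k, wave L k ^ 2 * c i k ^ 2 ≤ C) (hlim : ∀ k, Tendsto (fun i => c i k) l (𝓝 0)) :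
    Tendsto (fun i => ∑' k, holderWt α k * |c i k|) l (𝓝 0) := by
  have hs := summable_holderWt_div_sq (L := L) h0 h1
  rw [Metric.tendsto_nhds]
  intro e he
  set C' := |C| + 1 with hC'
  have hC'0 : 0 < C' := by positivity
  -- Chosen so that `δ / 2 * C' = e / 4`.
  set δ := e / (2 * C') with hδd
  have hδ : 0 < δ := by positivity
  have htail := tendsto_sum_nat_add (fun k => (holderWt α k / wave L k) ^ 2)
  have htail' : Tendsto (fun K => (2 * δ)⁻¹ * ∑' k, (holderWt α (k + K) / wave L (k + K)) ^ 2) atTop (𝓝 0) := by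
    simpa using htail.const_mul (2 * δ)⁻¹
  -- `K ≥ 1` keeps the constant mode, whose wave number is zero, out of the tail.
  obtain ⟨K, hK, hK0⟩ := ((htail'.eventually_lt_const (by positivity : 0 < e / 4)).and
    (eventually_ge_atTop 1)).exists
  have hfin : Tendsto (fun i => ∑ k ∈ Finset.range K, holderWt α k * |c i k|) l (𝓝 0) := by
    have : Tendsto (fun i => ∑ k ∈ Finset.range K, holderWt α k * |c i k|) l
        (𝓝 (∑ k ∈ Finset.range K, holderWt α k * |(0 : ℝ)|)) :=
      tendsto_finsetSum _ fun k _ => ((hlim k).abs).const_mul _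
    simpa using this
  filter_upwards [hfin.eventually_lt_const (by positivity : 0 < e / 4)] with i hi
  have hsum := summable_holderWt_mul (L := L) h0 h1 (hc i)
  have hnn : 0 ≤ ∑' k, holderWt α k * |c i k| :=
    tsum_nonneg fun k => mul_nonneg (holderWt_nonneg _ _) (abs_nonneg _)
  rw [Real.dist_eq, sub_zero, abs_of_nonneg hnn, ← hsum.sum_add_tsum_nat_add K]
  have hs' := (summable_nat_add_iff K).2 hs
  have hc' := (summable_nat_add_iff K).2 (hc i)
  have hle : ∑' k, holderWt α (k + K) * |c i (k + K)| ≤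
      (2 * δ)⁻¹ * ∑' k, (holderWt α (k + K) / wave L (k + K)) ^ 2 +
        δ / 2 * ∑' k, wave L (k + K) ^ 2 * c i (k + K) ^ 2 := by
    rw [← tsum_mul_left, ← tsum_mul_left, ← (hs'.mul_left _).tsum_add (hc'.mul_left _)]
    exact ((summable_nat_add_iff K).2 hsum).tsum_le_tsum
      (fun k => holderWt_mul_abs_le (by omega) hδ _) ((hs'.mul_left _).add (hc'.mul_left _))
  have hle2 : ∑' k, wave L (k + K) ^ 2 * c i (k + K) ^ 2 ≤ C' := by
    have := (hc i).sum_add_tsum_nat_add K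
    have h3 : 0 ≤ ∑ k ∈ Finset.range K, wave L k ^ 2 * c i k ^ 2 :=
      Finset.sum_nonneg fun k _ => by positivity
    have := hC i
    have := le_abs_self C
    linarith
  have : δ / 2 * ∑' k, wave L (k + K) ^ 2 * c i (k + K) ^ 2 ≤ e / 4 := by
    calc _ ≤ δ / 2 * C' := by gcongr
      _ = e / 4 := by rw [hδd]; field_simp; norm_num
  linarith

/-! ### Cosine series as functions -/

/-- The function with given cosine coefficients. -/
def cosSum (L : ℝ) (c : ℕ → ℝ) (x : ℝ) : ℝ := ∑' k, c k * cosBasis L k x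

/-- The continuous function on `[0, L]` with given cosine coefficients. -/
def sumC (L : ℝ) [Fact (0 < L)] (c : ℕ → ℝ) : C(Icc 0 L, ℝ) := ∑' k, c k • cosC k

theorem summable_abs {c : ℕ → ℝ} (hc : Summable fun k => wave L k ^ 2 * c k ^ 2) :
    Summable fun k => |c k| :=
  (summable_holderWt_mul (L := L) le_rfl (by norm_num) hc).of_nonneg_of_le (fun k => abs_nonneg _)
    fun k => le_mul_of_one_le_left (abs_nonneg _) (one_le_holderWt 0 k)

theorem summable_mul_cosBasis {c : ℕ → ℝ} (hc : Summable fun k => |c k|) (x : ℝ) :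
    Summable fun k => c k * cosBasis L k x := by
  refine Summable.of_norm_bounded (hc.mul_right (√(2 / L))) fun k => ?_
  rw [norm_mul]
  exact mul_le_mul_of_nonneg_left (abs_cosBasis_le k x) (abs_nonneg _)

theorem norm_smul_cosC_le (c : ℕ → ℝ) (k : ℕ) :
    ‖c k • (cosC k : C(Icc 0 L, ℝ))‖ ≤ √(2 / L) * |c k| := by
  rw [norm_smul, mul_comm]
  exact mul_le_mul_of_nonneg_right (norm_cosC_le k) (abs_nonneg _)

theorem hasSum_sumC {c : ℕ → ℝ} (hc : Summable fun k => |c k|) :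
    HasSum (fun k => c k • cosC k) (sumC L c) :=
  (Summable.of_norm_bounded (hc.mul_left (√(2 / L))) fun k => norm_smul_cosC_le c k).hasSum

theorem norm_sumC_le {c : ℕ → ℝ} (hc : Summable fun k => |c k|) :
    ‖sumC L c‖ ≤ √(2 / L) * ∑' k, |c k| := by
  rw [← tsum_mul_left]
  exact tsum_of_norm_bounded (hc.mul_left _).hasSum fun k => norm_smul_cosC_le c k

theorem sumC_sub {c d : ℕ → ℝ} (hc : Summable fun k => |c k|) (hd : Summable fun k => |d k|) :
    sumC L (fun k => c k - d k) = sumC L c - sumC L d := by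
  rw [← ((hasSum_sumC hc).sub (hasSum_sumC hd)).tsum_eq, sumC]
  simp only [sub_smul]

theorem sumC_apply {c : ℕ → ℝ} (hc : Summable fun k => |c k|) (x : Icc 0 L) :
    sumC L c x = cosSum L c x := by
  have := (hasSum_sumC hc).map (ContinuousMap.evalCLM ℝ x) (ContinuousMap.evalCLM ℝ x).continuous
  exact this.tsum_eq.symm

theorem ext_sumC {c : ℕ → ℝ} (hc : Summable fun k => |c k|) {x : ℝ} (hx : x ∈ Icc 0 L) :
    ext (sumC L c) x = cosSum L c x := by
  rw [ext_of_mem _ hx, sumC_apply hc]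

theorem ofC_sumC_coeFn {c : ℕ → ℝ} (hc : Summable fun k => |c k|) :
    ofC (sumC L c) =ᵐ[leb L] cosSum L c := by
  filter_upwards [ofC_coeFn (sumC L c), ae_mem_Ioo L] with x h1 h2
  rw [h1, ext_sumC hc (Ioo_subset_Icc_self h2)]

theorem hasSum_ofC_sumC {c : ℕ → ℝ} (hc : Summable fun k => |c k|) :
    HasSum (fun k => c k • cosE k) (ofC (sumC L c)) := by
  simpa only [map_smul, cosE] using (ofC (L := L)).hasSum (hasSum_sumC hc)

theorem continuous_cosSum {c : ℕ → ℝ} (hc : Summable fun k => |c k|) : Continuous (cosSum L c) := by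
  refine continuous_tsum (fun k => (continuous_cosBasis k).const_mul (c k)) (hc.mul_right (√(2 / L)))
    fun k x => ?_
  rw [norm_mul]
  exact mul_le_mul_of_nonneg_left (abs_cosBasis_le k x) (abs_nonneg _)

theorem cosSum_sub {c d : ℕ → ℝ} (hc : Summable fun k => |c k|) (hd : Summable fun k => |d k|) :
    cosSum L (fun k => c k - d k) = cosSum L c - cosSum L d := by
  ext x
  rw [Pi.sub_apply, cosSum, cosSum, cosSum,
    ← (summable_mul_cosBasis hc x).tsum_sub (summable_mul_cosBasis hd x)]
  simp only [sub_mul]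

/-- For `|a - b| ≤ 1` the Lipschitz bound is stronger; otherwise the trivial bound `2` suffices. -/
theorem abs_cos_sub_cos_le {α : ℝ} (h0 : 0 ≤ α) (h1 : α ≤ 1) (a b : ℝ) :
    |Real.cos a - Real.cos b| ≤ 2 * |a - b| ^ α := by
  rcases le_total |a - b| 1 with h | h
  · calc |Real.cos a - Real.cos b| ≤ |a - b| := Real.abs_cos_sub_cos_le a b
      _ = |a - b| ^ (1 : ℝ) := (Real.rpow_one _).symm
      _ ≤ |a - b| ^ α := by
          rcases eq_or_lt_of_le (abs_nonneg (a - b)) with h2 | h2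
          · rw [← h2, Real.zero_rpow one_ne_zero]; positivity
          · exact Real.rpow_le_rpow_of_exponent_ge h2 h h1
      _ ≤ 2 * |a - b| ^ α := by linarith [Real.rpow_nonneg (abs_nonneg (a - b)) α]
  · have h2 := Real.one_le_rpow h h0
    have h3 := Real.abs_cos_le_one a
    have h4 := Real.abs_cos_le_one b
    linarith [abs_sub (Real.cos a) (Real.cos b)]

theorem abs_cosBasis_sub_le {α : ℝ} (h0 : 0 ≤ α) (h1 : α ≤ 1) (k : ℕ) (x y : ℝ) :
    |cosBasis L k x - cosBasis L k y| ≤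
      √(2 / L) * (2 * (Real.pi / L) ^ α) * holderWt α k * |x - y| ^ α := by
  have hL0 := hL.out
  have hpi := Real.pi_pos
  have hwt := holderWt_nonneg α k
  by_cases hk : k = 0
  · subst hk
    have : cosBasis L 0 x - cosBasis L 0 y = 0 := by simp [cosBasis]
    rw [this, abs_zero]; positivity
  · rw [cosBasis_of_ne hk, cosBasis_of_ne hk, ← mul_sub, abs_mul, abs_of_nonneg (Real.sqrt_nonneg _),
      mul_assoc, mul_assoc]
    refine mul_le_mul_of_nonneg_left ((abs_cos_sub_cos_le h0 h1 _ _).trans ?_) (Real.sqrt_nonneg _)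
    have e : |wave L k * x - wave L k * y| ^ α = (Real.pi / L) ^ α * ((k : ℝ) ^ α * |x - y| ^ α) := by
      rw [← mul_sub, abs_mul, abs_of_nonneg (wave_nonneg k), wave, mul_div_assoc, mul_comm (k : ℝ),
        Real.mul_rpow (by positivity) (abs_nonneg _), Real.mul_rpow (by positivity) (by positivity),
        mul_assoc]
    rw [e, mul_assoc 2]
    gcongr
    unfold holderWt; linarith

theorem holderWith_cosSum {α : ℝ≥0} (h1 : (α : ℝ) ≤ 1) {c : ℕ → ℝ}
    (hc : Summable fun k => holderWt α k * |c k|) :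
    HolderWith (Real.toNNReal (√(2 / L) * (2 * (Real.pi / L) ^ (α : ℝ)) * ∑' k, holderWt α k * |c k|)) α
      ((Icc 0 L).domRestrict (cosSum L c)) := by
  have hL0 := hL.out
  have hpi := Real.pi_pos
  have hc' : Summable fun k => |c k| := hc.of_nonneg_of_le (fun k => abs_nonneg _)
    fun k => le_mul_of_one_le_left (abs_nonneg _) (one_le_holderWt α k)
  have hN : 0 ≤ ∑' k, holderWt α k * |c k| :=
    tsum_nonneg fun k => mul_nonneg (holderWt_nonneg _ _) (abs_nonneg _)
  intro x y
  have hb : |cosSum L c x - cosSum L c y| ≤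
      √(2 / L) * (2 * (Real.pi / L) ^ (α : ℝ)) * (∑' k, holderWt α k * |c k|) * |(x : ℝ) - y| ^ (α : ℝ) := by
    rw [cosSum, cosSum, ← (summable_mul_cosBasis hc' x).tsum_sub (summable_mul_cosBasis hc' y)]
    have e : √(2 / L) * (2 * (Real.pi / L) ^ (α : ℝ)) * (∑' k, holderWt α k * |c k|) * |(x : ℝ) - y| ^ (α : ℝ)
        = ∑' k, (√(2 / L) * (2 * (Real.pi / L) ^ (α : ℝ)) * |(x : ℝ) - y| ^ (α : ℝ)) * (holderWt α k * |c k|) := by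
      rw [tsum_mul_left]; ring
    rw [e, ← Real.norm_eq_abs]
    refine tsum_of_norm_bounded (hc.mul_left _).hasSum fun k => ?_
    rw [← mul_sub, norm_mul]
    calc ‖c k‖ * ‖cosBasis L k x - cosBasis L k y‖
        ≤ |c k| * (√(2 / L) * (2 * (Real.pi / L) ^ (α : ℝ)) * holderWt α k * |(x : ℝ) - y| ^ (α : ℝ)) :=
          mul_le_mul_of_nonneg_left (abs_cosBasis_sub_le α.2 h1 k x y) (abs_nonneg _)
      _ = _ := by ring
  rw [edist_dist, edist_dist, ENNReal.ofReal_rpow_of_nonneg dist_nonneg α.coe_nonneg,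
    ← ENNReal.ofReal_coe_nnreal, Real.coe_toNNReal _ (by positivity), ← ENNReal.ofReal_mul (by positivity)]
  exact ENNReal.ofReal_le_ofReal hb

theorem holderENorm_cosSum_le {α : ℝ≥0} (h1 : (α : ℝ) ≤ 1) {c : ℕ → ℝ}
    (hc : Summable fun k => holderWt α k * |c k|) :
    holderENorm L α (cosSum L c) ≤ ENNReal.ofReal
      (√(2 / L) * (1 + 2 * (Real.pi / L) ^ (α : ℝ)) * ∑' k, holderWt α k * |c k|) := by
  have hL0 := hL.out
  have hpi := Real.pi_pos
  have hc' : Summable fun k => |c k| := hc.of_nonneg_of_le (fun k => abs_nonneg _)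
    fun k => le_mul_of_one_le_left (abs_nonneg _) (one_le_holderWt α k)
  have hN : 0 ≤ ∑' k, holderWt α k * |c k| :=
    tsum_nonneg fun k => mul_nonneg (holderWt_nonneg _ _) (abs_nonneg _)
  rw [mul_add, mul_one, add_mul, ENNReal.ofReal_add (by positivity) (by positivity)]
  refine add_le_add (iSup₂_le fun x hx => ?_) (holderWith_cosSum h1 hc).eHolderNorm_le
  rw [← ofReal_norm, cosSum, ← tsum_mul_left]
  refine ENNReal.ofReal_le_ofReal (tsum_of_norm_bounded (hc.mul_left _).hasSum fun k => ?_)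
  rw [norm_mul, mul_comm]
  exact mul_le_mul (abs_cosBasis_le k x) (le_mul_of_one_le_left (abs_nonneg _) (one_le_holderWt α k))
    (norm_nonneg _) (Real.sqrt_nonneg _)

/-- Termwise differentiation is allowed because the derivatives are absolutely summable: write `w
|c| = w⁻² · (w³ |c|)` and use that both factors are square summable. -/
theorem hasDerivAt_cosSum {c : ℕ → ℝ} (h : Summable fun k => wave L k ^ 6 * c k ^ 2) (x : ℝ) :
    HasDerivAt (cosSum L c) (∑' k, c k * (-(wave L k) * sinBasis L k x)) x := by
  have h4 : Summable fun k => (wave L k ^ 4)⁻¹ := by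
    have hs : Summable fun k : ℕ => ((k : ℝ) ^ 4)⁻¹ := Real.summable_nat_pow_inv.2 (by norm_num)
    refine (hs.mul_left ((L / Real.pi) ^ 4)).congr fun k => ?_
    rw [wave, mul_div_assoc, mul_pow, mul_inv, ← inv_pow (Real.pi / L), inv_div]; ring
  have h1 : Summable fun k => wave L k * |c k| := by
    refine (h4.add h).of_nonneg_of_le (fun k => mul_nonneg (wave_nonneg k) (abs_nonneg _)) fun k => ?_
    by_cases hk : k = 0
    · subst hk; simp [wave_zero]
    · have hw := wave_pos (L := L) hk
      have e : wave L k * |c k| = (wave L k ^ 2)⁻¹ * (wave L k ^ 3 * |c k|) := by field_simp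
      have e2 : wave L k ^ 6 * c k ^ 2 = (wave L k ^ 3 * |c k|) ^ 2 := by rw [mul_pow, sq_abs]; ring
      have e3 : (wave L k ^ 4)⁻¹ = ((wave L k ^ 2)⁻¹) ^ 2 := by rw [inv_pow]; ring
      rw [e, e2, e3]
      nlinarith [sq_nonneg ((wave L k ^ 2)⁻¹ - wave L k ^ 3 * |c k|), sq_nonneg ((wave L k ^ 2)⁻¹),
        sq_nonneg (wave L k ^ 3 * |c k|)]
  have h2 : Summable fun k => wave L k ^ 2 * c k ^ 2 :=
    ((hasSum_norm_sq_dxL2_one h).summable)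
  refine hasDerivAt_tsum (h1.mul_left (√(2 / L))) (fun k y => (hasDerivAt_cosBasis k y).const_mul (c k))
    (fun k y => ?_) (summable_mul_cosBasis (summable_abs h2) 0) x
  rw [norm_mul, norm_mul, norm_neg, Real.norm_of_nonneg (wave_nonneg k)]
  calc ‖c k‖ * (wave L k * ‖sinBasis L k y‖) ≤ ‖c k‖ * (wave L k * √(2 / L)) := by
        have := wave_nonneg (L := L) k
        gcongr
        exact abs_sinBasis_le k y
    _ = _ := by rw [Real.norm_eq_abs]; ring

/-- The Neumann condition is built into the basis, since every term of the differentiated series is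
a sine. -/
theorem hasDerivAt_cosSum_boundary {c : ℕ → ℝ} (h : Summable fun k => wave L k ^ 6 * c k ^ 2) {x : ℝ}
    (hx : x ∈ ({0, L} : Set ℝ)) : HasDerivAt (cosSum L c) 0 x := by
  refine (hasDerivAt_cosSum h x).congr_deriv ?_
  rcases hx with rfl | rfl
  · simp [sinBasis_zero]
  · simp [sinBasis_right]

theorem dxL2_zero_sumH3 {c : ℕ → ℝ} (h : Summable fun k => wave L k ^ 6 * c k ^ 2) :
    dxL2 0 (sumH3 L c) = ofC (sumC L c) := by
  have h2 : Summable fun k => |c k| := summable_abs (hasSum_norm_sq_dxL2_one h).summable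
  rw [← (hasSum_ofC_sumC h2).tsum_eq, ← (hasSum_dxL2_sumH3 h 0).tsum_eq]
  rfl

end

end ThinFilm

namespace ThinFilm

noncomputable section

variable {L : ℝ}

/-! ### Superposition operators and fluxes -/

/-- The superposition operator `(f, g) ↦ Φ(f, g)` on continuous functions. -/
def superpose (Φ : C(ℝ × ℝ, ℝ)) (z : C(Icc 0 L, ℝ) × C(Icc 0 L, ℝ)) : C(Icc 0 L, ℝ) :=
  Φ.comp (z.1.prodMk z.2)

theorem continuous_superpose (Φ : C(ℝ × ℝ, ℝ)) :
    Continuous (superpose Φ : C(Icc 0 L, ℝ) × C(Icc 0 L, ℝ) → C(Icc 0 L, ℝ)) := by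
  refine ContinuousMap.continuous_of_continuous_uncurry _ ?_
  have h1 : Continuous fun p : (C(Icc 0 L, ℝ) × C(Icc 0 L, ℝ)) × Icc 0 L => p.1.1 p.2 :=
    ContinuousEval.continuous_eval.comp ((continuous_fst.comp continuous_fst).prodMk continuous_snd)
  have h2 : Continuous fun p : (C(Icc 0 L, ℝ) × C(Icc 0 L, ℝ)) × Icc 0 L => p.1.2 p.2 :=
    ContinuousEval.continuous_eval.comp ((continuous_snd.comp continuous_fst).prodMk continuous_snd)
  exact Φ.continuous.comp (h1.prodMk h2)

/-- Functions within distance `1` of `z₀` take values in one compact ball, on which `Φ` has a single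
Lipschitz constant. -/
theorem locallyLipschitz_superpose {Φ : C(ℝ × ℝ, ℝ)} (hΦ : LocallyLipschitz Φ) :
    LocallyLipschitz (superpose Φ : C(Icc 0 L, ℝ) × C(Icc 0 L, ℝ) → C(Icc 0 L, ℝ)) := by
  intro z₀
  obtain ⟨K, hK⟩ := hΦ.locallyLipschitzOn.exists_lipschitzOnWith_of_compact
    (isCompact_closedBall (0 : ℝ × ℝ) (‖z₀‖ + 1))
  refine ⟨K, Metric.closedBall z₀ 1, Metric.closedBall_mem_nhds _ one_pos, ?_⟩
  have hmem (z : C(Icc 0 L, ℝ) × C(Icc 0 L, ℝ)) (hz : z ∈ Metric.closedBall z₀ 1) (x : Icc 0 L) :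
      (z.1 x, z.2 x) ∈ Metric.closedBall (0 : ℝ × ℝ) (‖z₀‖ + 1) := by
    rw [mem_closedBall_zero_iff]
    have hn : ‖z‖ ≤ ‖z₀‖ + 1 := by
      rw [mem_closedBall_iff_norm] at hz
      linarith [norm_le_norm_add_norm_sub' z z₀]
    exact max_le ((z.1.norm_coe_le_norm x).trans ((norm_fst_le z).trans hn))
      ((z.2.norm_coe_le_norm x).trans ((norm_snd_le z).trans hn))
  refine LipschitzOnWith.of_dist_le_mul fun z hz w hw => ?_
  rw [ContinuousMap.dist_le (by positivity)]
  intro x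
  refine (hK.dist_le_mul _ (hmem z hz x) _ (hmem w hw x)).trans ?_
  refine mul_le_mul_of_nonneg_left ?_ K.2
  rw [Prod.dist_eq, Prod.dist_eq]
  exact max_le_max (ContinuousMap.dist_apply_le_dist x) (ContinuousMap.dist_apply_le_dist x)

theorem norm_superpose_le {Φ : C(ℝ × ℝ, ℝ)} {B M : ℝ} (hM : 0 ≤ M)
    (hΦ : ∀ s r, |s| ≤ B → |r| ≤ B → |Φ (s, r)| ≤ M) {f g : C(Icc 0 L, ℝ)} (hf : ‖f‖ ≤ B)
    (hg : ‖g‖ ≤ B) : ‖superpose Φ (f, g)‖ ≤ M :=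
  (ContinuousMap.norm_le _ hM).2 fun x =>
    hΦ _ _ ((f.norm_coe_le_norm x).trans hf) ((g.norm_coe_le_norm x).trans hg)

theorem norm_sq_eq_integral (u : Lp ℝ 2 (leb L)) : ‖u‖ ^ 2 = ∫ x, u x ^ 2 ∂(leb L) := by
  rw [← real_inner_self_eq_norm_sq, inner_eq_integral]
  simp only [sq]

theorem integrable_mul_Lp (u v : Lp ℝ 2 (leb L)) : Integrable (fun x => u x * v x) (leb L) :=
  (Lp.memLp u).integrable_mul (Lp.memLp v)

variable [hL : Fact (0 < L)]

/-- The class `Φ(f, g) z + Ψ(f, g) w` in `L₂(0, L)`. -/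
def field (Φ Ψ : C(ℝ × ℝ, ℝ)) (f g : C(Icc 0 L, ℝ)) (z w : Lp ℝ 2 (leb L)) : Lp ℝ 2 (leb L) :=
  mulOp (superpose Φ (f, g)) z + mulOp (superpose Ψ (f, g)) w

theorem field_coeFn (Φ Ψ : C(ℝ × ℝ, ℝ)) (f g : C(Icc 0 L, ℝ)) (z w : Lp ℝ 2 (leb L)) :
    field Φ Ψ f g z w =ᵐ[leb L]
      fun x => Φ (ext f x, ext g x) * z x + Ψ (ext f x, ext g x) * w x := by
  filter_upwards [Lp.coeFn_add (mulOp (superpose Φ (f, g)) z) (mulOp (superpose Ψ (f, g)) w),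
    mulOp_coeFn (superpose Φ (f, g)) z, mulOp_coeFn (superpose Ψ (f, g)) w] with x h1 h2 h3
  rw [field, h1, Pi.add_apply, h2, h3]; rfl

theorem continuous_mob (ε : ℝ) : Continuous (mob ε) := by unfold mob; fun_prop

/-- The function `(s, r) ↦ h(a_ε(s), a_ε(r))`. -/
def mobCoef (ε : ℝ) (h : ℝ × ℝ → ℝ) (hh : Continuous h) : C(ℝ × ℝ, ℝ) :=
  ⟨fun z => h (mob ε z.1, mob ε z.2), hh.comp
    (((continuous_mob ε).comp continuous_fst).prodMk ((continuous_mob ε).comp continuous_snd))⟩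

/-- The mobility has a kink at `0`, so the Galerkin system is treated with locally Lipschitz rather
than continuously differentiable coefficients. -/
theorem locallyLipschitz_mobCoef (ε : ℝ) {h : ℝ × ℝ → ℝ} (hh : ContDiff ℝ 1 h) :
    LocallyLipschitz (mobCoef ε h hh.continuous) := by
  have hm : LipschitzWith 1 (mob ε) := by
    refine LipschitzWith.of_dist_le_mul fun x y => ?_
    rw [mob, mob, dist_add_left, NNReal.coe_one, one_mul, Real.dist_eq, Real.dist_eq]
    rw [max_comm 0 x, max_comm 0 y]
    exact abs_max_sub_max_le_abs x y 0
  exact hh.locallyLipschitz.comp ((hm.locallyLipschitz.comp LipschitzWith.prod_fst.locallyLipschitz).prodMk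
    (hm.locallyLipschitz.comp LipschitzWith.prod_snd.locallyLipschitz))

theorem mob_pos {ε : ℝ} (hε : 0 < ε) (s : ℝ) : 0 < mob ε s := by
  unfold mob; linarith [le_max_left 0 s]

/-- The flux is linear in `(p, q)`; its two coefficients are later obtained by inserting `(1, 0)`
and `(0, 1)`. -/
theorem contDiff_fluxF (R p q : ℝ) : ContDiff ℝ 1 fun z : ℝ × ℝ => fluxF R z.1 z.2 p q := by
  unfold fluxF; fun_prop

theorem contDiff_fluxG (R μ p q : ℝ) : ContDiff ℝ 1 fun z : ℝ × ℝ => fluxG R μ z.1 z.2 p q := by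
  unfold fluxG; fun_prop

/-- The first flux as a class in `L₂(0, L)`. -/
def fieldF (R ε : ℝ) (f g : C(Icc 0 L, ℝ)) (z w : Lp ℝ 2 (leb L)) : Lp ℝ 2 (leb L) :=
  field (mobCoef ε _ (contDiff_fluxF R 1 0).continuous) (mobCoef ε _ (contDiff_fluxF R 0 1).continuous)
    f g z w

/-- The second flux as a class in `L₂(0, L)`. -/
def fieldG (R μ ε : ℝ) (f g : C(Icc 0 L, ℝ)) (z w : Lp ℝ 2 (leb L)) : Lp ℝ 2 (leb L) :=
  field (mobCoef ε _ (contDiff_fluxG R μ 1 0).continuous)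
    (mobCoef ε _ (contDiff_fluxG R μ 0 1).continuous) f g z w

/-- The square root of the first dissipation density. -/
def fieldY₁ (R ε : ℝ) (f g : C(Icc 0 L, ℝ)) (z w : Lp ℝ 2 (leb L)) : Lp ℝ 2 (leb L) :=
  field (mobCoef ε (fun z => √z.1 * (z.1 + R / 2 * (2 * z.1 + 3 * z.2))) (by fun_prop))
    (mobCoef ε (fun z => √z.1 * (R / 2 * (2 * z.1 + 3 * z.2))) (by fun_prop)) f g z w

/-- The square root of the second dissipation density. -/
def fieldY₂ (ε : ℝ) (f g : C(Icc 0 L, ℝ)) (z w : Lp ℝ 2 (leb L)) : Lp ℝ 2 (leb L) :=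
  field (mobCoef ε (fun z => √(z.2 ^ 3)) (by fun_prop)) (mobCoef ε (fun z => √(z.2 ^ 3)) (by fun_prop))
    f g z w

/-- The square root of the third dissipation density. -/
def fieldY₃ (ε : ℝ) (f g : C(Icc 0 L, ℝ)) (z w : Lp ℝ 2 (leb L)) : Lp ℝ 2 (leb L) :=
  field (mobCoef ε (fun z => √(z.1 * z.2 ^ 2)) (by fun_prop))
    (mobCoef ε (fun z => √(z.1 * z.2 ^ 2)) (by fun_prop)) f g z w

theorem fieldF_coeFn (R ε : ℝ) (f g : C(Icc 0 L, ℝ)) (z w : Lp ℝ 2 (leb L)) :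
    fieldF R ε f g z w =ᵐ[leb L]
      fun x => fluxF R (mob ε (ext f x)) (mob ε (ext g x)) (z x) (w x) := by
  refine (field_coeFn _ _ f g z w).trans (Eventually.of_forall fun x => ?_)
  simp only [mobCoef, ContinuousMap.coe_mk, fluxF]; ring

theorem fieldG_coeFn (R μ ε : ℝ) (f g : C(Icc 0 L, ℝ)) (z w : Lp ℝ 2 (leb L)) :
    fieldG R μ ε f g z w =ᵐ[leb L]
      fun x => fluxG R μ (mob ε (ext f x)) (mob ε (ext g x)) (z x) (w x) := by
  refine (field_coeFn _ _ f g z w).trans (Eventually.of_forall fun x => ?_)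
  simp only [mobCoef, ContinuousMap.coe_mk, fluxG]; ring

theorem fieldY₁_coeFn (R ε : ℝ) (f g : C(Icc 0 L, ℝ)) (z w : Lp ℝ 2 (leb L)) :
    fieldY₁ R ε f g z w =ᵐ[leb L] fun x => √(mob ε (ext f x)) * (mob ε (ext f x) * z x
      + R / 2 * (2 * mob ε (ext f x) + 3 * mob ε (ext g x)) * (z x + w x)) := by
  refine (field_coeFn _ _ f g z w).trans (Eventually.of_forall fun x => ?_)
  simp only [mobCoef, ContinuousMap.coe_mk]; ring

theorem fieldY₂_coeFn (ε : ℝ) (f g : C(Icc 0 L, ℝ)) (z w : Lp ℝ 2 (leb L)) :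
    fieldY₂ ε f g z w =ᵐ[leb L] fun x => √(mob ε (ext g x) ^ 3) * (z x + w x) := by
  refine (field_coeFn _ _ f g z w).trans (Eventually.of_forall fun x => ?_)
  simp only [mobCoef, ContinuousMap.coe_mk]; ring

theorem fieldY₃_coeFn (ε : ℝ) (f g : C(Icc 0 L, ℝ)) (z w : Lp ℝ 2 (leb L)) :
    fieldY₃ ε f g z w =ᵐ[leb L]
      fun x => √(mob ε (ext f x) * mob ε (ext g x) ^ 2) * (z x + w x) := by
  refine (field_coeFn _ _ f g z w).trans (Eventually.of_forall fun x => ?_)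
  simp only [mobCoef, ContinuousMap.coe_mk]; ring

theorem norm_sq_fieldY₁ (R : ℝ) {ε : ℝ} (hε : 0 < ε) (f g : C(Icc 0 L, ℝ)) (z w : Lp ℝ 2 (leb L)) :
    ‖fieldY₁ R ε f g z w‖ ^ 2 = ∫ x, mob ε (ext f x) * |mob ε (ext f x) * z x
      + R / 2 * (2 * mob ε (ext f x) + 3 * mob ε (ext g x)) * (z x + w x)| ^ 2 ∂(leb L) := by
  rw [norm_sq_eq_integral]
  refine integral_congr_ae ?_
  filter_upwards [fieldY₁_coeFn R ε f g z w] with x hx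
  rw [hx, mul_pow, Real.sq_sqrt (mob_pos hε (ext f x)).le, sq_abs]

theorem norm_sq_fieldY₂ {ε : ℝ} (hε : 0 < ε) (f g : C(Icc 0 L, ℝ)) (z w : Lp ℝ 2 (leb L)) :
    ‖fieldY₂ ε f g z w‖ ^ 2 = ∫ x, mob ε (ext g x) ^ 3 * |z x + w x| ^ 2 ∂(leb L) := by
  rw [norm_sq_eq_integral]
  refine integral_congr_ae ?_
  filter_upwards [fieldY₂_coeFn ε f g z w] with x hx
  rw [hx, mul_pow, Real.sq_sqrt (pow_nonneg (mob_pos hε (ext g x)).le 3), sq_abs]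

theorem norm_sq_fieldY₃ {ε : ℝ} (hε : 0 < ε) (f g : C(Icc 0 L, ℝ)) (z w : Lp ℝ 2 (leb L)) :
    ‖fieldY₃ ε f g z w‖ ^ 2 =
      ∫ x, mob ε (ext f x) * mob ε (ext g x) ^ 2 * |z x + w x| ^ 2 ∂(leb L) := by
  rw [norm_sq_eq_integral]
  refine integral_congr_ae ?_
  filter_upwards [fieldY₃_coeFn ε f g z w] with x hx
  rw [hx, mul_pow, Real.sq_sqrt (mul_nonneg (mob_pos hε (ext f x)).le (sq_nonneg _)), sq_abs]

/-- The energy dissipation rate. -/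
def dissip (R μ ε : ℝ) (f g : C(Icc 0 L, ℝ)) (z w : Lp ℝ 2 (leb L)) : ℝ :=
  ‖fieldY₁ R ε f g z w‖ ^ 2 + μ * R ^ 2 * ‖fieldY₂ ε f g z w‖ ^ 2
    + 3 * R ^ 2 / 4 * ‖fieldY₃ ε f g z w‖ ^ 2

theorem dissip_nonneg {R μ : ℝ} (hμ : 0 < μ) (ε : ℝ) (f g : C(Icc 0 L, ℝ)) (z w : Lp ℝ 2 (leb L)) :
    0 ≤ dissip R μ ε f g z w := by unfold dissip; positivity

/-- The algebraic heart of the energy estimate. With `s = p + q`, completing the square in `H_f (p +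
R s) + R H_g s` gives `a (a p + R/2 (2a + 3b) s)² + μ R² b³ s² + 3R²/4 a b² s²`, an identity valid
pointwise. -/
theorem dissip_eq_inner (R μ : ℝ) {ε : ℝ} (hε : 0 < ε) (f g : C(Icc 0 L, ℝ)) (z w : Lp ℝ 2 (leb L)) :
    dissip R μ ε f g z w = inner ℝ (fieldF R ε f g z w) (z + R • (z + w))
      + R * inner ℝ (fieldG R μ ε f g z w) (z + w) := by
  have i1 := integrable_mul_Lp (fieldY₁ R ε f g z w) (fieldY₁ R ε f g z w)
  have i2 := (integrable_mul_Lp (fieldY₂ ε f g z w) (fieldY₂ ε f g z w)).const_mul (μ * R ^ 2)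
  have i3 := (integrable_mul_Lp (fieldY₃ ε f g z w) (fieldY₃ ε f g z w)).const_mul (3 * R ^ 2 / 4)
  have i12 := i1.add i2
  simp only [Pi.add_def] at i12
  simp only [dissip, ← real_inner_self_eq_norm_sq, inner_eq_integral]
  rw [← integral_const_mul, ← integral_const_mul, ← integral_const_mul,
    ← integral_add i1 i2, ← integral_add i12 i3,
    ← integral_add (integrable_mul_Lp _ _) ((integrable_mul_Lp _ _).const_mul _)]
  refine integral_congr_ae ?_
  filter_upwards [fieldY₁_coeFn R ε f g z w, fieldY₂_coeFn ε f g z w, fieldY₃_coeFn ε f g z w,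
    fieldF_coeFn R ε f g z w, fieldG_coeFn R μ ε f g z w, Lp.coeFn_add z w,
    Lp.coeFn_add z (R • (z + w)), Lp.coeFn_smul R (z + w)] with x h1 h2 h3 h4 h5 h6 h7 h8
  have ha := mob_pos hε (ext f x)
  have hb := mob_pos hε (ext g x)
  have s1 := Real.sq_sqrt ha.le
  have s2 := Real.sq_sqrt (pow_nonneg hb.le 3)
  have s3 := Real.sq_sqrt (mul_nonneg ha.le (sq_nonneg (mob ε (ext g x))))
  simp only [h1, h2, h3, h4, h5, h6, h7, h8, Pi.add_apply, Pi.smul_apply, smul_eq_mul, fluxF, fluxG]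
  set a := mob ε (ext f x)
  set b := mob ε (ext g x)
  linear_combination (a * z x + R / 2 * (2 * a + 3 * b) * (z x + w x)) ^ 2 * s1
    + μ * R ^ 2 * (z x + w x) ^ 2 * s2 + 3 * R ^ 2 / 4 * (z x + w x) ^ 2 * s3

theorem exists_norm_field_le (Φ Ψ : C(ℝ × ℝ, ℝ)) (B : ℝ) : ∃ M, 0 ≤ M ∧
    ∀ (f g : C(Icc 0 L, ℝ)) (z w : Lp ℝ 2 (leb L)), ‖f‖ ≤ B → ‖g‖ ≤ B →
      ‖field Φ Ψ f g z w‖ ≤ M * (‖z‖ + ‖w‖) := by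
  have key (Θ : C(ℝ × ℝ, ℝ)) : ∃ M, 0 ≤ M ∧ ∀ s r, |s| ≤ B → |r| ≤ B → |Θ (s, r)| ≤ M := by
    obtain ⟨M, hM⟩ := (isCompact_closedBall (0 : ℝ × ℝ) B).exists_bound_of_continuousOn
      Θ.continuous.continuousOn
    refine ⟨|M|, abs_nonneg _, fun s r hs hr => (hM (s, r) ?_).trans (le_abs_self M)⟩
    rw [mem_closedBall_zero_iff]
    exact max_le hs hr
  obtain ⟨M₁, h₁, hM₁⟩ := key Φ
  obtain ⟨M₂, h₂, hM₂⟩ := key Ψ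
  refine ⟨M₁ + M₂, by positivity, fun f g z w hf hg => ?_⟩
  calc ‖field Φ Ψ f g z w‖ ≤ ‖mulOp (superpose Φ (f, g)) z‖ + ‖mulOp (superpose Ψ (f, g)) w‖ :=
        norm_add_le _ _
    _ ≤ M₁ * ‖z‖ + M₂ * ‖w‖ := add_le_add
        ((norm_mulOp_le _ _).trans (mul_le_mul_of_nonneg_right (norm_superpose_le h₁ hM₁ hf hg) (norm_nonneg _)))
        ((norm_mulOp_le _ _).trans (mul_le_mul_of_nonneg_right (norm_superpose_le h₂ hM₂ hf hg) (norm_nonneg _)))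
    _ ≤ (M₁ + M₂) * (‖z‖ + ‖w‖) := by nlinarith [norm_nonneg z, norm_nonneg w]

theorem mob_ext_le (ε : ℝ) {f : C(Icc 0 L, ℝ)} {B : ℝ} (hf : ‖f‖ ≤ B) (x : ℝ) :
    mob ε (ext f x) ≤ ε + |B| := by
  have h1 := (abs_ext_le f x).trans hf
  have h2 := le_abs_self B
  have h3 := le_abs_self (ext f x)
  have : max 0 (ext f x) ≤ |B| := max_le (abs_nonneg _) (by linarith)
  rw [mob]
  linarith

theorem le_mob (ε s : ℝ) : ε ≤ mob ε s := by
  rw [mob]; linarith [le_max_left 0 s]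

/-- The second square alone suffices, as `a_ε(g)³ ≥ ε³`. No bound on `f` and `g` is needed here. -/
theorem norm_sq_add_le_dissip {R μ ε : ℝ} (hR : 0 < R) (hμ : 0 < μ) (hε : 0 < ε)
    (f g : C(Icc 0 L, ℝ)) (z w : Lp ℝ 2 (leb L)) :
    ‖z + w‖ ^ 2 ≤ (μ * R ^ 2 * ε ^ 3)⁻¹ * dissip R μ ε f g z w := by
  have h2 : ε ^ 3 * ‖z + w‖ ^ 2 ≤ ‖fieldY₂ ε f g z w‖ ^ 2 := by
    rw [← real_inner_self_eq_norm_sq, ← real_inner_self_eq_norm_sq, inner_eq_integral, inner_eq_integral,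
      ← integral_const_mul]
    refine integral_mono_ae ((integrable_mul_Lp _ _).const_mul _) (integrable_mul_Lp _ _) ?_
    filter_upwards [fieldY₂_coeFn ε f g z w, Lp.coeFn_add z w] with x h2 h6
    have s2 := Real.sq_sqrt (pow_nonneg (mob_pos hε (ext g x)).le 3)
    rw [h2, h6, Pi.add_apply]
    calc ε ^ 3 * ((z x + w x) * (z x + w x)) ≤ mob ε (ext g x) ^ 3 * ((z x + w x) * (z x + w x)) :=
          mul_le_mul_of_nonneg_right (pow_le_pow_left₀ hε.le (le_mob ε _) 3) (mul_self_nonneg _)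
      _ = _ := by linear_combination -(z x + w x) ^ 2 * s2
  have h3 : μ * R ^ 2 * ‖fieldY₂ ε f g z w‖ ^ 2 ≤ dissip R μ ε f g z w := by
    unfold dissip
    have : 0 ≤ 3 * R ^ 2 / 4 * ‖fieldY₃ ε f g z w‖ ^ 2 := by positivity
    linarith [sq_nonneg ‖fieldY₁ R ε f g z w‖]
  rw [inv_mul_eq_div, le_div_iff₀ (by positivity), mul_comm, mul_assoc (μ * R ^ 2)]
  exact (mul_le_mul_of_nonneg_left h2 (by positivity)).trans h3

/-- Write `a z = (a z + T s) - T s` with `s = z + w`; the bracket is in the first square. Estimating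
`T s` requires an upper bound on the mobilities, and for this the supremum bounds on `f` and `g`
enter. -/
theorem norm_sq_le_fieldY₁ {R ε : ℝ} (hR : 0 < R) (hε : 0 < ε) {B : ℝ}
    {f g : C(Icc 0 L, ℝ)} (hf : ‖f‖ ≤ B) (hg : ‖g‖ ≤ B) (z w : Lp ℝ 2 (leb L)) :
    ε ^ 3 * ‖z‖ ^ 2 ≤ 2 * ‖fieldY₁ R ε f g z w‖ ^ 2
      + (ε + |B|) * (R * (5 * (ε + |B|))) ^ 2 * ‖z + w‖ ^ 2 := by
  set A := ε + |B| with hA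
  have hA0 : 0 < A := by positivity
  have is := integrable_mul_Lp (z + w) (z + w)
  rw [← real_inner_self_eq_norm_sq, ← real_inner_self_eq_norm_sq, ← real_inner_self_eq_norm_sq,
    inner_eq_integral, inner_eq_integral, inner_eq_integral,
    ← integral_const_mul, ← integral_const_mul, ← integral_const_mul,
    ← integral_add ((integrable_mul_Lp _ _).const_mul _) (is.const_mul _)]
  refine integral_mono_ae ((integrable_mul_Lp _ _).const_mul _)
    (((integrable_mul_Lp _ _).const_mul _).add (is.const_mul _)) ?_
  filter_upwards [fieldY₁_coeFn R ε f g z w, Lp.coeFn_add z w] with x h1 h6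
  have ha := mob_pos hε (ext f x)
  have hb := mob_pos hε (ext g x)
  have s1 := Real.sq_sqrt ha.le
  have haA : mob ε (ext f x) ≤ A := mob_ext_le ε hf x
  have hbA : mob ε (ext g x) ≤ A := mob_ext_le ε hg x
  have hεa := le_mob ε (ext f x)
  rw [h1, h6, Pi.add_apply]
  generalize mob ε (ext f x) = a at *
  generalize mob ε (ext g x) = b at *
  generalize z x + w x = s
  have hT : R / 2 * (2 * a + 3 * b) ≤ R / 2 * (5 * A) :=
    mul_le_mul_of_nonneg_left (by linarith) (by positivity)
  have hT0 : 0 ≤ R / 2 * (2 * a + 3 * b) := by positivity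
  generalize R / 2 * (2 * a + 3 * b) = T at *
  have e1 : √a * (a * z x + T * s) * (√a * (a * z x + T * s)) = a * (a * z x + T * s) ^ 2 := by
    linear_combination (a * z x + T * s) ^ 2 * s1
  rw [e1]
  have e2 : ε ^ 3 * (z x * z x) ≤ a * (a * z x) ^ 2 := by
    calc ε ^ 3 * (z x * z x) ≤ a ^ 3 * (z x * z x) :=
          mul_le_mul_of_nonneg_right (pow_le_pow_left₀ hε.le hεa 3) (mul_self_nonneg _)
      _ = _ := by ring
  have e3 : (a * z x) ^ 2 ≤ 2 * (a * z x + T * s) ^ 2 + 2 * (T * s) ^ 2 := by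
    linarith [sq_nonneg (a * z x + 2 * (T * s))]
  have e4 : (T * s) ^ 2 ≤ (R / 2 * (5 * A)) ^ 2 * s ^ 2 := by
    rw [mul_pow]
    exact mul_le_mul_of_nonneg_right (pow_le_pow_left₀ hT0 hT 2) (sq_nonneg _)
  calc ε ^ 3 * (z x * z x) ≤ a * (2 * (a * z x + T * s) ^ 2 + 2 * (T * s) ^ 2) :=
        e2.trans (mul_le_mul_of_nonneg_left e3 ha.le)
    _ = 2 * (a * (a * z x + T * s) ^ 2) + a * (2 * (T * s) ^ 2) := by ring
    _ ≤ 2 * (a * (a * z x + T * s) ^ 2) + A * (2 * ((R / 2 * (5 * A)) ^ 2 * s ^ 2)) := by gcongr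
    _ ≤ 2 * (a * (a * z x + T * s) ^ 2) + A * (R * (5 * A)) ^ 2 * (s * s) := by
        have h : 0 ≤ A * (R * (5 * A)) ^ 2 * (s * s) :=
          mul_nonneg (by positivity) (mul_self_nonneg _)
        have e : A * (2 * ((R / 2 * (5 * A)) ^ 2 * s ^ 2)) = 1 / 2 * (A * (R * (5 * A)) ^ 2 * (s * s)) := by
          ring
        linarith

/-- The dissipation controls the third derivatives, since the mobility is bounded below. -/
theorem exists_norm_sq_le_dissip {R μ ε : ℝ} (hR : 0 < R) (hμ : 0 < μ) (hε : 0 < ε) (B : ℝ) :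
    ∃ M, 0 ≤ M ∧ ∀ (f g : C(Icc 0 L, ℝ)) (z w : Lp ℝ 2 (leb L)), ‖f‖ ≤ B → ‖g‖ ≤ B →
      ‖z‖ ^ 2 ≤ M * dissip R μ ε f g z w ∧ ‖w‖ ^ 2 ≤ M * dissip R μ ε f g z w := by
  set A := (ε + |B|) * (R * (5 * (ε + |B|))) ^ 2 with hA
  have hA0 : 0 ≤ A := by positivity
  set m := (μ * R ^ 2 * ε ^ 3)⁻¹ with hm
  have hm0 : 0 ≤ m := by positivity
  set N := (ε ^ 3)⁻¹ * (2 + A * m) with hN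
  have hN0 : 0 ≤ N := by positivity
  refine ⟨2 * (N + m), by positivity, fun f g z w hf hg => ?_⟩
  have hD := dissip_nonneg (R := R) hμ ε f g z w
  have h1 : ‖z + w‖ ^ 2 ≤ m * dissip R μ ε f g z w := norm_sq_add_le_dissip hR hμ hε f g z w
  have h5 : ‖z‖ ^ 2 ≤ N * dissip R μ ε f g z w := by
    have h2 := norm_sq_le_fieldY₁ hR hε hf hg z w
    have h3 : ‖fieldY₁ R ε f g z w‖ ^ 2 ≤ dissip R μ ε f g z w := by
      unfold dissip
      have : 0 ≤ μ * R ^ 2 * ‖fieldY₂ ε f g z w‖ ^ 2 := by positivity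
      have : 0 ≤ 3 * R ^ 2 / 4 * ‖fieldY₃ ε f g z w‖ ^ 2 := by positivity
      linarith
    have h4 : A * ‖z + w‖ ^ 2 ≤ A * (m * dissip R μ ε f g z w) := mul_le_mul_of_nonneg_left h1 hA0
    rw [hN, mul_assoc, inv_mul_eq_div, le_div_iff₀ (by positivity), mul_comm]
    calc _ ≤ _ := h2
      _ ≤ 2 * dissip R μ ε f g z w + A * (m * dissip R μ ε f g z w) :=
          add_le_add (mul_le_mul_of_nonneg_left h3 zero_le_two) h4
      _ = _ := by ring
  have hmD := mul_nonneg hm0 hD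
  have hND := mul_nonneg hN0 hD
  rw [mul_assoc, add_mul]
  refine ⟨by linarith, ?_⟩
  have h7 : ‖w‖ ≤ ‖z + w‖ + ‖z‖ := by
    have := norm_sub_le (z + w) z
    rwa [add_sub_cancel_left] at this
  have h8 := pow_le_pow_left₀ (norm_nonneg w) h7 2
  have h9 := sq_nonneg (‖z + w‖ - ‖z‖)
  linarith

end

end ThinFilm

namespace ThinFilm

noncomputable section

variable {L : ℝ} [hL : Fact (0 < L)]

/-! ### The Galerkin system in terms of cosine coefficients -/

/-- The third derivative of a cosine series. -/
def third (L : ℝ) [Fact (0 < L)] (c : ℕ → ℝ) : Lp ℝ 2 (leb L) := dxL2 3 (sumH3 L c)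

/-- The first flux of a pair of cosine series. -/
def seqF (L R ε : ℝ) [Fact (0 < L)] (c d : ℕ → ℝ) : Lp ℝ 2 (leb L) :=
  fieldF R ε (sumC L c) (sumC L d) (third L c) (third L d)

/-- The second flux of a pair of cosine series. -/
def seqG (L R μ ε : ℝ) [Fact (0 < L)] (c d : ℕ → ℝ) : Lp ℝ 2 (leb L) :=
  fieldG R μ ε (sumC L c) (sumC L d) (third L c) (third L d)

/-- The energy dissipation of a pair of cosine series. -/
def seqD (L R μ ε : ℝ) [Fact (0 < L)] (c d : ℕ → ℝ) : ℝ :=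
  dissip R μ ε (sumC L c) (sumC L d) (third L c) (third L d)

/-- The energy of the first `n` modes of a pair of cosine series. -/
def modeEnergy (L R : ℝ) (n : ℕ) (c d : ℕ → ℝ) : ℝ :=
  1 / 2 * ∑ k ∈ Finset.range n, wave L k ^ 2 * (c k ^ 2 + R * (c k + d k) ^ 2)

/-- The coefficients `p, q` of a Galerkin approximation of order `n`, extended to negative times by
their initial values. -/
structure IsGalerkinCurve (L R μ ε : ℝ) [Fact (0 < L)] (c₀ d₀ : ℕ → ℝ) (n : ℕ)
    (p q : ℝ → ℕ → ℝ) : Prop where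
  eq_zero : ∀ t k, n < k → p t k = 0 ∧ q t k = 0
  init : ∀ k ≤ n, p 0 k = c₀ k ∧ q 0 k = d₀ k
  of_neg : ∀ t ≤ 0, p t = p 0 ∧ q t = q 0
  deriv_fst : ∀ k ≤ n, ∀ t ≥ 0, HasDerivWithinAt (fun s => p s k)
    (inner ℝ (seqF L R ε (p t) (q t)) (dxL2 1 (cosH3 k))) (Ici 0) t
  deriv_snd : ∀ k ≤ n, ∀ t ≥ 0, HasDerivWithinAt (fun s => q s k)
    (inner ℝ (seqG L R μ ε (p t) (q t)) (dxL2 1 (cosH3 k))) (Ici 0) t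

theorem tsum_smul_of_eq_zero {E : Type*} [NormedAddCommGroup E] [NormedSpace ℝ E] {c : ℕ → ℝ} {n : ℕ}
    (hc : ∀ k, n < k → c k = 0) (e : ℕ → E) :
    ∑' k, c k • e k = ∑ k ∈ Finset.range (n + 1), c k • e k :=
  tsum_eq_sum fun k hk => by
    rw [hc k (by rw [Finset.mem_range] at hk; omega), zero_smul]

theorem third_of_eq_zero {c : ℕ → ℝ} {n : ℕ} (hc : ∀ k, n < k → c k = 0) :
    third L c = ∑ k ∈ Finset.range (n + 1), (c k * wave L k ^ 3) • sinE k := by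
  rw [third, sumH3, tsum_smul_of_eq_zero hc, map_sum]
  simp only [map_smul, dxL2_three_cosH3, smul_smul]

/-- The sum over modes is the Galerkin system tested with `-∂_x²(f + R(f+g))` and `-R ∂_x²(f+g)`.
The factor `w²` from `-∂_x²` turns `∂_x φ_k = -w sin` into minus the third derivative, which
produces the sign. -/
theorem sum_wave_sq_mul_flux (R μ : ℝ) {ε : ℝ} (hε : 0 < ε) {c d : ℕ → ℝ} {n : ℕ}
    (hc : ∀ k, n < k → c k = 0) (hd : ∀ k, n < k → d k = 0) :
    ∑ k ∈ Finset.range (n + 1), wave L k ^ 2 *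
      (c k * inner ℝ (seqF L R ε c d) (dxL2 1 (cosH3 k)) + R * (c k + d k) *
        (inner ℝ (seqF L R ε c d) (dxL2 1 (cosH3 k)) + inner ℝ (seqG L R μ ε c d) (dxL2 1 (cosH3 k))))
      = -seqD L R μ ε c d := by
  rw [seqD, dissip_eq_inner R μ hε, ← seqF, ← seqG]
  generalize seqF L R ε c d = F
  generalize seqG L R μ ε c d = G
  have h (H : Lp ℝ 2 (leb L)) {c : ℕ → ℝ} (hc : ∀ k, n < k → c k = 0) :
      inner ℝ H (third L c) = ∑ k ∈ Finset.range (n + 1), c k * wave L k ^ 3 * inner ℝ H (sinE k) := by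
    rw [third_of_eq_zero hc, inner_sum]
    simp only [inner_smul_right]
  simp only [inner_add_right, inner_smul_right, h F hc, h F hd, h G hc, h G hd, dxL2_one_cosH3]
  simp only [Finset.mul_sum, ← Finset.sum_add_distrib, ← Finset.sum_neg_distrib]
  exact Finset.sum_congr rfl fun k _ => by ring

theorem seqD_nonneg {R μ : ℝ} (hμ : 0 < μ) (ε : ℝ) (c d : ℕ → ℝ) : 0 ≤ seqD L R μ ε c d :=
  dissip_nonneg hμ _ _ _ _ _

/-- Extension of a finite family of coefficients by zero. -/
def toSeq {n : ℕ} (y : Fin (n + 1) → ℝ) (k : ℕ) : ℝ := if h : k < n + 1 then y ⟨k, h⟩ else 0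

theorem toSeq_of_lt {n : ℕ} (y : Fin (n + 1) → ℝ) {k : ℕ} (h : n < k) : toSeq y k = 0 :=
  dif_neg (by omega)

theorem toSeq_val {n : ℕ} (y : Fin (n + 1) → ℝ) (i : Fin (n + 1)) : toSeq y i = y i :=
  dif_pos i.2

theorem tsum_toSeq {E : Type*} [NormedAddCommGroup E] [NormedSpace ℝ E] {n : ℕ}
    (y : Fin (n + 1) → ℝ) (e : ℕ → E) : ∑' k, toSeq y k • e k = ∑ i, y i • e i := by
  rw [tsum_smul_of_eq_zero (fun k hk => toSeq_of_lt y hk), Finset.sum_range]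
  simp only [toSeq_val]

theorem locallyLipschitz_smul {E F : Type*} [PseudoEMetricSpace E] [NormedAddCommGroup F]
    [NormedSpace ℝ F] {c : E → ℝ} {z : E → F} (hc : LocallyLipschitz c) (hz : LocallyLipschitz z) :
    LocallyLipschitz fun y => c y • z y := by
  have hs : LocallyLipschitz fun z : ℝ × F => z.1 • z.2 :=
    ContDiff.locallyLipschitz (𝕂 := ℝ) (contDiff_fst.smul contDiff_snd)
  exact hs.comp (hc.prodMk hz)

theorem locallyLipschitz_bilinear {E F G H : Type*} [PseudoEMetricSpace E] [NormedAddCommGroup F]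
    [NormedSpace ℝ F] [NormedAddCommGroup G] [NormedSpace ℝ G] [NormedAddCommGroup H] [NormedSpace ℝ H]
    (b : F →L[ℝ] G →L[ℝ] H) {c : E → F} {z : E → G} (hc : LocallyLipschitz c)
    (hz : LocallyLipschitz z) : LocallyLipschitz fun y => b (c y) (z y) := by
  have hb : LocallyLipschitz fun z : F × G => b z.1 z.2 :=
    ContDiff.locallyLipschitz (𝕂 := ℝ) b.isBoundedBilinearMap.contDiff
  exact hb.comp (hc.prodMk hz)

theorem locallyLipschitz_field {E : Type*} [PseudoEMetricSpace E] {Φ Ψ : C(ℝ × ℝ, ℝ)}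
    (hΦ : LocallyLipschitz Φ) (hΨ : LocallyLipschitz Ψ) {f g : E → C(Icc 0 L, ℝ)}
    {z w : E → Lp ℝ 2 (leb L)} (hf : LocallyLipschitz f) (hg : LocallyLipschitz g)
    (hz : LocallyLipschitz z) (hw : LocallyLipschitz w) :
    LocallyLipschitz fun y => field Φ Ψ (f y) (g y) (z y) (w y) := by
  have h1 := locallyLipschitz_bilinear mulOp ((locallyLipschitz_superpose hΦ).comp (hf.prodMk hg)) hz
  have h2 := locallyLipschitz_bilinear mulOp ((locallyLipschitz_superpose hΨ).comp (hf.prodMk hg)) hw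
  exact h1.add h2

theorem locallyLipschitz_sum_smul {F : Type*} [NormedAddCommGroup F] [NormedSpace ℝ F] {n : ℕ}
    (e : ℕ → F) : LocallyLipschitz fun y : Fin (n + 1) → ℝ => ∑' k, toSeq y k • e k := by
  simp only [tsum_toSeq]
  exact ContDiff.locallyLipschitz (𝕂 := ℝ) (by fun_prop)

theorem locallyLipschitz_sumC (n : ℕ) :
    LocallyLipschitz fun y : Fin (n + 1) → ℝ => sumC L (toSeq y) :=
  locallyLipschitz_sum_smul (F := C(Icc 0 L, ℝ)) cosC

theorem locallyLipschitz_third (n : ℕ) :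
    LocallyLipschitz fun y : Fin (n + 1) → ℝ => third L (toSeq y) :=
  (dxL2 3).lipschitz.locallyLipschitz.comp (locallyLipschitz_sum_smul _)

/-- The vector field of the Galerkin system. -/
def galerkinField (L R μ ε : ℝ) [Fact (0 < L)] (n : ℕ) (y : (Fin (n + 1) → ℝ) × (Fin (n + 1) → ℝ)) :
    (Fin (n + 1) → ℝ) × (Fin (n + 1) → ℝ) :=
  (fun i => inner ℝ (seqF L R ε (toSeq y.1) (toSeq y.2)) (dxL2 1 (cosH3 i)),
    fun i => inner ℝ (seqG L R μ ε (toSeq y.1) (toSeq y.2)) (dxL2 1 (cosH3 i)))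

theorem locallyLipschitz_galerkinField (R μ ε : ℝ) (n : ℕ) :
    LocallyLipschitz (galerkinField L R μ ε n) := by
  have p1 := (LipschitzWith.prod_fst (α := Fin (n + 1) → ℝ) (β := Fin (n + 1) → ℝ)).locallyLipschitz
  have p2 := (LipschitzWith.prod_snd (α := Fin (n + 1) → ℝ) (β := Fin (n + 1) → ℝ)).locallyLipschitz
  have f1 := (locallyLipschitz_sumC (L := L) n).comp p1
  have f2 := (locallyLipschitz_sumC (L := L) n).comp p2
  have z1 := (locallyLipschitz_third (L := L) n).comp p1
  have z2 := (locallyLipschitz_third (L := L) n).comp p2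
  have hF := locallyLipschitz_field (L := L) (locallyLipschitz_mobCoef ε (contDiff_fluxF R 1 0))
    (locallyLipschitz_mobCoef ε (contDiff_fluxF R 0 1)) f1 f2 z1 z2
  have hG := locallyLipschitz_field (L := L) (locallyLipschitz_mobCoef ε (contDiff_fluxG R μ 1 0))
    (locallyLipschitz_mobCoef ε (contDiff_fluxG R μ 0 1)) f1 f2 z1 z2
  have hl : LocallyLipschitz fun z : Lp ℝ 2 (leb L) => fun i : Fin (n + 1) =>
      inner ℝ z (dxL2 1 (cosH3 (i : ℕ) : Sob L 3)) := by
    refine ContDiff.locallyLipschitz (𝕂 := ℝ) (contDiff_pi.2 fun i => ?_)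
    exact contDiff_id.inner ℝ contDiff_const
  have hF' := hl.comp hF
  have hG' := hl.comp hG
  exact hF'.prodMk hG'

theorem hasDerivAt_modeEnergy (L R : ℝ) (n : ℕ) {p q p' q' : ℕ → ℝ → ℝ} {t : ℝ}
    (hp : ∀ k < n, HasDerivAt (p k) (p' k t) t) (hq : ∀ k < n, HasDerivAt (q k) (q' k t) t) :
    HasDerivAt (fun s => modeEnergy L R n (fun k => p k s) fun k => q k s)
      (∑ k ∈ Finset.range n, wave L k ^ 2 *
        (p k t * p' k t + R * (p k t + q k t) * (p' k t + q' k t))) t := by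
  have h (k : ℕ) (hk : k ∈ Finset.range n) :
      HasDerivAt (fun s => wave L k ^ 2 * (p k s ^ 2 + R * (p k s + q k s) ^ 2))
        (2 * (wave L k ^ 2 * (p k t * p' k t + R * (p k t + q k t) * (p' k t + q' k t)))) t := by
    have h1 := hp k (Finset.mem_range.1 hk)
    have h2 := hq k (Finset.mem_range.1 hk)
    refine (((h1.pow 2).add (((h1.add h2).pow 2).const_mul R)).const_mul (wave L k ^ 2)).congr_deriv ?_
    simp only [Pi.add_apply]
    push_cast; ring
  refine ((HasDerivAt.fun_sum h).const_mul (1 / 2)).congr_deriv ?_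
  rw [← Finset.mul_sum]; ring

/-- The energy gives `c² ≤ M` and `(c + d)² ≤ M / R` with `M = 2E / (wave L 1)²`, and `d = (c + d) -
c`. The constant mode is invisible to the energy and has to be excluded. -/
theorem sq_le_of_modeEnergy_le {R : ℝ} (hR : 0 < R) {n : ℕ} {c d : ℕ → ℝ} {E : ℝ}
    (h : modeEnergy L R n c d ≤ E) {k : ℕ} (hk : k < n) (hk0 : k ≠ 0) :
    c k ^ 2 ≤ (wave L 1)⁻¹ ^ 2 * (4 * E * (1 + 1 / R)) ∧
      d k ^ 2 ≤ (wave L 1)⁻¹ ^ 2 * (4 * E * (1 + 1 / R)) := by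
  have h1 : wave L k ^ 2 * (c k ^ 2 + R * (c k + d k) ^ 2) ≤ 2 * E := by
    have := Finset.single_le_sum (f := fun k => wave L k ^ 2 * (c k ^ 2 + R * (c k + d k) ^ 2))
      (fun i _ => by positivity) (Finset.mem_range.2 hk)
    unfold modeEnergy at h
    linarith
  have h2 : c k ^ 2 + R * (c k + d k) ^ 2 ≤ (wave L 1)⁻¹ ^ 2 * (2 * E) := by
    have := one_le_mul_wave_pow (L := L) hk0 2
    calc c k ^ 2 + R * (c k + d k) ^ 2
        ≤ (wave L 1)⁻¹ ^ 2 * wave L k ^ 2 * (c k ^ 2 + R * (c k + d k) ^ 2) :=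
          le_mul_of_one_le_left (by positivity) this
      _ ≤ _ := by rw [mul_assoc]; exact mul_le_mul_of_nonneg_left h1 (by positivity)
  set M := (wave L 1)⁻¹ ^ 2 * (2 * E) with hM
  have hs : 0 ≤ R * (c k + d k) ^ 2 := by positivity
  have hM0 : 0 ≤ M := by linarith [sq_nonneg (c k)]
  have h3 : (c k + d k) ^ 2 ≤ M / R := by
    rw [le_div_iff₀ hR, mul_comm]; linarith [sq_nonneg (c k)]
  have e : (wave L 1)⁻¹ ^ 2 * (4 * E * (1 + 1 / R)) = 2 * M + 2 * (M / R) := by rw [hM]; ring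
  have h4 : 0 ≤ M / R := by positivity
  rw [e]
  exact ⟨by linarith, by linarith [sq_nonneg (2 * c k + d k)]⟩

/-- Multiplying the vector field by a cutoff makes it bounded and its solutions global. The cutoff
is a nonnegative scalar, so the modified flow still decreases the energy and fixes the constant
modes. Its solution thus never leaves the region where the cutoff is `1` and solves the original
system. -/
theorem exists_isGalerkinCurve {R μ ε : ℝ} (hR : 0 < R) (hμ : 0 < μ) (hε : 0 < ε) (c₀ d₀ : ℕ → ℝ) (n : ℕ) :
    ∃ p q, IsGalerkinCurve L R μ ε c₀ d₀ n p q := by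
  let V := (Fin (n + 1) → ℝ) × (Fin (n + 1) → ℝ)
  let y₀ : V := (fun i => c₀ i, fun i => d₀ i)
  set E₀ := modeEnergy L R (n + 1) (toSeq y₀.1) (toSeq y₀.2) with hE₀
  -- The root is the a priori bound for the modes `k ≥ 1`; the next two terms bound the conserved
  -- constant modes, and the `1` makes the radius positive.
  set M := √((wave L 1)⁻¹ ^ 2 * (4 * E₀ * (1 + 1 / R))) + |c₀ 0| + |d₀ 0| + 1 with hM
  have hM0 : 0 < M := by positivity
  let χ : ContDiffBump (0 : V) := ⟨M, M + 1, hM0, by linarith⟩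
  let v : V → V := fun y => χ y • galerkinField L R μ ε n y
  have hgl := locallyLipschitz_galerkinField (L := L) R μ ε n
  have hv : LocallyLipschitz v :=
    locallyLipschitz_smul (ContDiff.locallyLipschitz (𝕂 := ℝ) χ.contDiff) hgl
  obtain ⟨B, hB⟩ : ∃ B : ℝ≥0, ∀ y, ‖v y‖ ≤ B := by
    obtain ⟨B, hB⟩ := (isCompact_closedBall (0 : V) (M + 1)).exists_bound_of_continuousOn
      hgl.continuous.continuousOn
    refine ⟨Real.toNNReal |B|, fun y => ?_⟩
    rw [Real.coe_toNNReal _ (abs_nonneg _)]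
    by_cases hy : y ∈ Metric.closedBall (0 : V) (M + 1)
    · rw [norm_smul, Real.norm_of_nonneg χ.nonneg]
      exact (mul_le_of_le_one_left (norm_nonneg _) χ.le_one).trans ((hB y hy).trans (le_abs_self B))
    · have : χ y = 0 := χ.zero_of_le_dist (not_le.1 hy).le
      simp [v, this]
  obtain ⟨y, hy0, hy⟩ := exists_integralCurve_of_bounded hv hB y₀
  have d1 (t : ℝ) (i : Fin (n + 1)) : HasDerivAt (fun s => (y s).1 i)
      (χ (y t) * inner ℝ (seqF L R ε (toSeq (y t).1) (toSeq (y t).2)) (dxL2 1 (cosH3 i))) t :=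
    hasDerivAt_pi.1 ((hasFDerivAt_fst (𝕜 := ℝ)).comp_hasDerivAt t (hy t)) i
  have d2 (t : ℝ) (i : Fin (n + 1)) : HasDerivAt (fun s => (y s).2 i)
      (χ (y t) * inner ℝ (seqG L R μ ε (toSeq (y t).1) (toSeq (y t).2)) (dxL2 1 (cosH3 i))) t :=
    hasDerivAt_pi.1 ((hasFDerivAt_snd (𝕜 := ℝ)).comp_hasDerivAt t (hy t)) i
  have e1 (t : ℝ) (k : ℕ) (hk : k < n + 1) : HasDerivAt (fun s => toSeq (y s).1 k)
      (χ (y t) * inner ℝ (seqF L R ε (toSeq (y t).1) (toSeq (y t).2)) (dxL2 1 (cosH3 k))) t := by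
    have := d1 t ⟨k, hk⟩
    simpa only [toSeq, dif_pos hk] using this
  have e2 (t : ℝ) (k : ℕ) (hk : k < n + 1) : HasDerivAt (fun s => toSeq (y s).2 k)
      (χ (y t) * inner ℝ (seqG L R μ ε (toSeq (y t).1) (toSeq (y t).2)) (dxL2 1 (cosH3 k))) t := by
    have := d2 t ⟨k, hk⟩
    simpa only [toSeq, dif_pos hk] using this
  have hen (t : ℝ) : HasDerivAt (fun s => modeEnergy L R (n + 1) (toSeq (y s).1) (toSeq (y s).2))
      (-(χ (y t) * seqD L R μ ε (toSeq (y t).1) (toSeq (y t).2))) t := by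
    refine (hasDerivAt_modeEnergy L R (n + 1) (p := fun k s => toSeq (y s).1 k)
      (q := fun k s => toSeq (y s).2 k) (p' := fun k t => _) (q' := fun k t => _)
      (e1 t) (e2 t)).congr_deriv ?_
    have h := sum_wave_sq_mul_flux (L := L) R μ hε (c := toSeq (y t).1) (d := toSeq (y t).2) (n := n)
      (fun k hk => toSeq_of_lt _ hk) fun k hk => toSeq_of_lt _ hk
    rw [← mul_neg, ← h, Finset.mul_sum]
    exact Finset.sum_congr rfl fun k _ => by ring
  have hanti : Antitone fun s => modeEnergy L R (n + 1) (toSeq (y s).1) (toSeq (y s).2) :=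
    antitone_of_hasDerivAt_nonpos hen fun t =>
      neg_nonpos.2 (mul_nonneg χ.nonneg (seqD_nonneg hμ ε _ _))
  have hz : dxL2 1 (cosH3 0 : Sob L 3) = 0 := by rw [dxL2_one_cosH3, wave_zero]; simp
  have hc1 (t : ℝ) : (y t).1 0 = c₀ 0 := by
    have := is_const_of_deriv_eq_zero (f := fun s => (y s).1 0) (fun t => (d1 t 0).differentiableAt)
      (fun t => by rw [(d1 t 0).deriv]; simp [hz]) t 0
    simpa [hy0, y₀] using this
  have hc2 (t : ℝ) : (y t).2 0 = d₀ 0 := by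
    have := is_const_of_deriv_eq_zero (f := fun s => (y s).2 0) (fun t => (d2 t 0).differentiableAt)
      (fun t => by rw [(d2 t 0).deriv]; simp [hz]) t 0
    simpa [hy0, y₀] using this
  have hχ (t : ℝ) (ht : 0 ≤ t) : χ (y t) = 1 := by
    refine χ.one_of_mem_closedBall ?_
    have hE : modeEnergy L R (n + 1) (toSeq (y t).1) (toSeq (y t).2) ≤ E₀ := by
      have := hanti ht
      simpa only [hy0] using this
    have hb (i : Fin (n + 1)) : |(y t).1 i| ≤ M ∧ |(y t).2 i| ≤ M := by
      by_cases hi : i = 0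
      · subst hi
        rw [hc1, hc2]
        have := Real.sqrt_nonneg ((wave L 1)⁻¹ ^ 2 * (4 * E₀ * (1 + 1 / R)))
        constructor <;> linarith [abs_nonneg (c₀ 0), abs_nonneg (d₀ 0)]
      · have := sq_le_of_modeEnergy_le hR hE i.2 fun h => hi (Fin.ext h)
        rw [toSeq_val, toSeq_val] at this
        have h1 := Real.abs_le_sqrt this.1
        have h2 := Real.abs_le_sqrt this.2
        constructor <;> linarith [abs_nonneg (c₀ 0), abs_nonneg (d₀ 0)]
    change y t ∈ Metric.closedBall 0 M
    rw [mem_closedBall_zero_iff]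
    exact max_le ((pi_norm_le_iff_of_nonneg hM0.le).2 fun i => (hb i).1)
      ((pi_norm_le_iff_of_nonneg hM0.le).2 fun i => (hb i).2)
  -- For negative times the energy bound is lost. Freezing the coefficients there keeps all
  -- estimates valid on the whole line, where the compactness argument takes place.
  refine ⟨fun t => toSeq (y (max t 0)).1, fun t => toSeq (y (max t 0)).2, ?_, ?_, ?_, ?_, ?_⟩
  · exact fun t k hk => ⟨toSeq_of_lt _ hk, toSeq_of_lt _ hk⟩
  · intro k hk
    have hk' : k < n + 1 := by omega
    simp only [max_self, hy0, toSeq, dif_pos hk', y₀, and_self]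
  · intro t ht
    simp only [max_eq_right ht, max_self, and_self]
  · intro k hk t ht
    have := (e1 t k (by omega)).hasDerivWithinAt (s := Ici 0)
    rw [hχ t ht, one_mul] at this
    simp only [max_eq_left ht]
    exact this.congr_of_mem (fun s hs => by simp only [max_eq_left (mem_Ici.1 hs)]) ht
  · intro k hk t ht
    have := (e2 t k (by omega)).hasDerivWithinAt (s := Ici 0)
    rw [hχ t ht, one_mul] at this
    simp only [max_eq_left ht]
    exact this.congr_of_mem (fun s hs => by simp only [max_eq_left (mem_Ici.1 hs)]) ht

end

end ThinFilm

namespace ThinFilm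

noncomputable section

variable {L : ℝ} [hL : Fact (0 < L)]

/-! ### Uniform bounds for the Galerkin approximations -/

theorem continuous_mulOp {E : Type*} [TopologicalSpace E] {c : E → C(Icc 0 L, ℝ)}
    {z : E → Lp ℝ 2 (leb L)} (hc : Continuous c) (hz : Continuous z) :
    Continuous fun y => mulOp (c y) (z y) :=
  (mulOp.continuous.comp hc).clm_apply hz

theorem continuous_field (Φ Ψ : C(ℝ × ℝ, ℝ)) {E : Type*} [TopologicalSpace E]
    {f g : E → C(Icc 0 L, ℝ)} {z w : E → Lp ℝ 2 (leb L)} (hf : Continuous f) (hg : Continuous g)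
    (hz : Continuous z) (hw : Continuous w) :
    Continuous fun y => field Φ Ψ (f y) (g y) (z y) (w y) :=
  (continuous_mulOp ((continuous_superpose Φ).comp (hf.prodMk hg)) hz).add
    (continuous_mulOp ((continuous_superpose Ψ).comp (hf.prodMk hg)) hw)

theorem continuous_sumC_of_eq_zero {E : Type*} [TopologicalSpace E] {c : E → ℕ → ℝ} {n : ℕ}
    (hc : ∀ t k, n < k → c t k = 0) (hcont : ∀ k, Continuous fun t => c t k) :
    Continuous fun t => sumC L (c t) := by
  have e (t : E) : sumC L (c t) = ∑ k ∈ Finset.range (n + 1), c t k • cosC k :=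
    tsum_smul_of_eq_zero (hc t) cosC
  simp only [e]
  exact continuous_finsetSum _ fun k _ => (hcont k).smul continuous_const

theorem continuous_third_of_eq_zero {E : Type*} [TopologicalSpace E] {c : E → ℕ → ℝ} {n : ℕ}
    (hc : ∀ t k, n < k → c t k = 0) (hcont : ∀ k, Continuous fun t => c t k) :
    Continuous fun t => third L (c t) := by
  simp only [fun t => third_of_eq_zero (L := L) (hc t)]
  exact continuous_finsetSum _ fun k _ => ((hcont k).mul continuous_const).smul continuous_const

theorem summable_mul_of_eq_zero {c : ℕ → ℝ} {n : ℕ} (hc : ∀ k, n < k → c k = 0) (a : ℕ → ℝ) :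
    Summable fun k => a k * c k ^ 2 :=
  summable_of_ne_finset_zero (s := Finset.range (n + 1)) fun k hk => by
    rw [hc k (by rw [Finset.mem_range] at hk; omega)]; ring

namespace IsGalerkinCurve

variable {R μ ε : ℝ} {c₀ d₀ : ℕ → ℝ} {n : ℕ} {p q : ℝ → ℕ → ℝ}

theorem eq_max (h : IsGalerkinCurve L R μ ε c₀ d₀ n p q) (t : ℝ) :
    p t = p (max t 0) ∧ q t = q (max t 0) := by
  rcases le_total t 0 with ht | ht
  · rw [max_eq_right ht]; exact h.of_neg t ht
  · rw [max_eq_left ht]; exact ⟨rfl, rfl⟩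

theorem continuous_coeff (h : IsGalerkinCurve L R μ ε c₀ d₀ n p q) (k : ℕ) :
    Continuous (fun t => p t k) ∧ Continuous fun t => q t k := by
  by_cases hk : k ≤ n
  · have h1 : ContinuousOn (fun t => p t k) (Ici 0) :=
      fun t ht => (h.deriv_fst k hk t ht).continuousWithinAt
    have h2 : ContinuousOn (fun t => q t k) (Ici 0) :=
      fun t ht => (h.deriv_snd k hk t ht).continuousWithinAt
    have hm : Continuous fun t : ℝ => max t 0 := by fun_prop
    refine ⟨(h1.comp_continuous hm fun t => mem_Ici.2 (le_max_right _ _)).congr fun t => ?_,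
      (h2.comp_continuous hm fun t => mem_Ici.2 (le_max_right _ _)).congr fun t => ?_⟩
    · rw [(h.eq_max t).1]; rfl
    · rw [(h.eq_max t).2]; rfl
  · simp only [fun t => (h.eq_zero t k (not_le.1 hk)).1, fun t => (h.eq_zero t k (not_le.1 hk)).2]
    exact ⟨continuous_const, continuous_const⟩

theorem continuous_field (Φ Ψ : C(ℝ × ℝ, ℝ)) (h : IsGalerkinCurve L R μ ε c₀ d₀ n p q) :
    Continuous fun t => field Φ Ψ (sumC L (p t)) (sumC L (q t)) (third L (p t)) (third L (q t)) :=
  ThinFilm.continuous_field Φ Ψ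
    (continuous_sumC_of_eq_zero (fun t k hk => (h.eq_zero t k hk).1) fun k => (h.continuous_coeff k).1)
    (continuous_sumC_of_eq_zero (fun t k hk => (h.eq_zero t k hk).2) fun k => (h.continuous_coeff k).2)
    (continuous_third_of_eq_zero (fun t k hk => (h.eq_zero t k hk).1) fun k => (h.continuous_coeff k).1)
    (continuous_third_of_eq_zero (fun t k hk => (h.eq_zero t k hk).2) fun k => (h.continuous_coeff k).2)

theorem continuous_seqD (h : IsGalerkinCurve L R μ ε c₀ d₀ n p q) :
    Continuous fun t => seqD L R μ ε (p t) (q t) := by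
  unfold seqD dissip
  have h1 : Continuous fun t => fieldY₁ R ε (sumC L (p t)) (sumC L (q t)) (third L (p t)) (third L (q t)) :=
    h.continuous_field _ _
  have h2 : Continuous fun t => fieldY₂ ε (sumC L (p t)) (sumC L (q t)) (third L (p t)) (third L (q t)) :=
    h.continuous_field _ _
  have h3 : Continuous fun t => fieldY₃ ε (sumC L (p t)) (sumC L (q t)) (third L (p t)) (third L (q t)) :=
    h.continuous_field _ _
  exact ((h1.norm.pow 2).add ((h2.norm.pow 2).const_mul _)).add ((h3.norm.pow 2).const_mul _)

theorem hasDerivAt_fst (h : IsGalerkinCurve L R μ ε c₀ d₀ n p q) {k : ℕ} (hk : k ≤ n) {t : ℝ} (ht : 0 < t) :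
    HasDerivAt (fun s => p s k) (inner ℝ (seqF L R ε (p t) (q t)) (dxL2 1 (cosH3 k))) t :=
  (h.deriv_fst k hk t ht.le).hasDerivAt (Ici_mem_nhds ht)

theorem hasDerivAt_snd (h : IsGalerkinCurve L R μ ε c₀ d₀ n p q) {k : ℕ} (hk : k ≤ n) {t : ℝ} (ht : 0 < t) :
    HasDerivAt (fun s => q s k) (inner ℝ (seqG L R μ ε (p t) (q t)) (dxL2 1 (cosH3 k))) t :=
  (h.deriv_snd k hk t ht.le).hasDerivAt (Ici_mem_nhds ht)

theorem hasDerivAt_energy (hε : 0 < ε) (h : IsGalerkinCurve L R μ ε c₀ d₀ n p q) {t : ℝ} (ht : 0 < t) :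
    HasDerivAt (fun s => modeEnergy L R (n + 1) (p s) (q s)) (-seqD L R μ ε (p t) (q t)) t := by
  refine (hasDerivAt_modeEnergy L R (n + 1) (p := fun k s => p s k)
    (q := fun k s => q s k) (p' := fun k t => _) (q' := fun k t => _)
    (fun k hk => h.hasDerivAt_fst (by omega) ht) (fun k hk => h.hasDerivAt_snd (by omega) ht)).congr_deriv ?_
  exact sum_wave_sq_mul_flux R μ hε (fun k hk => (h.eq_zero t k hk).1) fun k hk => (h.eq_zero t k hk).2

theorem continuous_energy (h : IsGalerkinCurve L R μ ε c₀ d₀ n p q) (m : ℕ) :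
    Continuous fun t => modeEnergy L R m (p t) (q t) := by
  unfold modeEnergy
  refine (continuous_finsetSum _ fun k _ => ?_).const_mul _
  exact ((((h.continuous_coeff k).1.pow 2)).add
    ((((h.continuous_coeff k).1.add (h.continuous_coeff k).2).pow 2).const_mul R)).const_mul _

theorem energy_identity (hε : 0 < ε) (h : IsGalerkinCurve L R μ ε c₀ d₀ n p q) {T : ℝ} (hT : 0 ≤ T) :
    modeEnergy L R (n + 1) (p T) (q T) + ∫ t, seqD L R μ ε (p t) (q t) ∂(leb T)
      = modeEnergy L R (n + 1) c₀ d₀ := by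
  -- The frozen extension may have a corner at time `0`, so the derivative is used on the open
  -- interval only.
  have h1 := intervalIntegral.integral_eq_sub_of_hasDerivAt_of_le hT (h.continuous_energy (n + 1)).continuousOn
    (fun t ht => h.hasDerivAt_energy hε ht.1) (h.continuous_seqD.neg.intervalIntegrable _ _)
  rw [intervalIntegral.integral_neg] at h1
  have h2 : modeEnergy L R (n + 1) (p 0) (q 0) = modeEnergy L R (n + 1) c₀ d₀ := by
    unfold modeEnergy
    congr 1
    refine Finset.sum_congr rfl fun k hk => ?_
    have := h.init k (by rw [Finset.mem_range] at hk; omega)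
    rw [this.1, this.2]
  rw [← integral_Ioc_eq_integral_Ioo, ← intervalIntegral.integral_of_le hT, ← h2]
  linarith

theorem integral_seqD_nonneg (hμ : 0 < μ) (T : ℝ) : 0 ≤ ∫ t, seqD L R μ ε (p t) (q t) ∂(leb T) :=
  integral_nonneg fun _ => seqD_nonneg hμ ε _ _

theorem energy_le (hε : 0 < ε) (hμ : 0 < μ) {E₀ : ℝ} (hE : ∀ n, modeEnergy L R n c₀ d₀ ≤ E₀)
    (h : IsGalerkinCurve L R μ ε c₀ d₀ n p q) (t : ℝ) : modeEnergy L R (n + 1) (p t) (q t) ≤ E₀ := by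
  rw [(h.eq_max t).1, (h.eq_max t).2]
  have := h.energy_identity hε (le_max_right t 0)
  linarith [integral_seqD_nonneg (L := L) (R := R) (ε := ε) (p := p) (q := q) hμ (max t 0), hE (n + 1)]

theorem integral_seqD_le (hε : 0 < ε) (hR : 0 < R) {E₀ : ℝ} (hE : ∀ n, modeEnergy L R n c₀ d₀ ≤ E₀)
    (h : IsGalerkinCurve L R μ ε c₀ d₀ n p q) {T : ℝ} (hT : 0 ≤ T) :
    ∫ t, seqD L R μ ε (p t) (q t) ∂(leb T) ≤ E₀ := by
  have := h.energy_identity hε hT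
  have h2 : 0 ≤ modeEnergy L R (n + 1) (p T) (q T) :=
    mul_nonneg (by norm_num) (Finset.sum_nonneg fun k _ => by positivity)
  linarith [hE (n + 1)]

/-- Conservation of mass: the constant test function has zero derivative, so the flux term drops
out. -/
theorem coeff_zero (h : IsGalerkinCurve L R μ ε c₀ d₀ n p q) (t : ℝ) : p t 0 = c₀ 0 ∧ q t 0 = d₀ 0 := by
  have hz : dxL2 1 (cosH3 0 : Sob L 3) = 0 := by rw [dxL2_one_cosH3, wave_zero]; simp
  rw [← (h.init 0 n.zero_le).1, ← (h.init 0 n.zero_le).2, (h.eq_max t).1, (h.eq_max t).2]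
  have key {f : ℝ → ℝ} (hf : Continuous f) (hd : ∀ t > 0, HasDerivAt f 0 t) (T : ℝ) (hT : 0 ≤ T) : f T = f 0 := by
    have := intervalIntegral.integral_eq_sub_of_hasDerivAt_of_le (f' := fun _ => (0 : ℝ)) hT hf.continuousOn
      (fun t ht => hd t ht.1) (by simp)
    simp only [intervalIntegral.integral_zero] at this
    linarith
  exact ⟨key (h.continuous_coeff 0).1 (fun t ht => by
      have := h.hasDerivAt_fst n.zero_le ht
      rwa [hz, inner_zero_right] at this) _ (le_max_right _ _),
    key (h.continuous_coeff 0).2 (fun t ht => by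
      have := h.hasDerivAt_snd n.zero_le ht
      rwa [hz, inner_zero_right] at this) _ (le_max_right _ _)⟩

theorem tsum_wave_sq_le (hR : 0 < R) (hε : 0 < ε) (hμ : 0 < μ) {E₀ : ℝ}
    (hE : ∀ n, modeEnergy L R n c₀ d₀ ≤ E₀) (h : IsGalerkinCurve L R μ ε c₀ d₀ n p q) (t : ℝ) :
    ∑' k, wave L k ^ 2 * p t k ^ 2 ≤ 4 * E₀ * (1 + 1 / R) ∧
      ∑' k, wave L k ^ 2 * q t k ^ 2 ≤ 4 * E₀ * (1 + 1 / R) := by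
  have h1 := h.energy_le hε hμ hE t
  have e1 : ∑' k, wave L k ^ 2 * p t k ^ 2 = ∑ k ∈ Finset.range (n + 1), wave L k ^ 2 * p t k ^ 2 :=
    tsum_eq_sum fun k hk => by
      rw [(h.eq_zero t k (by rw [Finset.mem_range] at hk; omega)).1]; ring
  have e2 : ∑' k, wave L k ^ 2 * q t k ^ 2 = ∑ k ∈ Finset.range (n + 1), wave L k ^ 2 * q t k ^ 2 :=
    tsum_eq_sum fun k hk => by
      rw [(h.eq_zero t k (by rw [Finset.mem_range] at hk; omega)).2]; ring
  have e3 : modeEnergy L R (n + 1) (p t) (q t) =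
      1 / 2 * ∑ k ∈ Finset.range (n + 1), wave L k ^ 2 * p t k ^ 2
      + R / 2 * ∑ k ∈ Finset.range (n + 1), wave L k ^ 2 * (p t k + q t k) ^ 2 := by
    rw [modeEnergy, Finset.mul_sum, Finset.mul_sum, Finset.mul_sum, ← Finset.sum_add_distrib]
    exact Finset.sum_congr rfl fun k _ => by ring
  -- The energy contains `p` and `p + q`; the bound for `q` comes from `q = (p + q) - p`.
  have e4 : ∑ k ∈ Finset.range (n + 1), wave L k ^ 2 * q t k ^ 2 ≤
      2 * ∑ k ∈ Finset.range (n + 1), wave L k ^ 2 * p t k ^ 2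
      + 2 * ∑ k ∈ Finset.range (n + 1), wave L k ^ 2 * (p t k + q t k) ^ 2 := by
    rw [Finset.mul_sum, Finset.mul_sum, ← Finset.sum_add_distrib]
    refine Finset.sum_le_sum fun k _ => ?_
    have := mul_nonneg (sq_nonneg (wave L k)) (sq_nonneg (2 * p t k + q t k))
    linarith
  have n1 : 0 ≤ ∑ k ∈ Finset.range (n + 1), wave L k ^ 2 * p t k ^ 2 :=
    Finset.sum_nonneg fun k _ => by positivity
  have n2 : 0 ≤ ∑ k ∈ Finset.range (n + 1), wave L k ^ 2 * (p t k + q t k) ^ 2 :=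
    Finset.sum_nonneg fun k _ => by positivity
  rw [e1, e2]
  rw [e3] at h1
  generalize ∑ k ∈ Finset.range (n + 1), wave L k ^ 2 * p t k ^ 2 = a at *
  generalize ∑ k ∈ Finset.range (n + 1), wave L k ^ 2 * (p t k + q t k) ^ 2 = b at *
  have hRb : 0 ≤ R / 2 * b := by positivity
  have ha : a ≤ 2 * E₀ := by linarith
  have hb : b ≤ 2 * E₀ / R := by rw [le_div_iff₀ hR]; linarith
  have e5 : 4 * E₀ * (1 + 1 / R) = 4 * E₀ + 2 * (2 * E₀ / R) := by ring
  have : 0 ≤ 2 * E₀ / R := n2.trans hb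
  rw [e5]
  exact ⟨by linarith, by linarith⟩

end IsGalerkinCurve

/-- The embedding of `H^1` into the continuous functions: Young's inequality with `δ = 1` for `k ≥
1`, and the constant mode, which the mass controls, kept apart. -/
theorem tsum_abs_le {c : ℕ → ℝ} (hc : Summable fun k => wave L k ^ 2 * c k ^ 2) :
    ∑' k, |c k| ≤ |c 0| + (1 / 2 * ∑' k, (holderWt 0 k / wave L k) ^ 2
      + 1 / 2 * ∑' k, wave L k ^ 2 * c k ^ 2) := by
  have hs := summable_holderWt_div_sq (L := L) le_rfl (by norm_num : (0 : ℝ) < 1 / 2)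
  have ha := summable_abs hc
  rw [← ha.sum_add_tsum_nat_add 1, Finset.sum_range_one]
  have hs' := (summable_nat_add_iff 1).2 hs
  have hc' := (summable_nat_add_iff 1).2 hc
  have h1 : ∑' k, |c (k + 1)| ≤ ∑' k, (1 / 2 * (holderWt 0 (k + 1) / wave L (k + 1)) ^ 2
      + 1 / 2 * (wave L (k + 1) ^ 2 * c (k + 1) ^ 2)) := by
    refine ((summable_nat_add_iff 1).2 ha).tsum_le_tsum (fun k => ?_) ((hs'.mul_left _).add (hc'.mul_left _))
    have h := holderWt_mul_abs_le (L := L) (α := 0) (Nat.succ_ne_zero k) one_pos (c (k + 1))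
    rw [mul_one, ← one_div] at h
    exact (le_mul_of_one_le_left (abs_nonneg _) (one_le_holderWt 0 _)).trans h
  rw [(hs'.mul_left _).tsum_add (hc'.mul_left _), tsum_mul_left, tsum_mul_left] at h1
  have h2 := hs.sum_add_tsum_nat_add 1
  have h3 := hc.sum_add_tsum_nat_add 1
  have h4 : 0 ≤ ∑ i ∈ Finset.range 1, (holderWt 0 i / wave L i) ^ 2 :=
    Finset.sum_nonneg fun k _ => sq_nonneg _
  have h5 : 0 ≤ ∑ i ∈ Finset.range 1, wave L i ^ 2 * c i ^ 2 :=
    Finset.sum_nonneg fun k _ => by positivity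
  linarith

/-- By Young's inequality `|f'| ≤ 1/(2r) + (r/2) A D`, and `D = -E'`. Hence `±f` grows no faster
than `τ/(2r) - (A r/2) E(τ)`, whose increment on `[s, t]` is at most `(1 + A E₀)/2 · r` when `r =
√(t - s)`. Monotonicity replaces Cauchy–Schwarz for the integral of `f'`. -/
theorem abs_sub_le_of_deriv_le {f E D : ℝ → ℝ} (hf : Continuous f) (hE : Continuous E)
    {f' : ℝ → ℝ} (hfd : ∀ t > 0, HasDerivAt f (f' t) t) (hEd : ∀ t > 0, HasDerivAt E (-D t) t) {A : ℝ}
    (hA : ∀ t > 0, f' t ^ 2 ≤ A * D t) {E₀ : ℝ} (hEn : ∀ t, 0 ≤ E t) (hE₀ : ∀ t, E t ≤ E₀) (hA0 : 0 ≤ A)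
    {s t : ℝ} (hs : 0 ≤ s) (hst : s ≤ t) : |f t - f s| ≤ (1 + A * E₀) / 2 * √(t - s) := by
  rcases eq_or_lt_of_le hst with rfl | hlt
  · simp
  set r := √(t - s) with hr
  have hr0 : 0 < r := Real.sqrt_pos.2 (sub_pos.2 hlt)
  have hr2 : r ^ 2 = t - s := Real.sq_sqrt (sub_pos.2 hlt).le
  -- The sign `σ = ±1` treats upper and lower bounds together.
  have key (σ : ℝ) (hσ : σ ^ 2 = 1) : σ * (f t - f s) ≤ (1 + A * E₀) / 2 * r := by
    have hmono : MonotoneOn (fun τ => (τ / r - A * r * E τ) / 2 - σ * f τ) (Ici 0) := by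
      refine monotoneOn_of_deriv_nonneg (convex_Ici 0) (by fun_prop) ?_ ?_
      · intro τ hτ
        rw [interior_Ici] at hτ
        have := ((((hasDerivAt_id τ).div_const r).sub ((hEd τ hτ).const_mul (A * r))).div_const 2).sub
          ((hfd τ hτ).const_mul σ)
        exact this.differentiableAt.differentiableWithinAt
      · intro τ hτ
        rw [interior_Ici] at hτ
        have := ((((hasDerivAt_id τ).div_const r).sub ((hEd τ hτ).const_mul (A * r))).div_const 2).sub
          ((hfd τ hτ).const_mul σ)
        have e := this.deriv
        simp only [id, Pi.sub_def] at e
        rw [e]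
        have h1 : 0 ≤ r / 2 * (1 / r - σ * f' τ) ^ 2 := by positivity
        have h2 : r / 2 * (1 / r - σ * f' τ) ^ 2
            = 1 / r / 2 - σ * f' τ + r / 2 * (σ ^ 2 * f' τ ^ 2) := by field_simp; ring
        rw [h2, hσ, one_mul] at h1
        have h3 : r / 2 * f' τ ^ 2 ≤ r / 2 * (A * D τ) :=
          mul_le_mul_of_nonneg_left (hA τ hτ) (by positivity)
        have e2 : (1 / r - A * r * -D τ) / 2 - σ * f' τ = 1 / r / 2 - σ * f' τ + r / 2 * (A * D τ) := by ring
        rw [e2]; linarith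
    have := hmono (mem_Ici.2 hs) (mem_Ici.2 (hs.trans hst)) hst
    simp only at this
    have e : (t - s) / r = r := by rw [← hr2]; field_simp
    have h4 : A * r * (E s - E t) ≤ A * r * E₀ :=
      mul_le_mul_of_nonneg_left (by linarith [hEn t, hE₀ s]) (by positivity)
    have e3 : (t - s) / r = t / r - s / r := sub_div _ _ _
    have e4 : t / r - s / r = r := by rw [← e3, e]
    have : σ * (f t - f s) ≤ (r + A * r * E₀) / 2 := by linarith
    linarith
  rw [abs_le]
  constructor
  · linarith [key (-1) (by norm_num)]
  · linarith [key 1 (by norm_num)]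

/-- Bounds for the Galerkin approximations that do not depend on their order. -/
theorem exists_galerkin_bounds {R μ ε : ℝ} (hR : 0 < R) (hμ : 0 < μ) (hε : 0 < ε) {c₀ d₀ : ℕ → ℝ} {E₀ : ℝ}
    (hE : ∀ n, modeEnergy L R n c₀ d₀ ≤ E₀) : ∃ (C : ℝ) (A : ℕ → ℝ), ∀ n p q,
      IsGalerkinCurve L R μ ε c₀ d₀ n p q →
      (∀ t, ∑' k, |p t k| ≤ C ∧ ∑' k, |q t k| ≤ C) ∧
      (∀ T ≥ 0, ∫ t, ‖third L (p t)‖ ^ 2 ∂(leb T) ≤ C ∧ ∫ t, ‖third L (q t)‖ ^ 2 ∂(leb T) ≤ C) ∧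
      (∀ k s t, |p t k - p s k| ≤ A k * √|t - s| ∧ |q t k - q s k| ≤ A k * √|t - s|) := by
  set τ := ∑' k, (holderWt 0 k / wave L k) ^ 2 with hτ
  set C₁ := |c₀ 0| + |d₀ 0| + (1 / 2 * τ + 1 / 2 * (4 * E₀ * (1 + 1 / R))) with hC₁
  have sm {n : ℕ} {p q : ℝ → ℕ → ℝ} (h : IsGalerkinCurve L R μ ε c₀ d₀ n p q) (t : ℝ) :
      Summable (fun k => |p t k|) ∧ Summable fun k => |q t k| :=
    ⟨summable_abs (L := L) (summable_mul_of_eq_zero (fun k hk => (h.eq_zero t k hk).1) _),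
      summable_abs (L := L) (summable_mul_of_eq_zero (fun k hk => (h.eq_zero t k hk).2) _)⟩
  have hsup {n : ℕ} {p q : ℝ → ℕ → ℝ} (h : IsGalerkinCurve L R μ ε c₀ d₀ n p q) (t : ℝ) :
      ∑' k, |p t k| ≤ C₁ ∧ ∑' k, |q t k| ≤ C₁ := by
    have h1 := tsum_abs_le (L := L) (summable_mul_of_eq_zero (fun k hk => (h.eq_zero t k hk).1) fun k => wave L k ^ 2)
    have h2 := tsum_abs_le (L := L) (summable_mul_of_eq_zero (fun k hk => (h.eq_zero t k hk).2) fun k => wave L k ^ 2)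
    have h3 := h.tsum_wave_sq_le hR hε hμ hE t
    rw [(h.coeff_zero t).1] at h1
    rw [(h.coeff_zero t).2] at h2
    exact ⟨by linarith [h3.1, abs_nonneg (d₀ 0)], by linarith [h3.2, abs_nonneg (c₀ 0)]⟩
  -- The resulting bound on the supremum norms, uniform in the order and in time; the mobility
  -- constants below depend only on it.
  set B := √(2 / L) * C₁ with hB
  have hnorm {n : ℕ} {p q : ℝ → ℕ → ℝ} (h : IsGalerkinCurve L R μ ε c₀ d₀ n p q) (t : ℝ) :
      ‖sumC L (p t)‖ ≤ B ∧ ‖sumC L (q t)‖ ≤ B :=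
    ⟨(norm_sumC_le (sm h t).1).trans (mul_le_mul_of_nonneg_left (hsup h t).1 (Real.sqrt_nonneg _)),
      (norm_sumC_le (sm h t).2).trans (mul_le_mul_of_nonneg_left (hsup h t).2 (Real.sqrt_nonneg _))⟩
  obtain ⟨M, hM0, hM⟩ := exists_norm_sq_le_dissip (L := L) hR hμ hε B
  obtain ⟨N₁, hN₁0, hN₁⟩ := exists_norm_field_le (L := L)
    (mobCoef ε _ (contDiff_fluxF R 1 0).continuous) (mobCoef ε _ (contDiff_fluxF R 0 1).continuous) B
  obtain ⟨N₂, hN₂0, hN₂⟩ := exists_norm_field_le (L := L)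
    (mobCoef ε _ (contDiff_fluxG R μ 1 0).continuous) (mobCoef ε _ (contDiff_fluxG R μ 0 1).continuous) B
  have hE0 : 0 ≤ E₀ := by simpa [modeEnergy] using hE 0
  -- The constant in `|⟨H, ∂_x φ_k⟩|² ≤ a k · D`: Cauchy–Schwarz gives the first factor, the flux
  -- bound `(N₁ + N₂)²`, and `(‖z‖ + ‖w‖)² ≤ 4 M D` the last. It depends on the mode but not on `n`.
  set a : ℕ → ℝ := fun k => ‖dxL2 1 (cosH3 k : Sob L 3)‖ ^ 2 * ((N₁ + N₂) ^ 2 * (4 * M)) with ha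
  have ha0 (k : ℕ) : 0 ≤ a k := by positivity
  refine ⟨max C₁ (M * E₀), fun k => (1 + a k * E₀) / 2, fun n p q h =>
    ⟨fun t => ⟨(hsup h t).1.trans (le_max_left _ _), (hsup h t).2.trans (le_max_left _ _)⟩,
      fun T hT => ?_, fun k => ?_⟩⟩
  · have hint (z : ℝ → Lp ℝ 2 (leb L)) (hz : Continuous z)
        (hzD : ∀ t, ‖z t‖ ^ 2 ≤ M * seqD L R μ ε (p t) (q t)) :
        ∫ t, ‖z t‖ ^ 2 ∂(leb T) ≤ max C₁ (M * E₀) := by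
      have ci {φ : ℝ → ℝ} (hφ : Continuous φ) : Integrable φ (leb T) :=
        (hφ.integrableOn_Icc (a := 0) (b := T)).mono_set Ioo_subset_Icc_self
      calc _ ≤ ∫ t, M * seqD L R μ ε (p t) (q t) ∂(leb T) :=
            integral_mono (ci (hz.norm.pow 2)) (ci (h.continuous_seqD.const_mul M)) hzD
        _ ≤ M * E₀ := by
            rw [integral_const_mul]
            exact mul_le_mul_of_nonneg_left (h.integral_seqD_le hε hR hE hT) hM0
        _ ≤ _ := le_max_right _ _
    exact ⟨hint _ (continuous_third_of_eq_zero (fun t k hk => (h.eq_zero t k hk).1)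
        fun k => (h.continuous_coeff k).1) fun t => (hM _ _ _ _ (hnorm h t).1 (hnorm h t).2).1,
      hint _ (continuous_third_of_eq_zero (fun t k hk => (h.eq_zero t k hk).2)
        fun k => (h.continuous_coeff k).2) fun t => (hM _ _ _ _ (hnorm h t).1 (hnorm h t).2).2⟩
  · have hflux (H : Lp ℝ 2 (leb L)) (t : ℝ)
        (hH : ‖H‖ ≤ (N₁ + N₂) * (‖third L (p t)‖ + ‖third L (q t)‖)) :
        inner ℝ H (dxL2 1 (cosH3 k : Sob L 3)) ^ 2 ≤ a k * seqD L R μ ε (p t) (q t) := by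
      have hz := hM (sumC L (p t)) (sumC L (q t)) (third L (p t)) (third L (q t)) (hnorm h t).1 (hnorm h t).2
      have h1 : inner ℝ H (dxL2 1 (cosH3 k : Sob L 3)) ^ 2 ≤ (‖H‖ * ‖dxL2 1 (cosH3 k : Sob L 3)‖) ^ 2 := by
        rw [← sq_abs]
        exact pow_le_pow_left₀ (abs_nonneg _) (abs_real_inner_le_norm _ _) 2
      have h2 : ‖H‖ ^ 2 ≤ (N₁ + N₂) ^ 2 * (‖third L (p t)‖ + ‖third L (q t)‖) ^ 2 := by
        rw [← mul_pow]; exact pow_le_pow_left₀ (norm_nonneg _) hH 2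
      have h3 : (‖third L (p t)‖ + ‖third L (q t)‖) ^ 2 ≤ 4 * M * seqD L R μ ε (p t) (q t) := by
        have := sq_nonneg (‖third L (p t)‖ - ‖third L (q t)‖)
        unfold seqD
        linarith [hz.1, hz.2]
      calc _ ≤ ‖H‖ ^ 2 * ‖dxL2 1 (cosH3 k : Sob L 3)‖ ^ 2 := by rw [← mul_pow]; exact h1
        _ ≤ (N₁ + N₂) ^ 2 * (4 * M * seqD L R μ ε (p t) (q t)) * ‖dxL2 1 (cosH3 k : Sob L 3)‖ ^ 2 := by
            refine mul_le_mul_of_nonneg_right (h2.trans ?_) (sq_nonneg _)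
            exact mul_le_mul_of_nonneg_left h3 (sq_nonneg _)
        _ = _ := by rw [ha]; ring
    have hF (t : ℝ) := hflux (seqF L R ε (p t) (q t)) t ((hN₁ _ _ _ _ (hnorm h t).1 (hnorm h t).2).trans
      (mul_le_mul_of_nonneg_right (by linarith) (by positivity)))
    have hG (t : ℝ) := hflux (seqG L R μ ε (p t) (q t)) t ((hN₂ _ _ _ _ (hnorm h t).1 (hnorm h t).2).trans
      (mul_le_mul_of_nonneg_right (by linarith) (by positivity)))
    have hEn (t : ℝ) : 0 ≤ modeEnergy L R (n + 1) (p t) (q t) :=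
      mul_nonneg (by norm_num) (Finset.sum_nonneg fun k _ => by positivity)
    by_cases hk : k ≤ n
    · have main (s t : ℝ) (hst : s ≤ t) : |p t k - p s k| ≤ (1 + a k * E₀) / 2 * √(t - s) ∧
          |q t k - q s k| ≤ (1 + a k * E₀) / 2 * √(t - s) := by
        have hm : max s 0 ≤ max t 0 := max_le_max_right 0 hst
        have hle : √(max t 0 - max s 0) ≤ √(t - s) := by
          refine Real.sqrt_le_sqrt ?_
          have := abs_max_sub_max_le_abs t s 0
          rw [abs_of_nonneg (sub_nonneg.2 hm), abs_of_nonneg (sub_nonneg.2 hst)] at this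
          exact this
        have hnn : 0 ≤ (1 + a k * E₀) / 2 := by have := mul_nonneg (ha0 k) hE0; linarith
        rw [(h.eq_max t).1, (h.eq_max s).1, (h.eq_max t).2, (h.eq_max s).2]
        exact ⟨(abs_sub_le_of_deriv_le (h.continuous_coeff k).1 (h.continuous_energy (n + 1))
            (fun t ht => h.hasDerivAt_fst hk ht) (fun t ht => h.hasDerivAt_energy hε ht) (fun t _ => hF t)
            hEn (h.energy_le hε hμ hE) (ha0 k) (le_max_right _ _) hm).trans (mul_le_mul_of_nonneg_left hle hnn),
          (abs_sub_le_of_deriv_le (h.continuous_coeff k).2 (h.continuous_energy (n + 1))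
            (fun t ht => h.hasDerivAt_snd hk ht) (fun t ht => h.hasDerivAt_energy hε ht) (fun t _ => hG t)
            hEn (h.energy_le hε hμ hE) (ha0 k) (le_max_right _ _) hm).trans (mul_le_mul_of_nonneg_left hle hnn)⟩
      intro s t
      rcases le_total s t with hst | hst
      · rw [abs_of_nonneg (sub_nonneg.2 hst)]; exact main s t hst
      · rw [abs_sub_comm t s, abs_of_nonneg (sub_nonneg.2 hst), abs_sub_comm (p t k), abs_sub_comm (q t k)]
        exact main t s hst
    · intro s t
      have := mul_nonneg (ha0 k) hE0
      rw [(h.eq_zero t k (not_le.1 hk)).1, (h.eq_zero s k (not_le.1 hk)).1,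
        (h.eq_zero t k (not_le.1 hk)).2, (h.eq_zero s k (not_le.1 hk)).2, sub_zero, abs_zero]
      constructor <;> positivity

end

end ThinFilm

/-! ### Integrability in time and limits of coefficient sequences -/

namespace ThinFilm

noncomputable section

theorem ae_Ioi_of_forall_leb {P : ℝ → Prop} (h : ∀ T > 0, ∀ᵐ t ∂(leb T), P t) :
    ∀ᵐ t ∂(volume.restrict (Ioi (0 : ℝ))), P t := by
  have e : Ioi (0 : ℝ) = ⋃ n : ℕ, Ioo 0 ((n : ℝ) + 1) := by
    ext t
    simp only [mem_Ioi, mem_iUnion, mem_Ioo]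
    refine ⟨fun ht => ?_, fun ⟨_, h1, _⟩ => h1⟩
    obtain ⟨n, hn⟩ := exists_nat_gt t
    exact ⟨n, ht, by linarith⟩
  rw [e, ae_restrict_iUnion_iff]
  exact fun n => h _ (by positivity)

theorem integrable_leb_of_continuous {E : Type*} [NormedAddCommGroup E] {φ : ℝ → E} (hφ : Continuous φ)
    (T : ℝ) : Integrable φ (leb T) :=
  (hφ.integrableOn_Icc (a := 0) (b := T)).mono_set Ioo_subset_Icc_self

theorem memLp_leb_of_continuous {E : Type*} [NormedAddCommGroup E] {φ : ℝ → E} (hφ : Continuous φ)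
    (T : ℝ) (r : ℝ≥0∞) : MemLp φ r (leb T) := by
  obtain ⟨M, hM⟩ := (isCompact_Icc (a := (0 : ℝ)) (b := T)).exists_bound_of_continuousOn hφ.continuousOn
  refine MemLp.of_bound hφ.aestronglyMeasurable M ?_
  filter_upwards [ae_mem_Ioo T] with t ht
  exact hM t (Ioo_subset_Icc_self ht)

theorem summable_wave_sq_sub {L : ℝ} {c d : ℕ → ℝ} {C D : ℝ} (hc : Summable fun k => wave L k ^ 2 * c k ^ 2)
    (hd : Summable fun k => wave L k ^ 2 * d k ^ 2) (hC : ∑' k, wave L k ^ 2 * c k ^ 2 ≤ C)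
    (hD : ∑' k, wave L k ^ 2 * d k ^ 2 ≤ D) :
    Summable (fun k => wave L k ^ 2 * (c k - d k) ^ 2) ∧
      ∑' k, wave L k ^ 2 * (c k - d k) ^ 2 ≤ 2 * C + 2 * D := by
  have hs := (hc.mul_left 2).add (hd.mul_left 2)
  have hle (k : ℕ) : wave L k ^ 2 * (c k - d k) ^ 2 ≤
      2 * (wave L k ^ 2 * c k ^ 2) + 2 * (wave L k ^ 2 * d k ^ 2) := by
    have := mul_nonneg (sq_nonneg (wave L k)) (sq_nonneg (c k + d k))
    linarith
  have h1 : Summable (fun k => wave L k ^ 2 * (c k - d k) ^ 2) :=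
    hs.of_nonneg_of_le (fun k => by positivity) hle
  refine ⟨h1, (h1.tsum_le_tsum hle hs).trans ?_⟩
  rw [(hc.mul_left 2).tsum_add (hd.mul_left 2), tsum_mul_left, tsum_mul_left]
  linarith

variable {L : ℝ} [hL : Fact (0 < L)]

/-! ### Limits of cosine coefficients -/

/-- The finitely supported coefficients `P n t` converge to `p t`, with the bounds that are satisfied by
the Galerkin approximations. -/
structure IsCoeffLimit (L : ℝ) [Fact (0 < L)] (C : ℝ) (P : ℕ → ℝ → ℕ → ℝ) (p : ℝ → ℕ → ℝ) : Prop where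
  eq_zero : ∀ n, ∃ m, ∀ t k, m < k → P n t k = 0
  continuous : ∀ n k, Continuous fun t => P n t k
  tsum_wave_sq : ∀ n t, ∑' k, wave L k ^ 2 * P n t k ^ 2 ≤ C
  tsum_abs : ∀ n t, ∑' k, |P n t k| ≤ C
  integral_third : ∀ n, ∀ T ≥ 0, ∫ t, ‖third L (P n t)‖ ^ 2 ∂(leb T) ≤ C
  continuous_limit : ∀ k, Continuous fun t => p t k
  tendsto : ∀ k, TendstoLocallyUniformly (fun n t => P n t k) (fun t => p t k) atTop

namespace IsCoeffLimit

variable {C : ℝ} {P : ℕ → ℝ → ℕ → ℝ} {p : ℝ → ℕ → ℝ}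

theorem tendsto_apply (h : IsCoeffLimit L C P p) (t : ℝ) (k : ℕ) :
    Tendsto (fun n => P n t k) atTop (𝓝 (p t k)) := TendstoLocallyUniformlyOn.tendsto_at
    (tendstoLocallyUniformlyOn_univ.2 (h.tendsto k)) (mem_univ t)

theorem summable_approx (h : IsCoeffLimit L C P p) (n : ℕ) (t : ℝ) (a : ℕ → ℝ) :
    Summable fun k => a k * P n t k ^ 2 := by
  obtain ⟨m, hm⟩ := h.eq_zero n
  exact summable_mul_of_eq_zero (hm t) a

theorem summable_abs_approx (h : IsCoeffLimit L C P p) (n : ℕ) (t : ℝ) : Summable fun k => |P n t k| :=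
  ThinFilm.summable_abs (L := L) (h.summable_approx n t _)

theorem abs_approx_le (h : IsCoeffLimit L C P p) (n : ℕ) (t : ℝ) (k : ℕ) : |P n t k| ≤ C :=
  ((h.summable_abs_approx n t).le_tsum k fun _ _ => abs_nonneg _).trans (h.tsum_abs n t)

theorem sum_wave_sq_le (h : IsCoeffLimit L C P p) (t : ℝ) (m : ℕ) :
    ∑ k ∈ Finset.range m, wave L k ^ 2 * p t k ^ 2 ≤ C := by
  refine le_of_tendsto (tendsto_finsetSum _ fun k _ => ((h.tendsto_apply t k).pow 2).const_mul _)
    (Eventually.of_forall fun n => ?_)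
  exact ((h.summable_approx n t _).sum_le_tsum _ fun k _ => by positivity).trans (h.tsum_wave_sq n t)

theorem summable_wave_sq (h : IsCoeffLimit L C P p) (t : ℝ) :
    Summable fun k => wave L k ^ 2 * p t k ^ 2 :=
  summable_of_sum_range_le (fun k => by positivity) (h.sum_wave_sq_le t)

theorem tsum_wave_sq_limit_le (h : IsCoeffLimit L C P p) (t : ℝ) :
    ∑' k, wave L k ^ 2 * p t k ^ 2 ≤ C :=
  Real.tsum_le_of_sum_range_le (fun k => by positivity) (h.sum_wave_sq_le t)

theorem summable_abs (h : IsCoeffLimit L C P p) (t : ℝ) : Summable fun k => |p t k| :=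
  ThinFilm.summable_abs (h.summable_wave_sq t)

theorem tsum_abs_limit_le (h : IsCoeffLimit L C P p) (t : ℝ) : ∑' k, |p t k| ≤ C := by
  refine Real.tsum_le_of_sum_range_le (fun k => abs_nonneg _) fun m => ?_
  refine le_of_tendsto (tendsto_finsetSum _ fun k _ => (h.tendsto_apply t k).abs)
    (Eventually.of_forall fun n => ?_)
  exact ((h.summable_abs_approx n t).sum_le_tsum _ fun k _ => abs_nonneg _).trans (h.tsum_abs n t)

theorem nonneg (h : IsCoeffLimit L C P p) : 0 ≤ C :=
  (tsum_nonneg fun _ => abs_nonneg _).trans (h.tsum_abs 0 0)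

/-- The filter `atTop ×ˢ 𝓟 K` encodes uniformity in `t ∈ K`, so the general compactness statement
covers this case directly. -/
theorem tendsto_holderWt (h : IsCoeffLimit L C P p) {α : ℝ} (h0 : 0 ≤ α) (h1 : α < 1 / 2) {K : Set ℝ}
    (hK : IsCompact K) :
    Tendsto (fun i : ℕ × ℝ => ∑' k, holderWt α k * |P i.1 i.2 k - p i.2 k|) (atTop ×ˢ 𝓟 K) (𝓝 0) := by
  refine tendsto_tsum_holderWt (L := L) h0 h1 (C := 2 * C + 2 * C)
    (fun i => (summable_wave_sq_sub (h.summable_approx i.1 i.2 _) (h.summable_wave_sq i.2)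
      (h.tsum_wave_sq i.1 i.2) (h.tsum_wave_sq_limit_le i.2)).1)
    (fun i => (summable_wave_sq_sub (h.summable_approx i.1 i.2 _) (h.summable_wave_sq i.2)
      (h.tsum_wave_sq i.1 i.2) (h.tsum_wave_sq_limit_le i.2)).2) fun k => ?_
  have hu := (tendstoLocallyUniformly_iff_forall_isCompact.1 (h.tendsto k)) K hK
  rw [tendsto_zero_iff_abs_tendsto_zero, Metric.tendsto_nhds]
  intro e he
  rw [Metric.tendstoUniformlyOn_iff] at hu
  rw [eventually_prod_principal_iff]
  filter_upwards [hu e he] with n hn t ht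
  have := hn t ht
  rw [dist_comm, Real.dist_eq] at this
  simpa using this

theorem tendsto_holderWt_time (h : IsCoeffLimit L C P p) {α : ℝ} (h0 : 0 ≤ α) (h1 : α < 1 / 2) (t : ℝ) :
    Tendsto (fun s => ∑' k, holderWt α k * |p s k - p t k|) (𝓝 t) (𝓝 0) := by
  refine tendsto_tsum_holderWt (L := L) h0 h1 (C := 2 * C + 2 * C)
    (fun s => (summable_wave_sq_sub (h.summable_wave_sq s) (h.summable_wave_sq t)
      (h.tsum_wave_sq_limit_le s) (h.tsum_wave_sq_limit_le t)).1)
    (fun s => (summable_wave_sq_sub (h.summable_wave_sq s) (h.summable_wave_sq t)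
      (h.tsum_wave_sq_limit_le s) (h.tsum_wave_sq_limit_le t)).2) fun k => ?_
  have := ((h.continuous_limit k).tendsto t).sub_const (p t k)
  rwa [sub_self] at this

theorem norm_sumC_sub_le {c d : ℕ → ℝ} (hc : Summable fun k => |c k|) (hd : Summable fun k => |d k|)
    (hw : Summable fun k => wave L k ^ 2 * (c k - d k) ^ 2) :
    ‖sumC L c - sumC L d‖ ≤ √(2 / L) * ∑' k, holderWt 0 k * |c k - d k| := by
  rw [← sumC_sub hc hd]
  have hs := ThinFilm.summable_abs (L := L) (c := fun k => c k - d k) hw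
  refine (norm_sumC_le hs).trans (mul_le_mul_of_nonneg_left ?_ (Real.sqrt_nonneg _))
  exact hs.tsum_le_tsum (fun k => le_mul_of_one_le_left (abs_nonneg _) (one_le_holderWt 0 k))
    (summable_holderWt_mul (L := L) le_rfl (by norm_num) hw)

theorem continuous_sumC_approx (h : IsCoeffLimit L C P p) (n : ℕ) : Continuous fun t => sumC L (P n t) := by
  obtain ⟨m, hm⟩ := h.eq_zero n
  exact continuous_sumC_of_eq_zero hm (h.continuous n)

theorem continuous_third_approx (h : IsCoeffLimit L C P p) (n : ℕ) :
    Continuous fun t => third L (P n t) := by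
  obtain ⟨m, hm⟩ := h.eq_zero n
  exact continuous_third_of_eq_zero hm (h.continuous n)

theorem continuous_sumC (h : IsCoeffLimit L C P p) : Continuous fun t => sumC L (p t) := by
  refine continuous_iff_continuousAt.2 fun t => ?_
  have h1 := (h.tendsto_holderWt_time le_rfl (by norm_num) t).const_mul (√(2 / L))
  rw [mul_zero] at h1
  refine tendsto_iff_norm_sub_tendsto_zero.2 (squeeze_zero (fun s => norm_nonneg _) (fun s => ?_) h1)
  exact norm_sumC_sub_le (h.summable_abs s) (h.summable_abs t)
    (summable_wave_sq_sub (h.summable_wave_sq s) (h.summable_wave_sq t) le_rfl le_rfl).1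

/-- The approximations as continuous curves in `C([0, L])`. -/
def approxCurve (h : IsCoeffLimit L C P p) (n : ℕ) : C(ℝ, C(Icc 0 L, ℝ)) :=
  ⟨fun t => sumC L (P n t), h.continuous_sumC_approx n⟩

/-- The limit as a continuous curve in `C([0, L])`. -/
def limitCurve (h : IsCoeffLimit L C P p) : C(ℝ, C(Icc 0 L, ℝ)) := ⟨fun t => sumC L (p t), h.continuous_sumC⟩

theorem tendsto_approxCurve (h : IsCoeffLimit L C P p) :
    Tendsto h.approxCurve atTop (𝓝 h.limitCurve) := by
  rw [ContinuousMap.tendsto_iff_forall_isCompact_tendstoUniformlyOn]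
  intro K hK
  have h1 := (h.tendsto_holderWt le_rfl (by norm_num) hK).const_mul (√(2 / L))
  rw [mul_zero] at h1
  rw [Metric.tendstoUniformlyOn_iff]
  intro e he
  have h2 := h1.eventually_lt_const he
  rw [eventually_prod_principal_iff] at h2
  filter_upwards [h2] with n hn t ht
  rw [dist_comm, dist_eq_norm]
  exact (norm_sumC_sub_le (h.summable_abs_approx n t) (h.summable_abs t)
    (summable_wave_sq_sub (h.summable_approx n t _) (h.summable_wave_sq t) le_rfl le_rfl).1).trans_lt (hn t ht)

theorem sum_wave_six_approx_le (h : IsCoeffLimit L C P p) (n m : ℕ) (t : ℝ) :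
    ∑ k ∈ Finset.range m, wave L k ^ 6 * P n t k ^ 2 ≤ ‖third L (P n t)‖ ^ 2 :=
  sum_le_hasSum _ (fun k _ => by positivity) (hasSum_norm_sq_dxL2_three (h.summable_approx n t _))

theorem tendsto_integral_mul_coeff (h : IsCoeffLimit L C P p) (k : ℕ) {T : ℝ} {w : ℝ → ℝ}
    (hw : Integrable w (leb T)) :
    Tendsto (fun n => ∫ t, P n t k * w t ∂(leb T)) atTop (𝓝 (∫ t, p t k * w t ∂(leb T))) := by
  refine tendsto_integral_of_dominated_convergence (fun t => C * ‖w t‖)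
    (fun n => (h.continuous n k).aestronglyMeasurable.mul hw.1) (hw.norm.const_mul C)
    (fun n => Eventually.of_forall fun t => ?_)
    (Eventually.of_forall fun t => (h.tendsto_apply t k).mul_const _)
  rw [norm_mul]
  exact mul_le_mul_of_nonneg_right (h.abs_approx_le n t k) (norm_nonneg _)

/-- With only `m` modes, the bounded coefficients allow dominated convergence; the uniform bound on
the third derivatives of the approximations passes to the limit. -/
theorem integral_sum_wave_six_le (h : IsCoeffLimit L C P p) (m : ℕ) {T : ℝ} (hT : 0 ≤ T) :
    ∫ t, ∑ k ∈ Finset.range m, wave L k ^ 6 * p t k ^ 2 ∂(leb T) ≤ C := by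
  have hb (n : ℕ) (t : ℝ) : ‖∑ k ∈ Finset.range m, wave L k ^ 6 * P n t k ^ 2‖ ≤
      ∑ k ∈ Finset.range m, wave L k ^ 6 * C ^ 2 := by
    rw [Real.norm_of_nonneg (Finset.sum_nonneg fun k _ => by positivity)]
    refine Finset.sum_le_sum fun k _ => mul_le_mul_of_nonneg_left ?_ (by positivity)
    rw [← sq_abs (P n t k)]
    exact pow_le_pow_left₀ (abs_nonneg _) (h.abs_approx_le n t k) 2
  have hc (n : ℕ) : Continuous fun t => ∑ k ∈ Finset.range m, wave L k ^ 6 * P n t k ^ 2 :=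
    continuous_finsetSum _ fun k _ => ((h.continuous n k).pow 2).const_mul _
  have hl := tendsto_integral_of_dominated_convergence (μ := leb T)
    (f := fun t => ∑ k ∈ Finset.range m, wave L k ^ 6 * p t k ^ 2)
    (fun _ => ∑ k ∈ Finset.range m, wave L k ^ 6 * C ^ 2)
    (fun n => (hc n).aestronglyMeasurable) (integrable_const _)
    (fun n => Eventually.of_forall (hb n)) (Eventually.of_forall fun t =>
      tendsto_finsetSum _ fun k _ => ((h.tendsto_apply t k).pow 2).const_mul _)
  refine le_of_tendsto hl (Eventually.of_forall fun n => ?_)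
  refine le_trans ?_ (h.integral_third n T hT)
  exact integral_mono (integrable_leb_of_continuous (hc n) T)
    (integrable_leb_of_continuous ((h.continuous_third_approx n).norm.pow 2) T)
    fun t => h.sum_wave_six_approx_le n m t

/-- Values in `[0, ∞]` are used because summability in `k` is not yet known; finiteness of this
integral is what yields it for almost every time. -/
theorem lintegral_wave_six_le (h : IsCoeffLimit L C P p) {T : ℝ} (hT : 0 ≤ T) :
    ∫⁻ t, ∑' k, ENNReal.ofReal (wave L k ^ 6 * p t k ^ 2) ∂(leb T) ≤ ENNReal.ofReal C := by
  have hm (k : ℕ) : Continuous fun t => wave L k ^ 6 * p t k ^ 2 :=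
    ((h.continuous_limit k).pow 2).const_mul _
  rw [lintegral_tsum fun k => (hm k).measurable.ennreal_ofReal.aemeasurable]
  refine ENNReal.tsum_le_of_sum_range_le fun m => ?_
  rw [← lintegral_finsetSum _ fun k _ => (hm k).measurable.ennreal_ofReal]
  simp only [← ENNReal.ofReal_sum_of_nonneg fun k _ =>
    (mul_nonneg (pow_nonneg (wave_nonneg k) 6) (sq_nonneg _) : (0 : ℝ) ≤ wave L k ^ 6 * p _ k ^ 2)]
  rw [← ofReal_integral_eq_lintegral_ofReal
    (integrable_leb_of_continuous (continuous_finsetSum _ fun k _ => hm k) T)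
    (Eventually.of_forall fun t => Finset.sum_nonneg fun k _ => by positivity)]
  exact ENNReal.ofReal_le_ofReal (h.integral_sum_wave_six_le m hT)

theorem ae_summable_wave_six (h : IsCoeffLimit L C P p) :
    ∀ᵐ t ∂(volume.restrict (Ioi (0 : ℝ))), Summable fun k => wave L k ^ 6 * p t k ^ 2 := by
  refine ae_Ioi_of_forall_leb fun T hT => ?_
  have hm : Measurable fun t => ∑' k, ENNReal.ofReal (wave L k ^ 6 * p t k ^ 2) :=
    Measurable.tsum fun k => (((h.continuous_limit k).pow 2).const_mul _).measurable.ennreal_ofReal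
  filter_upwards [ae_lt_top hm ((h.lintegral_wave_six_le hT.le).trans_lt ENNReal.ofReal_lt_top).ne] with t ht
  have := ENNReal.summable_toReal ht.ne
  refine this.congr fun k => ?_
  exact ENNReal.toReal_ofReal (mul_nonneg (pow_nonneg (wave_nonneg k) 6) (sq_nonneg _))

theorem ae_leb_summable_wave_six (h : IsCoeffLimit L C P p) (T : ℝ) :
    ∀ᵐ t ∂(leb T), Summable fun k => wave L k ^ 6 * p t k ^ 2 :=
  ae_restrict_of_ae_restrict_of_subset Ioo_subset_Ioi_self h.ae_summable_wave_six

theorem aestronglyMeasurable_sumH3 (h : IsCoeffLimit L C P p) (T : ℝ) :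
    AEStronglyMeasurable (fun t => sumH3 L (p t)) (leb T) := by
  refine aestronglyMeasurable_of_tendsto_ae atTop
    (f := fun m t => ∑ k ∈ Finset.range m, p t k • (cosH3 k : Sob L 3)) (fun m => ?_) ?_
  · have : SecondCountableTopologyEither ℝ (Sob L 3) := ⟨Or.inl inferInstance⟩
    exact (continuous_finsetSum _ fun k _ =>
      (h.continuous_limit k).smul continuous_const).aestronglyMeasurable
  · filter_upwards [h.ae_leb_summable_wave_six T] with t ht
    exact (hasSum_sumH3 ht).tendsto_sum_nat

theorem memLp_third (h : IsCoeffLimit L C P p) {T : ℝ} (hT : 0 < T) :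
    MemLp (fun t => third L (p t)) 2 (leb T) := by
  have hm : AEStronglyMeasurable (fun t => third L (p t)) (leb T) :=
    (dxL2 3).continuous.comp_aestronglyMeasurable (h.aestronglyMeasurable_sumH3 T)
  rw [memLp_two_iff_integrable_sq_norm hm]
  refine ⟨(hm.norm.pow 2), ?_⟩
  rw [hasFiniteIntegral_iff_ofReal (Eventually.of_forall fun t => sq_nonneg _)]
  refine (lintegral_mono_ae ?_).trans_lt ((h.lintegral_wave_six_le hT.le).trans_lt ENNReal.ofReal_lt_top)
  filter_upwards [h.ae_leb_summable_wave_six T] with t ht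
  rw [← ENNReal.ofReal_tsum_of_nonneg (fun k => by positivity) ht, third,
    (hasSum_norm_sq_dxL2_three ht).tsum_eq]

/-- The powers of `(wave L 1)⁻¹` are the Poincaré constants that bound the function and its first
two derivatives, apart from the mean, by the third derivative. -/
theorem sq_norm_sumH3_le {c : ℕ → ℝ} (hc : Summable fun k => wave L k ^ 6 * c k ^ 2) :
    ‖sumH3 L c‖ ^ 2 ≤ c 0 ^ 2 + ((wave L 1)⁻¹ ^ 6 + (wave L 1)⁻¹ ^ 4 + (wave L 1)⁻¹ ^ 2 + 1) * ‖third L c‖ ^ 2 := by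
  have h1 : HasSum (fun k => ‖c k • (cosH3 k : Sob L 3)‖ ^ 2) (‖sumH3 L c‖ ^ 2) := by
    refine hasSum_norm_sq_of_orthogonal (hasSum_sumH3 hc) fun j k hjk => ?_
    rw [inner_Sob]
    refine Finset.sum_eq_zero fun i _ => ?_
    rw [map_smul, map_smul, inner_smul_left, inner_smul_right, inner_cosH3 j k hjk i]
    simp
  have h2 := hasSum_norm_sq_dxL2_three hc
  rw [← third] at h2
  set A := (wave L 1)⁻¹ ^ 6 + (wave L 1)⁻¹ ^ 4 + (wave L 1)⁻¹ ^ 2 + 1 with hA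
  have hA0 : 0 ≤ A := by positivity
  have h3 := (hasSum_ite_eq 0 (c 0 ^ 2)).add (h2.mul_left A)
  refine hasSum_le (fun k => ?_) h1 h3
  rw [norm_smul, mul_pow, norm_sq_cosH3, Real.norm_eq_abs, sq_abs]
  by_cases hk : k = 0
  · subst hk; simp [wave_zero]
  rw [if_neg hk, zero_add, mul_comm, ← mul_assoc]
  refine mul_le_mul_of_nonneg_right ?_ (sq_nonneg _)
  have e6 := one_le_mul_wave_pow (L := L) hk 6
  have e4 : wave L k ^ 2 ≤ (wave L 1)⁻¹ ^ 4 * wave L k ^ 6 := by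
    have := mul_le_mul_of_nonneg_right (one_le_mul_wave_pow (L := L) hk 4) (sq_nonneg (wave L k))
    calc _ = 1 * wave L k ^ 2 := (one_mul _).symm
      _ ≤ _ := this
      _ = _ := by ring
  have e2 : wave L k ^ 4 ≤ (wave L 1)⁻¹ ^ 2 * wave L k ^ 6 := by
    have := mul_le_mul_of_nonneg_right (one_le_mul_wave_pow (L := L) hk 2) (pow_nonneg (wave_nonneg (L := L) k) 4)
    calc _ = 1 * wave L k ^ 4 := (one_mul _).symm
      _ ≤ _ := this
      _ = _ := by ring
  rw [hA]; linarith

theorem memLp_sumH3 (h : IsCoeffLimit L C P p) {T : ℝ} (hT : 0 < T) :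
    MemLp (fun t => sumH3 L (p t)) 2 (leb T) := by
  have hm := h.aestronglyMeasurable_sumH3 T
  have h3 := h.memLp_third hT
  rw [memLp_two_iff_integrable_sq_norm hm]
  have h1 := integrable_leb_of_continuous ((h.continuous_limit 0).pow 2) T
  refine (h1.add (((memLp_two_iff_integrable_sq_norm h3.1).1 h3).const_mul
    ((wave L 1)⁻¹ ^ 6 + (wave L 1)⁻¹ ^ 4 + (wave L 1)⁻¹ ^ 2 + 1))).mono' (hm.norm.pow 2) ?_
  filter_upwards [h.ae_leb_summable_wave_six T] with t ht
  rw [Real.norm_of_nonneg (sq_nonneg _)]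
  exact sq_norm_sumH3_le ht

theorem memLp_top_toH1 (h : IsCoeffLimit L C P p) (T : ℝ) :
    MemLp (fun t => toH1 (sumH3 L (p t))) ∞ (leb T) := by
  refine MemLp.of_bound (continuous_toH1.comp_aestronglyMeasurable (h.aestronglyMeasurable_sumH3 T))
    (√(C * C + C)) ?_
  filter_upwards [h.ae_leb_summable_wave_six T] with t ht
  refine Real.le_sqrt_of_sq_le ?_
  rw [norm_sq_Sob, Fin.sum_univ_two, dxL2_zero_toH1, dxL2_one_toH1, ← (hasSum_norm_sq_dxL2_one ht).tsum_eq,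
    ← (hasSum_norm_sq_dxL2_zero ht).tsum_eq]
  refine add_le_add ?_ (h.tsum_wave_sq_limit_le t)
  have hs := h.summable_abs t
  have hC := h.nonneg
  have hle (k : ℕ) : |p t k| ≤ C := (hs.le_tsum k fun _ _ => abs_nonneg _).trans (h.tsum_abs_limit_le t)
  -- The `L₂` norm is estimated by supremum times sum of the coefficients, both at most `C`.
  calc ∑' k, p t k ^ 2 ≤ ∑' k, C * |p t k| := by
        refine (hasSum_norm_sq_dxL2_zero ht).summable.tsum_le_tsum (fun k => ?_) (hs.mul_left C)
        rw [← sq_abs, sq]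
        exact mul_le_mul_of_nonneg_right (hle k) (abs_nonneg _)
    _ ≤ C * C := by
        rw [tsum_mul_left]
        exact mul_le_mul_of_nonneg_left (h.tsum_abs_limit_le t) hC

theorem represents (h : IsCoeffLimit L C P p) :
    ∀ᵐ t ∂(volume.restrict (Ioi (0 : ℝ))), cosSum L (p t) =ᵐ[leb L] dx 0 (sumH3 L (p t)) := by
  filter_upwards [h.ae_summable_wave_six] with t ht
  rw [dx, dxL2_zero_sumH3 ht]
  exact (ofC_sumC_coeFn (h.summable_abs t)).symm

theorem contHolder (h : IsCoeffLimit L C P p) (T : ℝ) {α : ℝ≥0} (hα : α < 1 / 2) :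
    ContHolder L T α fun t => cosSum L (p t) := by
  have hα' : (α : ℝ) < 1 / 2 := by exact_mod_cast hα
  refine ⟨fun t _ => ⟨(continuous_cosSum (h.summable_abs t)).continuousOn, ?_⟩, fun t _ => ?_⟩
  · exact (holderWith_cosSum (by linarith) (summable_holderWt_mul α.2 hα' (h.summable_wave_sq t))).memHolder
  · have h1 := (h.tendsto_holderWt_time α.2 hα' t).const_mul (√(2 / L) * (1 + 2 * (Real.pi / L) ^ (α : ℝ)))
    rw [mul_zero] at h1
    have h2 := ENNReal.tendsto_ofReal h1
    rw [ENNReal.ofReal_zero] at h2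
    refine (tendsto_of_tendsto_of_tendsto_of_le_of_le tendsto_const_nhds h2 (fun s => zero_le)
      fun s => ?_).mono_left nhdsWithin_le_nhds
    have hw := (summable_wave_sq_sub (h.summable_wave_sq s) (h.summable_wave_sq t) le_rfl le_rfl).1
    have := holderENorm_cosSum_le (L := L) (α := α) (by linarith) (c := fun k => p s k - p t k)
      (summable_holderWt_mul (L := L) α.2 hα' hw)
    rwa [cosSum_sub (h.summable_abs s) (h.summable_abs t)] at this

theorem tendsto_iSup_holderENorm (h : IsCoeffLimit L C P p) (T : ℝ) {α : ℝ≥0} (hα : α < 1 / 2) :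
    Tendsto (fun n => ⨆ t ∈ Icc 0 T, holderENorm L α (cosSum L (P n t) - cosSum L (p t))) atTop (𝓝 0) := by
  have hα' : (α : ℝ) < 1 / 2 := by exact_mod_cast hα
  have h1 := (h.tendsto_holderWt α.2 hα' (isCompact_Icc (a := 0) (b := T))).const_mul
    (√(2 / L) * (1 + 2 * (Real.pi / L) ^ (α : ℝ)))
  rw [mul_zero] at h1
  have h2 := ENNReal.tendsto_ofReal h1
  rw [ENNReal.ofReal_zero, ENNReal.tendsto_nhds_zero] at h2
  rw [ENNReal.tendsto_nhds_zero]
  intro e he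
  have h3 := h2 e he
  rw [eventually_prod_principal_iff] at h3
  filter_upwards [h3] with n hn
  refine iSup₂_le fun t ht => le_trans ?_ (hn t ht)
  have hw := (summable_wave_sq_sub (h.summable_approx n t _) (h.summable_wave_sq t) le_rfl le_rfl).1
  have := holderENorm_cosSum_le (L := L) (α := α) (by linarith) (c := fun k => P n t k - p t k)
    (summable_holderWt_mul (L := L) α.2 hα' hw)
  rwa [cosSum_sub (h.summable_abs_approx n t) (h.summable_abs t)] at this

end IsCoeffLimit

end

end ThinFilm

namespace ThinFilm

noncomputable section

/-! ### Weak convergence -/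

theorem tendsto_of_forall_approx {a : ℕ → ℝ} {A : ℝ} (h : ∀ e > 0, ∃ (b : ℕ → ℝ) (B : ℝ),
    Tendsto b atTop (𝓝 B) ∧ (∀ n, |a n - b n| ≤ e) ∧ |A - B| ≤ e) : Tendsto a atTop (𝓝 A) := by
  rw [Metric.tendsto_nhds]
  intro e he
  obtain ⟨b, B, hb, h1, h2⟩ := h (e / 4) (by positivity)
  filter_upwards [(Metric.tendsto_nhds.1 hb) (e / 4) (by positivity)] with n hn
  rw [Real.dist_eq] at hn ⊢
  have h3 := h1 n
  rw [abs_le] at h2 h3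
  rw [abs_lt] at hn ⊢
  constructor <;> linarith [h2.1, h2.2, h3.1, h3.2, hn.1, hn.2]

section Hilbert

theorem integrable_norm_sq {E : Type*} [NormedAddCommGroup E] {μ : Measure ℝ} {z : ℝ → E} (hz : MemLp z 2 μ) :
    Integrable (fun t => ‖z t‖ ^ 2) μ := (memLp_two_iff_integrable_sq_norm hz.1).1 hz

variable {E : Type*} [NormedAddCommGroup E] [InnerProductSpace ℝ E]

theorem abs_inner_le_young {δ : ℝ} (hδ : 0 < δ) (x y : E) :
    |inner ℝ x y| ≤ δ / 2 * ‖x‖ ^ 2 + (2 * δ)⁻¹ * ‖y‖ ^ 2 := by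
  refine (abs_real_inner_le_norm x y).trans ?_
  have h1 : 0 ≤ (2 * δ)⁻¹ * (δ * ‖x‖ - ‖y‖) ^ 2 := by positivity
  have h2 : (2 * δ)⁻¹ * (δ * ‖x‖ - ‖y‖) ^ 2 =
      δ / 2 * ‖x‖ ^ 2 + (2 * δ)⁻¹ * ‖y‖ ^ 2 - ‖x‖ * ‖y‖ := by field_simp; ring
  linarith

theorem integrable_inner_of_memLp {μ : Measure ℝ} {z V : ℝ → E} (hz : MemLp z 2 μ) (hV : MemLp V 2 μ) :
    Integrable (fun t => inner ℝ (z t) (V t)) μ := by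
  refine (((integrable_norm_sq hz).const_mul (1 / 2)).add
    ((integrable_norm_sq hV).const_mul (2 * 1)⁻¹)).mono' (hz.1.inner hV.1) (Eventually.of_forall fun t => ?_)
  exact abs_inner_le_young one_pos _ _

theorem abs_integral_inner_le {μ : Measure ℝ} {z V : ℝ → E} (hz : MemLp z 2 μ) (hV : MemLp V 2 μ) {δ : ℝ}
    (hδ : 0 < δ) : |∫ t, inner ℝ (z t) (V t) ∂μ| ≤
      δ / 2 * ∫ t, ‖z t‖ ^ 2 ∂μ + (2 * δ)⁻¹ * ∫ t, ‖V t‖ ^ 2 ∂μ := by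
  rw [← integral_const_mul, ← integral_const_mul, ← integral_add ((integrable_norm_sq hz).const_mul _)
    ((integrable_norm_sq hV).const_mul _)]
  exact (abs_integral_le_integral_abs).trans (integral_mono (integrable_inner_of_memLp hz hV).abs
    (((integrable_norm_sq hz).const_mul _).add ((integrable_norm_sq hV).const_mul _))
    fun t => abs_inner_le_young hδ _ _)

end Hilbert

variable {L : ℝ} [hL : Fact (0 < L)]

/-- Projection onto the first `m` sines. -/
def sinProj (m : ℕ) (u : Lp ℝ 2 (leb L)) : Lp ℝ 2 (leb L) :=
  ∑ k ∈ Finset.range m, inner ℝ (sinE (k + 1)) u • sinE (k + 1)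

theorem tendsto_sinProj (u : Lp ℝ 2 (leb L)) : Tendsto (fun m => sinProj m u) atTop (𝓝 u) := by
  have := (sinHilbert.hasSum_repr u).tendsto_sum_nat
  simpa only [HilbertBasis.repr_apply_apply, coe_sinHilbert, sinProj] using this

theorem norm_sinProj_le (m : ℕ) (u : Lp ℝ 2 (leb L)) : ‖sinProj m u‖ ≤ ‖u‖ := by
  have h1 : ‖sinProj m u‖ ^ 2 ≤ ‖u‖ ^ 2 := by
    refine le_trans (le_of_eq ?_) (orthonormal_sinE.sum_inner_products_le u (s := Finset.range m))
    rw [← real_inner_self_eq_norm_sq, sinProj, orthonormal_sinE.inner_sum]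
    exact Finset.sum_congr rfl fun k _ => by simp [sq]
  exact (abs_le_of_sq_le_sq' h1 (norm_nonneg _)).2

theorem continuous_sinProj (m : ℕ) : Continuous (sinProj m : Lp ℝ 2 (leb L) → Lp ℝ 2 (leb L)) :=
  continuous_finsetSum _ fun k _ =>
    (innerSL ℝ (sinE (k + 1) : Lp ℝ 2 (leb L))).continuous.smul continuous_const

theorem memLp_sinProj (m : ℕ) {T : ℝ} {W : ℝ → Lp ℝ 2 (leb L)} (hW : MemLp W 2 (leb T)) :
    MemLp (fun t => sinProj m (W t)) 2 (leb T) :=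
  hW.mono ((continuous_sinProj m).comp_aestronglyMeasurable hW.1)
    (Eventually.of_forall fun t => norm_sinProj_le m (W t))

theorem tendsto_integral_sinProj {T : ℝ} {W : ℝ → Lp ℝ 2 (leb L)} (hW : MemLp W 2 (leb T)) :
    Tendsto (fun m => ∫ t, ‖W t - sinProj m (W t)‖ ^ 2 ∂(leb T)) atTop (𝓝 0) := by
  have := tendsto_integral_of_dominated_convergence (μ := leb T) (f := fun _ => (0 : ℝ))
    (F := fun m t => ‖W t - sinProj m (W t)‖ ^ 2) (fun t => 4 * ‖W t‖ ^ 2)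
    (fun m => ((hW.1.sub (memLp_sinProj m hW).1).norm.pow 2)) ((integrable_norm_sq hW).const_mul 4)
    (fun m => Eventually.of_forall fun t => ?_) (Eventually.of_forall fun t => ?_)
  · simpa using this
  · rw [Real.norm_of_nonneg (sq_nonneg _)]
    have h1 : ‖W t - sinProj m (W t)‖ ≤ 2 * ‖W t‖ := by
      linarith [norm_sub_le (W t) (sinProj m (W t)), norm_sinProj_le m (W t)]
    calc _ ≤ (2 * ‖W t‖) ^ 2 := pow_le_pow_left₀ (norm_nonneg _) h1 2
      _ = _ := by ring
  · have h := ((tendsto_const_nhds (x := W t)).sub (tendsto_sinProj (W t))).norm.pow 2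
    simpa using h

theorem memLp_mulOp (c : C(ℝ, C(Icc 0 L, ℝ))) {T : ℝ} {W : ℝ → Lp ℝ 2 (leb L)} (hW : MemLp W 2 (leb T)) :
    MemLp (fun t => mulOp (c t) (W t)) 2 (leb T) := by
  obtain ⟨M, hM⟩ := (isCompact_Icc (a := (0 : ℝ)) (b := T)).exists_bound_of_continuousOn
    c.continuous.continuousOn
  refine hW.of_le_mul (c := M)
    ((mulOp (L := L)).aestronglyMeasurable_comp₂ c.continuous.aestronglyMeasurable hW.1) ?_
  filter_upwards [ae_mem_Ioo T] with t ht
  exact (norm_mulOp_le _ _).trans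
    (mul_le_mul_of_nonneg_right (hM t (Ioo_subset_Icc_self ht)) (norm_nonneg _))

namespace IsCoeffLimit

variable {C D : ℝ} {P Q : ℕ → ℝ → ℕ → ℝ} {p q : ℝ → ℕ → ℝ}

theorem memLp_third_approx (h : IsCoeffLimit L C P p) (n : ℕ) (T : ℝ) :
    MemLp (fun t => third L (P n t)) 2 (leb T) :=
  memLp_leb_of_continuous (h.continuous_third_approx n) T 2

/-- Against finitely many sines, the third derivative enters only through finitely many
coefficients, where convergence is already known. -/
theorem integral_inner_sinProj {T : ℝ} {W : ℝ → Lp ℝ 2 (leb L)} (hW : MemLp W 2 (leb T)) (m : ℕ)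
    {c : ℝ → ℕ → ℝ} (hc : ∀ᵐ t ∂(leb T), Summable fun k => wave L k ^ 6 * c t k ^ 2)
    (hcont : ∀ k, Continuous fun t => c t k) :
    ∫ t, inner ℝ (third L (c t)) (sinProj m (W t)) ∂(leb T) =
      ∑ k ∈ Finset.range m, wave L (k + 1) ^ 3 * ∫ t, c t (k + 1) * inner ℝ (sinE (k + 1)) (W t) ∂(leb T) := by
  have hi (k : ℕ) : Integrable (fun t => c t (k + 1) * inner ℝ (sinE (k + 1)) (W t)) (leb T) := by
    refine ((memLp_leb_of_continuous (hcont (k + 1)) T 2).integrable_mul (q := 2)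
      (g := fun t => inner ℝ (sinE (k + 1)) (W t)) ?_)
    exact hW.const_inner _
  simp only [← integral_const_mul]
  rw [← integral_finsetSum _ fun k _ => (hi k).const_mul _]
  refine integral_congr_ae ?_
  filter_upwards [hc] with t ht
  rw [sinProj, inner_sum]
  refine Finset.sum_congr rfl fun k _ => ?_
  rw [inner_smul_right, real_inner_comm (sinE (k + 1)) (third L (c t)), third,
    inner_sinE_dxL2_three ht]
  ring

/-- Weak convergence of the third derivatives in `L₂(0, T; L₂)`. The norms are bounded, so it
suffices to replace `W` by its projection onto finitely many sines. -/
theorem tendsto_integral_inner_third (h : IsCoeffLimit L C P p) {T : ℝ} (hT : 0 < T)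
    {W : ℝ → Lp ℝ 2 (leb L)} (hW : MemLp W 2 (leb T)) :
    Tendsto (fun n => ∫ t, inner ℝ (third L (P n t)) (W t) ∂(leb T)) atTop
      (𝓝 (∫ t, inner ℝ (third L (p t)) (W t) ∂(leb T))) := by
  have hz := h.memLp_third hT
  set D := C + ∫ t, ‖third L (p t)‖ ^ 2 ∂(leb T) with hD
  have hp0 : 0 ≤ ∫ t, ‖third L (p t)‖ ^ 2 ∂(leb T) := integral_nonneg fun _ => sq_nonneg _
  have hD0 : 0 ≤ D := add_nonneg h.nonneg hp0
  refine tendsto_of_forall_approx fun e he => ?_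
  -- `D` bounds the squared norms of both the approximations and the limit; this `δ` makes their
  -- share in Young's inequality at most `e / 2`, and then `m` is chosen.
  set δ := e / (D + 1) with hδ
  have hδ0 : 0 < δ := by positivity
  obtain ⟨m, hm⟩ : ∃ m, ∫ t, ‖W t - sinProj m (W t)‖ ^ 2 ∂(leb T) < e * δ :=
    ((tendsto_integral_sinProj hW).eventually_lt_const (by positivity)).exists
  have hV := hW.sub (memLp_sinProj m hW)
  have key {z : ℝ → Lp ℝ 2 (leb L)} (hz : MemLp z 2 (leb T)) (hzD : ∫ t, ‖z t‖ ^ 2 ∂(leb T) ≤ D) :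
      |∫ t, inner ℝ (z t) (W t) ∂(leb T) - ∫ t, inner ℝ (z t) (sinProj m (W t)) ∂(leb T)| ≤ e := by
    rw [← integral_sub (integrable_inner_of_memLp hz hW)
      (integrable_inner_of_memLp hz (memLp_sinProj m hW))]
    simp only [← inner_sub_right]
    refine (abs_integral_inner_le hz hV hδ0).trans ?_
    have h1 : δ / 2 * ∫ t, ‖z t‖ ^ 2 ∂(leb T) ≤ e / 2 := by
      calc _ ≤ δ / 2 * (D + 1) := mul_le_mul_of_nonneg_left (by linarith) (by positivity)
        _ = e / 2 := by rw [hδ]; field_simp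
    have h2 : (2 * δ)⁻¹ * ∫ t, ‖(W - fun t => sinProj m (W t)) t‖ ^ 2 ∂(leb T) ≤ e / 2 := by
      calc _ ≤ (2 * δ)⁻¹ * (e * δ) := mul_le_mul_of_nonneg_left hm.le (by positivity)
        _ = e / 2 := by field_simp
    linarith
  refine ⟨_, _, ?_, fun n => key (h.memLp_third_approx n T) ((h.integral_third n T hT.le).trans (by linarith)),
    key hz (by linarith [h.nonneg])⟩
  simp only [fun n => integral_inner_sinProj hW m (Eventually.of_forall fun t => h.summable_approx n t _)
    (h.continuous n)]
  rw [integral_inner_sinProj hW m (h.ae_leb_summable_wave_six T) h.continuous_limit]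
  refine tendsto_finsetSum _ fun k _ => (h.tendsto_integral_mul_coeff (k + 1) ?_).const_mul _
  exact (hW.const_inner _).integrable (by norm_num)

/-- Weak times uniform convergence. Multiplication is self-adjoint and moves the coefficient onto
`W`; replacing `c n` by `d` there costs at most their uniform distance times a bounded quantity. -/
theorem tendsto_integral_inner_mulOp (h : IsCoeffLimit L C P p) {T : ℝ} (hT : 0 < T)
    {c : ℕ → C(ℝ, C(Icc 0 L, ℝ))} {d : C(ℝ, C(Icc 0 L, ℝ))} (hc : Tendsto c atTop (𝓝 d))
    {W : ℝ → Lp ℝ 2 (leb L)} (hW : MemLp W 2 (leb T)) :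
    Tendsto (fun n => ∫ t, inner ℝ (mulOp (c n t) (third L (P n t))) (W t) ∂(leb T)) atTop
      (𝓝 (∫ t, inner ℝ (mulOp (d t) (third L (p t))) (W t) ∂(leb T))) := by
  simp only [inner_mulOp]
  have h1 := h.tendsto_integral_inner_third hT (memLp_mulOp d hW)
  have h2 : Tendsto (fun n => ∫ t, inner ℝ (third L (P n t)) (mulOp (c n t) (W t)) ∂(leb T)
      - ∫ t, inner ℝ (third L (P n t)) (mulOp (d t) (W t)) ∂(leb T)) atTop (𝓝 0) := by
    rw [ContinuousMap.tendsto_iff_forall_isCompact_tendstoUniformlyOn] at hc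
    have hu := Metric.tendstoUniformlyOn_iff.1 (hc (Icc 0 T) isCompact_Icc)
    set A := C + ∫ t, ‖W t‖ ^ 2 ∂(leb T) with hA
    have hA0 : 0 ≤ A := add_nonneg h.nonneg (integral_nonneg fun _ => sq_nonneg _)
    rw [Metric.tendsto_nhds]
    intro e he
    filter_upwards [hu (e / (A + 1)) (by positivity)] with n hn
    have hz := h.memLp_third_approx n T
    rw [Real.dist_eq, sub_zero, ← integral_sub (integrable_inner_of_memLp hz (memLp_mulOp (c n) hW))
      (integrable_inner_of_memLp hz (memLp_mulOp d hW))]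
    calc _ ≤ ∫ t, e / (A + 1) * (‖third L (P n t)‖ ^ 2 + ‖W t‖ ^ 2) ∂(leb T) := by
          refine abs_integral_le_integral_abs.trans (integral_mono_ae
            ((integrable_inner_of_memLp hz (memLp_mulOp (c n) hW)).sub
              (integrable_inner_of_memLp hz (memLp_mulOp d hW))).abs
            (((integrable_norm_sq hz).add (integrable_norm_sq hW)).const_mul _) ?_)
          filter_upwards [ae_mem_Ioo T] with t ht
          have h3 := (hn t (Ioo_subset_Icc_self ht)).le
          rw [dist_comm, dist_eq_norm] at h3
          rw [← inner_sub_right, ← _root_.sub_apply, ← map_sub]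
          refine (abs_real_inner_le_norm _ _).trans ?_
          have h4 : ‖mulOp (c n t - d t) (W t)‖ ≤ e / (A + 1) * ‖W t‖ :=
            (norm_mulOp_le _ _).trans (mul_le_mul_of_nonneg_right h3 (norm_nonneg _))
          calc _ ≤ ‖third L (P n t)‖ * (e / (A + 1) * ‖W t‖) :=
                mul_le_mul_of_nonneg_left h4 (norm_nonneg _)
            _ = e / (A + 1) * (‖third L (P n t)‖ * ‖W t‖) := by ring
            _ ≤ _ := by
                refine mul_le_mul_of_nonneg_left ?_ (by positivity)
                nlinarith [sq_nonneg (‖third L (P n t)‖ - ‖W t‖), norm_nonneg (third L (P n t)), norm_nonneg (W t)]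
      _ ≤ e / (A + 1) * A := by
          rw [integral_const_mul, integral_add (integrable_norm_sq hz) (integrable_norm_sq hW)]
          refine mul_le_mul_of_nonneg_left ?_ (by positivity)
          linarith [h.integral_third n T hT.le]
      _ < e := by
          rw [div_mul_eq_mul_div, div_lt_iff₀ (by positivity)]
          exact mul_lt_mul_of_pos_left (by linarith) he
  have := h1.add h2
  simpa using this

theorem memLp_field_limit (h : IsCoeffLimit L C P p) (k : IsCoeffLimit L D Q q) (Φ Ψ : C(ℝ × ℝ, ℝ)) {T : ℝ}
    (hT : 0 < T) :
    MemLp (fun t => field Φ Ψ (sumC L (p t)) (sumC L (q t)) (third L (p t)) (third L (q t))) 2 (leb T) := by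
  have hs (Θ : C(ℝ × ℝ, ℝ)) : Continuous fun t => superpose Θ (sumC L (p t), sumC L (q t)) :=
    (continuous_superpose Θ).comp (h.continuous_sumC.prodMk k.continuous_sumC)
  exact (memLp_mulOp ⟨_, hs Φ⟩ (h.memLp_third hT)).add (memLp_mulOp ⟨_, hs Ψ⟩ (k.memLp_third hT))

theorem memLp_field_approx (h : IsCoeffLimit L C P p) (k : IsCoeffLimit L D Q q) (Φ Ψ : C(ℝ × ℝ, ℝ)) (n : ℕ)
    (T : ℝ) :
    MemLp (fun t => field Φ Ψ (sumC L (P n t)) (sumC L (Q n t)) (third L (P n t)) (third L (Q n t)))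
      2 (leb T) :=
  memLp_leb_of_continuous (continuous_field Φ Ψ (h.continuous_sumC_approx n) (k.continuous_sumC_approx n)
    (h.continuous_third_approx n) (k.continuous_third_approx n)) T 2

theorem tendsto_integral_inner_field (h : IsCoeffLimit L C P p) (k : IsCoeffLimit L D Q q)
    (Φ Ψ : C(ℝ × ℝ, ℝ)) {T : ℝ} (hT : 0 < T) {W : ℝ → Lp ℝ 2 (leb L)} (hW : MemLp W 2 (leb T)) :
    Tendsto (fun n => ∫ t, inner ℝ
      (field Φ Ψ (sumC L (P n t)) (sumC L (Q n t)) (third L (P n t)) (third L (Q n t))) (W t) ∂(leb T)) atTop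
      (𝓝 (∫ t, inner ℝ
        (field Φ Ψ (sumC L (p t)) (sumC L (q t)) (third L (p t)) (third L (q t))) (W t) ∂(leb T))) := by
  -- Superposition is continuous on the space of continuous functions, so composing with it
  -- preserves locally uniform convergence of curves.
  have hlim (Θ : C(ℝ × ℝ, ℝ)) : Tendsto
      (fun n => (⟨superpose Θ, continuous_superpose Θ⟩ : C(C(Icc 0 L, ℝ) × C(Icc 0 L, ℝ), C(Icc 0 L, ℝ))).comp
        ((h.approxCurve n).prodMk (k.approxCurve n))) atTop
      (𝓝 ((⟨superpose Θ, continuous_superpose Θ⟩ : C(C(Icc 0 L, ℝ) × C(Icc 0 L, ℝ), C(Icc 0 L, ℝ))).comp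
        (h.limitCurve.prodMk k.limitCurve))) := by
    refine ((ContinuousMap.continuous_postcomp _).tendsto _).comp ?_
    rw [ContinuousMap.tendsto_iff_forall_isCompact_tendstoUniformlyOn]
    intro K hK e he
    have h1 := ContinuousMap.tendsto_iff_forall_isCompact_tendstoUniformlyOn.1 h.tendsto_approxCurve K hK
    have h2 := ContinuousMap.tendsto_iff_forall_isCompact_tendstoUniformlyOn.1 k.tendsto_approxCurve K hK
    exact (tendsto_id.prodMk tendsto_id).eventually (h1.prodMk h2 e he)
  have h1 := h.tendsto_integral_inner_mulOp hT (hlim Φ) hW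
  have h2 := k.tendsto_integral_inner_mulOp hT (hlim Ψ) hW
  have i1 (n : ℕ) := integrable_inner_of_memLp (memLp_mulOp ((⟨superpose Φ, continuous_superpose Φ⟩ :
    C(C(Icc 0 L, ℝ) × C(Icc 0 L, ℝ), C(Icc 0 L, ℝ))).comp
        ((h.approxCurve n).prodMk (k.approxCurve n))) (h.memLp_third_approx n T)) hW
  have i2 (n : ℕ) := integrable_inner_of_memLp (memLp_mulOp ((⟨superpose Ψ, continuous_superpose Ψ⟩ :
    C(C(Icc 0 L, ℝ) × C(Icc 0 L, ℝ), C(Icc 0 L, ℝ))).comp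
        ((h.approxCurve n).prodMk (k.approxCurve n))) (k.memLp_third_approx n T)) hW
  have j1 := integrable_inner_of_memLp (memLp_mulOp ((⟨superpose Φ, continuous_superpose Φ⟩ :
    C(C(Icc 0 L, ℝ) × C(Icc 0 L, ℝ), C(Icc 0 L, ℝ))).comp
        ((h.limitCurve).prodMk (k.limitCurve))) (h.memLp_third hT)) hW
  have j2 := integrable_inner_of_memLp (memLp_mulOp ((⟨superpose Ψ, continuous_superpose Ψ⟩ :
    C(C(Icc 0 L, ℝ) × C(Icc 0 L, ℝ), C(Icc 0 L, ℝ))).comp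
        ((h.limitCurve).prodMk (k.limitCurve))) (k.memLp_third hT)) hW
  have h3 := h1.add h2
  simp only [← fun n => integral_add (i1 n) (i2 n)] at h3
  rw [← integral_add j1 j2] at h3
  simp only [field, inner_add_left]
  exact h3

/-- Lower semicontinuity of the square of the `L₂(0, T; L₂)` norm along fields of approximations. -/
theorem exists_lower_bound_integral_norm_sq_field (h : IsCoeffLimit L C P p) (k : IsCoeffLimit L D Q q)
    (Φ Ψ : C(ℝ × ℝ, ℝ)) {T : ℝ} (hT : 0 < T) : ∃ b : ℕ → ℝ,
    (∀ n, b n ≤ ∫ t, ‖field Φ Ψ (sumC L (P n t)) (sumC L (Q n t)) (third L (P n t)) (third L (Q n t))‖ ^ 2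
      ∂(leb T)) ∧
    Tendsto b atTop (𝓝 (∫ t, ‖field Φ Ψ (sumC L (p t)) (sumC L (q t)) (third L (p t)) (third L (q t))‖ ^ 2
      ∂(leb T))) := by
  have hY := h.memLp_field_limit k Φ Ψ hT
  -- Expanding `‖Y_n - Y‖² ≥ 0` gives the lower bound `2⟨Y_n, Y⟩ - ‖Y‖²`, and after integration weak
  -- convergence applies to it. An explicit convergent minorant is easier to add up than lower
  -- limits.
  have hl := ((h.tendsto_integral_inner_field k Φ Ψ hT hY).const_mul 2).sub_const
    (∫ t, ‖field Φ Ψ (sumC L (p t)) (sumC L (q t)) (third L (p t)) (third L (q t))‖ ^ 2 ∂(leb T))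
  simp only [real_inner_self_eq_norm_sq] at hl
  refine ⟨_, fun n => ?_, by convert hl using 2; ring⟩
  have hYn := h.memLp_field_approx k Φ Ψ n T
  rw [← integral_const_mul, ← integral_sub ((integrable_inner_of_memLp hYn hY).const_mul 2)
    (integrable_norm_sq hY)]
  refine integral_mono (((integrable_inner_of_memLp hYn hY).const_mul 2).sub (integrable_norm_sq hY))
    (integrable_norm_sq hYn) fun t => ?_
  have := norm_sub_sq_real (field Φ Ψ (sumC L (P n t)) (sumC L (Q n t)) (third L (P n t)) (third L (Q n t)))
    (field Φ Ψ (sumC L (p t)) (sumC L (q t)) (third L (p t)) (third L (q t)))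
  have h0 := sq_nonneg ‖field Φ Ψ (sumC L (P n t)) (sumC L (Q n t)) (third L (P n t)) (third L (Q n t)) -
    field Φ Ψ (sumC L (p t)) (sumC L (q t)) (third L (p t)) (third L (q t))‖
  linarith

end IsCoeffLimit

end

end ThinFilm

namespace ThinFilm

noncomputable section

variable {L : ℝ}

/-! ### Finite cosine sums -/

theorem cosSum_of_eq_zero {c : ℕ → ℝ} {n : ℕ} (hc : ∀ k, n < k → c k = 0) (x : ℝ) :
    cosSum L c x = ∑ k ∈ Finset.range (n + 1), c k * cosBasis L k x :=
  tsum_smul_of_eq_zero hc fun k => cosBasis L k x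

theorem iteratedDeriv_cosSum {c : ℕ → ℝ} {n : ℕ} (hc : ∀ k, n < k → c k = 0) (x : ℝ) :
    iteratedDeriv 3 (cosSum L c) x
      = ∑ k ∈ Finset.range (n + 1), c k * wave L k ^ 3 * sinBasis L k x := by
  have d1 : deriv (cosSum L c) = fun x => ∑ k ∈ Finset.range (n + 1), -(c k * wave L k) * sinBasis L k x := by
    funext x
    rw [funext (cosSum_of_eq_zero hc), (HasDerivAt.fun_sum fun k _ =>
      (hasDerivAt_cosBasis k x).const_mul (c k)).deriv]
    exact Finset.sum_congr rfl fun k _ => by ring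
  have d2 : deriv (deriv (cosSum L c)) =
      fun x => ∑ k ∈ Finset.range (n + 1), -(c k * wave L k ^ 2) * cosBasis L k x := by
    funext x
    rw [d1, (HasDerivAt.fun_sum fun k _ => (hasDerivAt_sinBasis k x).const_mul (-(c k * wave L k))).deriv]
    exact Finset.sum_congr rfl fun k _ => by ring
  rw [iteratedDeriv_succ, iteratedDeriv_succ, iteratedDeriv_succ, iteratedDeriv_zero, d2,
    (HasDerivAt.fun_sum fun k _ => (hasDerivAt_cosBasis k x).const_mul (-(c k * wave L k ^ 2))).deriv]
  exact Finset.sum_congr rfl fun k _ => by ring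

theorem sum_smul_coeFn {e : ℕ → Lp ℝ 2 (leb L)} {b : ℕ → ℝ → ℝ} (h : ∀ k, e k =ᵐ[leb L] b k) (a : ℕ → ℝ)
    (s : Finset ℕ) : (∑ k ∈ s, a k • e k : Lp ℝ 2 (leb L)) =ᵐ[leb L] fun x => ∑ k ∈ s, a k * b k x := by
  classical
  induction s using Finset.induction_on with
  | empty =>
    simp only [Finset.sum_empty]
    exact Lp.coeFn_zero ℝ 2 (leb L)
  | insert k s hk ih =>
    rw [Finset.sum_insert hk]
    filter_upwards [Lp.coeFn_add (a k • e k) (∑ k ∈ s, a k • e k), Lp.coeFn_smul (a k) (e k), h k, ih]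
      with x h1 h2 h3 h4
    rw [h1, Pi.add_apply, h2, Pi.smul_apply, h3, h4, Finset.sum_insert hk, smul_eq_mul]

/-! ### Time derivatives -/

theorem continuous_innerSL_comp_dxL2 (j : Fin 2) :
    Continuous fun H : Lp ℝ 2 (leb L) => (innerSL ℝ H).comp (dxL2 (k := 1) j) :=
  (innerSL ℝ).continuous.clm_comp continuous_const

theorem memLp_innerSL_comp_dxL2 (j : Fin 2) {T : ℝ} {H : ℝ → Lp ℝ 2 (leb L)} (hH : MemLp H 2 (leb T)) :
    MemLp (fun t => (innerSL ℝ (H t)).comp (dxL2 (k := 1) j)) 2 (leb T) := by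
  refine MemLp.of_le_mul (E := StrongDual ℝ (Sob L 1)) hH (c := ‖(dxL2 j : Sob L 1 →L[ℝ] Lp ℝ 2 (leb L))‖)
    ((continuous_innerSL_comp_dxL2 j).comp_aestronglyMeasurable hH.1) (Eventually.of_forall fun t => ?_)
  refine (ContinuousLinearMap.opNorm_comp_le _ _).trans ?_
  rw [innerSL_apply_norm, mul_comm]

theorem IsTest.memLp_deriv {T : ℝ} {θ : ℝ → ℝ} (hθ : IsTest T θ) :
    MemLp (deriv θ) 2 (leb T) :=
  memLp_leb_of_continuous (hθ.1.continuous_deriv (by simp)) T 2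

theorem IsTest.memLp {T : ℝ} {θ : ℝ → ℝ} (hθ : IsTest T θ) : MemLp θ 2 (leb T) :=
  memLp_leb_of_continuous hθ.1.continuous T 2

theorem integrable_smul_of_memLp {E : Type*} [NormedAddCommGroup E] [NormedSpace ℝ E] {μ : Measure ℝ}
    {θ : ℝ → ℝ} {w : ℝ → E} (hθ : MemLp θ 2 μ) (hw : MemLp w 2 μ) : Integrable (fun t => θ t • w t) μ :=
  memLp_one_iff_integrable.1 (hw.smul hθ)

section

variable [hL : Fact (0 < L)]

/-- Both sides of the distributional identity are continuous functionals on `H^1`, so testing with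
cosines is enough by density. -/
theorem isTimeDeriv_of_coeff {T : ℝ} {F H : ℝ → Lp ℝ 2 (leb L)} (hF : MemLp F 2 (leb T))
    (hH : MemLp H 2 (leb T)) (h : ∀ θ, IsTest T θ → ∀ j, ∫ t, deriv θ t * inner ℝ (F t) (cosE j) ∂(leb T)
      = -∫ t, θ t * inner ℝ (H t) (dxL2 1 (cosH3 j : Sob L 3)) ∂(leb T)) :
    IsTimeDeriv T F fun t => (innerSL ℝ (H t)).comp (dxL2 1) := by
  intro θ hθ
  have i1 := integrable_smul_of_memLp (E := StrongDual ℝ (Sob L 1)) hθ.memLp_deriv (memLp_innerSL_comp_dxL2 0 hF)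
  have i2 := integrable_smul_of_memLp (E := StrongDual ℝ (Sob L 1)) hθ.memLp (memLp_innerSL_comp_dxL2 1 hH)
  have hd : Dense (Submodule.span ℝ (range fun k => toH1 (cosH3 k : Sob L 3)) : Set (Sob L 1)) :=
    Submodule.dense_iff_topologicalClosure_eq_top.2 dense_span_cosH1
  refine ContinuousLinearMap.ext_on hd ?_
  rintro _ ⟨j, rfl⟩
  refine (ContinuousLinearMap.integral_apply i1 (toH1 (cosH3 j))).trans ?_
  refine Eq.trans ?_ (congrArg Neg.neg (ContinuousLinearMap.integral_apply i2 (toH1 (cosH3 j))).symm)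
  exact h θ hθ j

theorem integral_deriv_mul_eq_neg {T : ℝ} (hT : 0 < T) {θ : ℝ → ℝ} (hθ : IsTest T θ) {f f' : ℝ → ℝ}
    (hf : Continuous f) (hf' : Continuous f') (hd : ∀ t > 0, HasDerivAt f (f' t) t) :
    ∫ t, deriv θ t * f t ∂(leb T) = -∫ t, θ t * f' t ∂(leb T) := by
  have hθd (t : ℝ) : HasDerivAt θ (deriv θ t) t :=
    (hθ.1.differentiable (by simp)).differentiableAt.hasDerivAt
  have hc : Continuous (deriv θ) := hθ.1.continuous_deriv (by simp)
  have h1 := intervalIntegral.integral_eq_sub_of_hasDerivAt_of_le hT.le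
    (hθ.1.continuous.mul hf).continuousOn (fun t ht => (hθd t).mul (hd t ht.1))
    (((hc.mul hf).add (hθ.1.continuous.mul hf')).intervalIntegrable _ _)
  simp only [Pi.mul_apply] at h1
  rw [hθ.eq_zero_of_notMem (x := T) (by simp), hθ.eq_zero_of_notMem (x := 0) (by simp),
    intervalIntegral.integral_of_le hT.le, integral_Ioc_eq_integral_Ioo,
    integral_add (f := fun t => deriv θ t * f t) (g := fun t => θ t * f' t)
      (integrable_leb_of_continuous (hc.mul hf) T)
      (integrable_leb_of_continuous (hθ.1.continuous.mul hf') T)] at h1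
  linarith

theorem IsCoeffLimit.inner_cosE {C : ℝ} {P : ℕ → ℝ → ℕ → ℝ} {p : ℝ → ℕ → ℝ} (h : IsCoeffLimit L C P p)
    (t : ℝ) (j : ℕ) : inner ℝ (ofC (sumC L (p t))) (cosE j) = p t j := by
  have := (innerSL ℝ (cosE j : Lp ℝ 2 (leb L))).hasSum (hasSum_ofC_sumC (h.summable_abs t))
  simp only [innerSL_apply_apply] at this
  rw [real_inner_comm, ← this.tsum_eq, tsum_eq_single j fun k hk => ?_]
  · rw [inner_smul_right, ThinFilm.inner_cosE, if_pos rfl, mul_one]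
  · rw [inner_smul_right, ThinFilm.inner_cosE, if_neg hk.symm, mul_zero]

/-- For fixed `j` the Galerkin equation for mode `j` need hold only from some order on, which is all
the limit requires. The differentiated component `U` is kept apart from `P, Q` so that both
equations are covered. -/
theorem IsCoeffLimit.isTimeDeriv {A B C : ℝ} {U P Q : ℕ → ℝ → ℕ → ℝ} {u p q : ℝ → ℕ → ℝ}
    (hu : IsCoeffLimit L A U u) (h : IsCoeffLimit L B P p) (k : IsCoeffLimit L C Q q) (Φ Ψ : C(ℝ × ℝ, ℝ))
    (hd : ∀ j, ∀ᶠ n in atTop, ∀ t > 0, HasDerivAt (fun s => U n s j) (inner ℝ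
      (field Φ Ψ (sumC L (P n t)) (sumC L (Q n t)) (third L (P n t)) (third L (Q n t)))
      (dxL2 1 (cosH3 j : Sob L 3))) t) {T : ℝ} (hT : 0 < T) :
    IsTimeDeriv T (fun t => dxL2 0 (sumH3 L (u t))) fun t => (innerSL ℝ
      (field Φ Ψ (sumC L (p t)) (sumC L (q t)) (third L (p t)) (third L (q t)))).comp (dxL2 1) := by
  have hF : MemLp (fun t => dxL2 0 (sumH3 L (u t))) 2 (leb T) :=
    (dxL2 0).comp_memLp' (hu.memLp_sumH3 hT)
  have hH := h.memLp_field_limit k Φ Ψ hT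
  refine isTimeDeriv_of_coeff hF hH fun θ hθ j => ?_
  have e1 : ∫ t, deriv θ t * inner ℝ (dxL2 0 (sumH3 L (u t))) (cosE j) ∂(leb T)
      = ∫ t, u t j * deriv θ t ∂(leb T) := by
    refine integral_congr_ae ?_
    filter_upwards [hu.ae_leb_summable_wave_six T] with t ht
    rw [dxL2_zero_sumH3 ht, hu.inner_cosE, mul_comm]
  rw [e1]
  have h1 := hu.tendsto_integral_mul_coeff j (hθ.memLp_deriv.integrable (by norm_num))
  have hW : MemLp (fun t => θ t • dxL2 1 (cosH3 j : Sob L 3)) 2 (leb T) :=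
    memLp_leb_of_continuous (hθ.1.continuous.smul continuous_const) T 2
  have h2 := (h.tendsto_integral_inner_field k Φ Ψ hT hW).neg
  simp only [inner_smul_right] at h2
  refine tendsto_nhds_unique_of_eventuallyEq h1 h2 ?_
  filter_upwards [hd j] with n hn
  have := integral_deriv_mul_eq_neg hT hθ (hu.continuous n j)
    ((continuous_field Φ Ψ (h.continuous_sumC_approx n) (k.continuous_sumC_approx n)
    (h.continuous_third_approx n) (k.continuous_third_approx n)).inner continuous_const) hn
  rw [← this]
  simp only [mul_comm]

/-! ### The Galerkin approximations as functions -/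

theorem third_coeFn {c : ℕ → ℝ} {n : ℕ} (hc : ∀ k, n < k → c k = 0) :
    third L c =ᵐ[leb L] iteratedDeriv 3 (cosSum L c) := by
  rw [third_of_eq_zero hc, funext (iteratedDeriv_cosSum hc)]
  exact sum_smul_coeFn sinE_coeFn _ _

theorem dxL2_one_cosH3_coeFn (j : ℕ) : dxL2 1 (cosH3 j : Sob L 3) =ᵐ[leb L] deriv (cosBasis L j) := by
  rw [dxL2_one_cosH3]
  filter_upwards [Lp.coeFn_smul (-(wave L j)) (sinE j : Lp ℝ 2 (leb L)), sinE_coeFn (L := L) j] with x h1 h2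
  rw [h1, Pi.smul_apply, h2, deriv_cosBasis, smul_eq_mul]

theorem ae_ext_sumC {c : ℕ → ℝ} (hc : Summable fun k => |c k|) :
    ∀ᵐ x ∂(leb L), ext (sumC L c) x = cosSum L c x := by
  filter_upwards [ae_mem_Ioo L] with x hx
  exact ext_sumC hc (Ioo_subset_Icc_self hx)

namespace IsGalerkinCurve

variable {R μ ε : ℝ} {c₀ d₀ : ℕ → ℝ} {n : ℕ} {p q : ℝ → ℕ → ℝ}

theorem summable_abs (h : IsGalerkinCurve L R μ ε c₀ d₀ n p q) (t : ℝ) :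
    Summable (fun k => |p t k|) ∧ Summable fun k => |q t k| :=
  ⟨ThinFilm.summable_abs (L := L) (summable_mul_of_eq_zero (fun k hk => (h.eq_zero t k hk).1) _),
    ThinFilm.summable_abs (L := L) (summable_mul_of_eq_zero (fun k hk => (h.eq_zero t k hk).2) _)⟩

theorem contDiffOn_of_hasDerivWithinAt {f f' : ℝ → ℝ} (hf : ∀ t ≥ 0, HasDerivWithinAt f (f' t) (Ici 0) t)
    (hf' : Continuous f') : ContDiffOn ℝ 1 f (Ici 0) := by
  rw [contDiffOn_one_iff_derivWithin (uniqueDiffOn_Ici 0)]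
  refine ⟨fun t ht => (hf t ht).differentiableWithinAt, hf'.continuousOn.congr fun t ht => ?_⟩
  exact (hf t ht).derivWithin (uniqueDiffOn_Ici 0 t ht)

theorem integral_derivWithin_mul {c : ℝ → ℕ → ℝ} (hc : ∀ t k, n < k → c t k = 0) {a : ℕ → ℝ} {t : ℝ}
    (ht : 0 ≤ t) (hd : ∀ k ≤ n, HasDerivWithinAt (fun s => c s k) (a k) (Ici 0) t) {j : ℕ} (hj : j ≤ n) :
    ∫ x, derivWithin (fun s => cosSum L (c s) x) (Ici 0) t * cosBasis L j x ∂(leb L) = a j := by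
  have e (x : ℝ) : derivWithin (fun s => cosSum L (c s) x) (Ici 0) t
      = ∑ k ∈ Finset.range (n + 1), a k * cosBasis L k x := by
    simp only [fun s => cosSum_of_eq_zero (L := L) (hc s) x]
    refine (HasDerivWithinAt.fun_sum fun k hk => ?_).derivWithin (uniqueDiffOn_Ici 0 t ht)
    exact (hd k (by rw [Finset.mem_range] at hk; omega)).mul_const _
  have h1 : ∫ x, derivWithin (fun s => cosSum L (c s) x) (Ici 0) t * cosBasis L j x ∂(leb L)
      = inner ℝ (∑ k ∈ Finset.range (n + 1), a k • cosE k : Lp ℝ 2 (leb L)) (cosE j) := by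
    rw [inner_eq_integral]
    refine integral_congr_ae ?_
    filter_upwards [sum_smul_coeFn (L := L) cosE_coeFn a (Finset.range (n + 1)), cosE_coeFn (L := L) j]
      with x h1 h2
    rw [h1, h2, e]
  rw [h1, sum_inner, Finset.sum_eq_single j (fun k _ hk => ?_) fun hk => ?_]
  · rw [inner_smul_left, inner_cosE, if_pos rfl, mul_one]; rfl
  · rw [inner_smul_left, inner_cosE, if_neg hk, mul_zero]
  · exact absurd (Finset.mem_range.2 (by omega)) hk

theorem isGalerkin (h : IsGalerkinCurve L R μ ε c₀ d₀ n p q) {f₀ g₀ : Sob L 1}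
    (hc : ∀ k, c₀ k = inner ℝ (dxL2 0 f₀) (cosE k)) (hd : ∀ k, d₀ k = inner ℝ (dxL2 0 g₀) (cosE k)) :
    IsGalerkin R μ ε f₀ g₀ n (fun t => cosSum L (p t)) fun t => cosSum L (q t) := by
  have hp (t : ℝ) (k : ℕ) (hk : n < k) := (h.eq_zero t k hk).1
  have hq (t : ℝ) (k : ℕ) (hk : n < k) := (h.eq_zero t k hk).2
  have hin (u : Sob L 1) (k : ℕ) : inner ℝ (dxL2 0 u) (cosE k) = ∫ x, dx 0 u x * cosBasis L k x ∂(leb L) := by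
    rw [inner_eq_integral]
    refine integral_congr_ae ?_
    filter_upwards [cosE_coeFn (L := L) k] with x hx
    rw [hx]; rfl
  refine ⟨fun k t => p t k, fun k t => q t k, fun k => ?_, fun t x => cosSum_of_eq_zero (hp t) x,
    fun t x => cosSum_of_eq_zero (hq t) x, fun k hk => ?_, fun t ht j hj => ?_⟩
  · by_cases hk : k ≤ n
    · exact ⟨contDiffOn_of_hasDerivWithinAt (h.deriv_fst k hk)
          ((h.continuous_field _ _).inner continuous_const),
        contDiffOn_of_hasDerivWithinAt (h.deriv_snd k hk)
          ((h.continuous_field _ _).inner continuous_const)⟩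
    · simp only [fun t => hp t k (not_le.1 hk), fun t => hq t k (not_le.1 hk)]
      exact ⟨contDiffOn_const, contDiffOn_const⟩
  · rw [← hin, ← hin, ← hc, ← hd]
    exact h.init k hk
  · rw [integral_derivWithin_mul hp ht (fun k hk => h.deriv_fst k hk t ht) hj,
      integral_derivWithin_mul hq ht (fun k hk => h.deriv_snd k hk t ht) hj]
    rw [inner_eq_integral, inner_eq_integral]
    have hs := h.summable_abs t
    constructor
    · refine integral_congr_ae ?_
      filter_upwards [fieldF_coeFn R ε (sumC L (p t)) (sumC L (q t)) (third L (p t)) (third L (q t)),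
        ae_ext_sumC hs.1, ae_ext_sumC hs.2, third_coeFn (hp t), third_coeFn (hq t),
        dxL2_one_cosH3_coeFn (L := L) j] with x h1 h2 h3 h4 h5 h6
      rw [seqF, h1, h2, h3, h4, h5, h6]
    · refine integral_congr_ae ?_
      filter_upwards [fieldG_coeFn R μ ε (sumC L (p t)) (sumC L (q t)) (third L (p t)) (third L (q t)),
        ae_ext_sumC hs.1, ae_ext_sumC hs.2, third_coeFn (hp t), third_coeFn (hq t),
        dxL2_one_cosH3_coeFn (L := L) j] with x h1 h2 h3 h4 h5 h6
      rw [seqG, h1, h2, h3, h4, h5, h6]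

end IsGalerkinCurve

end

end

end ThinFilm

namespace ThinFilm

noncomputable section

variable {L : ℝ}

/-! ### Passage to the limit -/

theorem energy_eq_norm_sq (R : ℝ) (u v : Sob L 1) :
    energy R u v = 1 / 2 * (‖dxL2 1 u‖ ^ 2 + R * ‖dxL2 1 (u + v)‖ ^ 2) := by
  have h (w : Sob L 1) : ‖dxL2 1 w‖ ^ 2 = ∫ x, |dx 1 w x| ^ 2 ∂(leb L) := by
    rw [norm_sq_eq_integral]
    simp only [sq_abs]; rfl
  have hi (w : Sob L 1) : Integrable (fun x => |dx 1 w x| ^ 2) (leb L) := by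
    simp only [sq_abs]
    exact (Lp.memLp (dxL2 1 w)).integrable_sq
  rw [h, h, energy, integral_add (hi u) ((hi _).const_mul R), integral_const_mul]

variable [hL : Fact (0 < L)]

theorem modeEnergy_le_energy {R : ℝ} (hR : 0 < R) (f₀ g₀ : Sob L 1) (n : ℕ) :
    modeEnergy L R n (fun k => inner ℝ (dxL2 0 f₀) (cosE k)) (fun k => inner ℝ (dxL2 0 g₀) (cosE k))
      ≤ energy R f₀ g₀ := by
  have h1 := sum_wave_sq_coeff_le f₀ n
  have h2 := mul_le_mul_of_nonneg_left (sum_wave_sq_coeff_le (f₀ + g₀) n) hR.le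
  simp only [map_add, inner_add_left] at h2
  rw [energy_eq_norm_sq, modeEnergy, map_add]
  refine mul_le_mul_of_nonneg_left ?_ (by norm_num)
  refine le_trans (le_of_eq ?_) (add_le_add h1 h2)
  rw [Finset.mul_sum, ← Finset.sum_add_distrib]
  exact Finset.sum_congr rfl fun k _ => by ring

theorem tendsto_modeEnergy (R : ℝ) {c d : ℕ → ℝ} (hc : Summable fun k => wave L k ^ 6 * c k ^ 2)
    (hd : Summable fun k => wave L k ^ 6 * d k ^ 2) :
    Tendsto (fun n => modeEnergy L R n c d) atTop
      (𝓝 (energy R (toH1 (sumH3 L c)) (toH1 (sumH3 L d)))) := by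
  have hcd : Summable fun k => wave L k ^ 6 * (c + d) k ^ 2 := by
    refine ((hc.mul_left 2).add (hd.mul_left 2)).of_nonneg_of_le (fun k => ?_) fun k => ?_
    · have := wave_nonneg (L := L) k
      positivity
    · have := mul_nonneg (pow_nonneg (wave_nonneg (L := L) k) 6) (sq_nonneg (c k - d k))
      rw [Pi.add_apply]
      linarith
  have h1 := (hasSum_norm_sq_dxL2_one hc).tendsto_sum_nat
  have h2 := (hasSum_norm_sq_dxL2_one hcd).tendsto_sum_nat
  have h3 := (h1.add (h2.const_mul R)).const_mul (1 / 2)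
  rw [energy_eq_norm_sq, map_add, dxL2_one_toH1, dxL2_one_toH1, ← map_add, ← sumH3_add hc hd]
  refine h3.congr fun n => ?_
  rw [modeEnergy, Finset.mul_sum, ← Finset.sum_add_distrib]
  congr 1
  exact Finset.sum_congr rfl fun k _ => by rw [Pi.add_apply]; ring

theorem integral_eq_mul_inner_cosE (u : Lp ℝ 2 (leb L)) :
    ∫ x, u x ∂(leb L) = √L * inner ℝ u (cosE 0) := by
  rw [inner_eq_integral, ← integral_const_mul]
  refine integral_congr_ae ?_
  filter_upwards [cosE_coeFn (L := L) 0] with x hx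
  rw [hx, cosBasis, if_pos rfl, Real.sqrt_div zero_le_one, Real.sqrt_one]
  have := Real.sqrt_pos.2 hL.out
  field_simp

/-- A subsequence of Galerkin approximations converges. -/
theorem exists_subseq_isCoeffLimit {R μ ε : ℝ} (hR : 0 < R) (hμ : 0 < μ) (hε : 0 < ε) {c₀ d₀ : ℕ → ℝ}
    {E₀ : ℝ} (hE : ∀ n, modeEnergy L R n c₀ d₀ ≤ E₀) {P Q : ℕ → ℝ → ℕ → ℝ}
    (hPQ : ∀ n, IsGalerkinCurve L R μ ε c₀ d₀ n (P n) (Q n)) :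
    ∃ (C : ℝ) (ν : ℕ → ℕ) (p q : ℝ → ℕ → ℝ), StrictMono ν ∧
      IsCoeffLimit L C (fun n => P (ν n)) p ∧ IsCoeffLimit L C (fun n => Q (ν n)) q := by
  obtain ⟨C, A, hCA⟩ := exists_galerkin_bounds (L := L) hR hμ hε hE
  have hb (n : ℕ) := hCA n _ _ (hPQ n)
  have hP (n : ℕ) (t : ℝ) (k : ℕ) : |P n t k| ≤ C :=
    (((hPQ n).summable_abs t).1.le_tsum k fun _ _ => abs_nonneg _).trans ((hb n).1 t).1
  have hQ (n : ℕ) (t : ℝ) (k : ℕ) : |Q n t k| ≤ C :=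
    (((hPQ n).summable_abs t).2.le_tsum k fun _ _ => abs_nonneg _).trans ((hb n).1 t).2
  -- Indexing both families by one disjoint union produces a common subsequence.
  obtain ⟨ν, q, hν, hq, hlim⟩ := exists_subseq_tendsto_of_modulus (ι := ℕ ⊕ ℕ)
    (fun n i t => Sum.elim (fun k => P n t k) (fun k => Q n t k) i) (fun _ => C)
    (by rintro n (k | k) t; exacts [hP n t k, hQ n t k]) (Sum.elim A A)
    (by rintro n (k | k) s t; exacts [((hb n).2.2 k s t).1, ((hb n).2.2 k s t).2])
  set C' := max C (4 * E₀ * (1 + 1 / R))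
  refine ⟨C', ν, fun t k => q (.inl k) t, fun t k => q (.inr k) t, hν, ?_, ?_⟩
  · exact ⟨fun n => ⟨ν n, fun t k hk => ((hPQ (ν n)).eq_zero t k hk).1⟩,
      fun n k => ((hPQ (ν n)).continuous_coeff k).1,
      fun n t => ((hPQ (ν n)).tsum_wave_sq_le hR hε hμ hE t).1.trans (le_max_right _ _),
      fun n t => ((hb (ν n)).1 t).1.trans (le_max_left _ _),
      fun n T hT => ((hb (ν n)).2.1 T hT).1.trans (le_max_left _ _), fun k => hq _, fun k => hlim (.inl k)⟩
  · exact ⟨fun n => ⟨ν n, fun t k hk => ((hPQ (ν n)).eq_zero t k hk).2⟩,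
      fun n k => ((hPQ (ν n)).continuous_coeff k).2,
      fun n t => ((hPQ (ν n)).tsum_wave_sq_le hR hε hμ hE t).2.trans (le_max_right _ _),
      fun n t => ((hb (ν n)).1 t).2.trans (le_max_left _ _),
      fun n T hT => ((hb (ν n)).2.1 T hT).2.trans (le_max_left _ _), fun k => hq _, fun k => hlim (.inr k)⟩

namespace IsCoeffLimit

variable {C D : ℝ} {P Q : ℕ → ℝ → ℕ → ℝ} {p q : ℝ → ℕ → ℝ}

theorem exists_lower_bound_integral_seqD (h : IsCoeffLimit L C P p) (k : IsCoeffLimit L D Q q) (R : ℝ) {μ : ℝ}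
    (hμ : 0 < μ) (ε : ℝ) {T : ℝ} (hT : 0 < T) :
    ∃ b : ℕ → ℝ, (∀ n, b n ≤ ∫ t, seqD L R μ ε (P n t) (Q n t) ∂(leb T)) ∧
      Tendsto b atTop (𝓝 (
        (∫ t, ‖fieldY₁ R ε (sumC L (p t)) (sumC L (q t)) (third L (p t)) (third L (q t))‖ ^ 2 ∂(leb T))
        + μ * R ^ 2 *
          (∫ t, ‖fieldY₂ ε (sumC L (p t)) (sumC L (q t)) (third L (p t)) (third L (q t))‖ ^ 2 ∂(leb T))
        + 3 * R ^ 2 / 4 *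
          (∫ t, ‖fieldY₃ ε (sumC L (p t)) (sumC L (q t)) (third L (p t)) (third L (q t))‖ ^ 2 ∂(leb T)))) := by
  obtain ⟨b₁, h₁, l₁⟩ := h.exists_lower_bound_integral_norm_sq_field k
    (mobCoef ε (fun z => √z.1 * (z.1 + R / 2 * (2 * z.1 + 3 * z.2))) (by fun_prop))
    (mobCoef ε (fun z => √z.1 * (R / 2 * (2 * z.1 + 3 * z.2))) (by fun_prop)) hT
  obtain ⟨b₂, h₂, l₂⟩ := h.exists_lower_bound_integral_norm_sq_field k
    (mobCoef ε (fun z => √(z.2 ^ 3)) (by fun_prop)) (mobCoef ε (fun z => √(z.2 ^ 3)) (by fun_prop)) hT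
  obtain ⟨b₃, h₃, l₃⟩ := h.exists_lower_bound_integral_norm_sq_field k
    (mobCoef ε (fun z => √(z.1 * z.2 ^ 2)) (by fun_prop))
    (mobCoef ε (fun z => √(z.1 * z.2 ^ 2)) (by fun_prop)) hT
  refine ⟨_, fun n => ?_, (l₁.add (l₂.const_mul (μ * R ^ 2))).add (l₃.const_mul (3 * R ^ 2 / 4))⟩
  have i₁ := integrable_norm_sq (h.memLp_field_approx k
    (mobCoef ε (fun z => √z.1 * (z.1 + R / 2 * (2 * z.1 + 3 * z.2))) (by fun_prop))
    (mobCoef ε (fun z => √z.1 * (R / 2 * (2 * z.1 + 3 * z.2))) (by fun_prop)) n T)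
  have i₂ := (integrable_norm_sq (h.memLp_field_approx k
    (mobCoef ε (fun z => √(z.2 ^ 3)) (by fun_prop))
    (mobCoef ε (fun z => √(z.2 ^ 3)) (by fun_prop)) n T)).const_mul (μ * R ^ 2)
  have i₃ := (integrable_norm_sq (h.memLp_field_approx k
    (mobCoef ε (fun z => √(z.1 * z.2 ^ 2)) (by fun_prop))
    (mobCoef ε (fun z => √(z.1 * z.2 ^ 2)) (by fun_prop)) n T)).const_mul (3 * R ^ 2 / 4)
  have e : ∫ t, seqD L R μ ε (P n t) (Q n t) ∂(leb T) = _ :=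
    (integral_add (i₁.add i₂) i₃).trans (congrArg₂ (· + ·) (integral_add i₁ i₂) rfl)
  rw [e, integral_const_mul, integral_const_mul]
  exact add_le_add (add_le_add (h₁ n) (mul_le_mul_of_nonneg_left (h₂ n) (by positivity)))
    (mul_le_mul_of_nonneg_left (h₃ n) (by positivity))

theorem energy_inequality (h : IsCoeffLimit L C P p) (k : IsCoeffLimit L D Q q) {R μ ε : ℝ} (hR : 0 < R)
    (hμ : 0 < μ) (hε : 0 < ε) {c₀ d₀ : ℕ → ℝ} {E₀ : ℝ} (hE : ∀ n, modeEnergy L R n c₀ d₀ ≤ E₀) {ν : ℕ → ℕ}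
    (hν : StrictMono ν) (hPQ : ∀ n, IsGalerkinCurve L R μ ε c₀ d₀ (ν n) (P n) (Q n)) {T : ℝ} (hT : 0 < T)
    (hp : Summable fun k => wave L k ^ 6 * p T k ^ 2) (hq : Summable fun k => wave L k ^ 6 * q T k ^ 2) :
    energy R (toH1 (sumH3 L (p T))) (toH1 (sumH3 L (q T)))
      + (∫ t, ‖fieldY₁ R ε (sumC L (p t)) (sumC L (q t)) (third L (p t)) (third L (q t))‖ ^ 2 ∂(leb T))
      + μ * R ^ 2 *
        (∫ t, ‖fieldY₂ ε (sumC L (p t)) (sumC L (q t)) (third L (p t)) (third L (q t))‖ ^ 2 ∂(leb T))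
      + 3 * R ^ 2 / 4 *
        (∫ t, ‖fieldY₃ ε (sumC L (p t)) (sumC L (q t)) (third L (p t)) (third L (q t))‖ ^ 2 ∂(leb T))
      ≤ E₀ := by
  obtain ⟨b, hb, hlim⟩ := h.exists_lower_bound_integral_seqD k R hμ ε hT
  rw [add_assoc, add_assoc, ← add_assoc (∫ t, _ ∂(leb T))]
  -- The energy itself need not converge along the subsequence. Its first `m` modes do; the limit in
  -- the order is taken with `m` fixed, and the limit in `m` afterwards.
  refine le_of_tendsto ((tendsto_modeEnergy R hp hq).add_const _) (Eventually.of_forall fun m => ?_)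
  have hm : Tendsto (fun n => modeEnergy L R m (P n T) (Q n T)) atTop (𝓝 (modeEnergy L R m (p T) (q T))) :=
    (tendsto_finsetSum _ fun j _ => (((h.tendsto_apply T j).pow 2).add
      ((((h.tendsto_apply T j).add (k.tendsto_apply T j)).pow 2).const_mul R)).const_mul _).const_mul _
  refine le_of_tendsto (hm.add hlim) ?_
  filter_upwards [eventually_ge_atTop m] with n hn
  have hmn : m ≤ ν n + 1 := (hn.trans hν.le_apply).trans (Nat.le_succ _)
  have h1 : modeEnergy L R m (P n T) (Q n T) ≤ modeEnergy L R (ν n + 1) (P n T) (Q n T) :=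
    mul_le_mul_of_nonneg_left (Finset.sum_le_sum_of_subset_of_nonneg (Finset.range_mono hmn)
      fun j _ _ => by positivity) (by norm_num)
  linarith [(hPQ n).energy_identity hε hT.le, hE (ν n + 1), hb n]

end IsCoeffLimit

theorem inner_seqF_dxL2_one (R ε : ℝ) {c d : ℕ → ℝ} (hc : Summable fun k => |c k|)
    (hd : Summable fun k => |d k|) (ξ : Sob L 1) :
    inner ℝ (seqF L R ε c d) (dxL2 1 ξ) = ∫ x, fluxF R (mob ε (cosSum L c x)) (mob ε (cosSum L d x))
      (dx 3 (sumH3 L c) x) (dx 3 (sumH3 L d) x) * dx 1 ξ x ∂(leb L) := by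
  rw [inner_eq_integral]
  refine integral_congr_ae ?_
  filter_upwards [fieldF_coeFn R ε (sumC L c) (sumC L d) (third L c) (third L d), ae_ext_sumC hc,
    ae_ext_sumC hd] with x h1 h2 h3
  rw [seqF, h1, h2, h3]; rfl

theorem inner_seqG_dxL2_one (R μ ε : ℝ) {c d : ℕ → ℝ} (hc : Summable fun k => |c k|)
    (hd : Summable fun k => |d k|) (ξ : Sob L 1) :
    inner ℝ (seqG L R μ ε c d) (dxL2 1 ξ) = ∫ x, fluxG R μ (mob ε (cosSum L c x)) (mob ε (cosSum L d x))
      (dx 3 (sumH3 L c) x) (dx 3 (sumH3 L d) x) * dx 1 ξ x ∂(leb L) := by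
  rw [inner_eq_integral]
  refine integral_congr_ae ?_
  filter_upwards [fieldG_coeFn R μ ε (sumC L c) (sumC L d) (third L c) (third L d), ae_ext_sumC hc,
    ae_ext_sumC hd] with x h1 h2 h3
  rw [seqG, h1, h2, h3]; rfl

theorem norm_sq_fieldY_cosSum (R : ℝ) {ε : ℝ} (hε : 0 < ε) {c d : ℕ → ℝ} (hc : Summable fun k => |c k|)
    (hd : Summable fun k => |d k|) :
    ‖fieldY₁ R ε (sumC L c) (sumC L d) (third L c) (third L d)‖ ^ 2
      = ∫ x, mob ε (cosSum L c x) * |mob ε (cosSum L c x) * dx 3 (sumH3 L c) x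
        + R / 2 * (2 * mob ε (cosSum L c x) + 3 * mob ε (cosSum L d x))
          * (dx 3 (sumH3 L c) x + dx 3 (sumH3 L d) x)| ^ 2 ∂(leb L) ∧
    ‖fieldY₂ ε (sumC L c) (sumC L d) (third L c) (third L d)‖ ^ 2
      = ∫ x, mob ε (cosSum L d x) ^ 3 * |dx 3 (sumH3 L c) x + dx 3 (sumH3 L d) x| ^ 2 ∂(leb L) ∧
    ‖fieldY₃ ε (sumC L c) (sumC L d) (third L c) (third L d)‖ ^ 2
      = ∫ x, mob ε (cosSum L c x) * mob ε (cosSum L d x) ^ 2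
        * |dx 3 (sumH3 L c) x + dx 3 (sumH3 L d) x| ^ 2 ∂(leb L) := by
  rw [norm_sq_fieldY₁ R hε, norm_sq_fieldY₂ hε, norm_sq_fieldY₃ hε]
  refine ⟨integral_congr_ae ?_, integral_congr_ae ?_, integral_congr_ae ?_⟩ <;>
  · filter_upwards [ae_ext_sumC hc, ae_ext_sumC hd] with x h2 h3
    simp only [h2, h3]; rfl

theorem IsCoeffLimit.hasRegularity {A B C : ℝ} {U P Q : ℕ → ℝ → ℕ → ℝ} {u p q : ℝ → ℕ → ℝ}
    (hu : IsCoeffLimit L A U u) (h : IsCoeffLimit L B P p) (k : IsCoeffLimit L C Q q) (Φ Ψ : C(ℝ × ℝ, ℝ))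
    (hd : ∀ j, ∀ᶠ n in atTop, ∀ t > 0, HasDerivAt (fun s => U n s j) (inner ℝ
      (field Φ Ψ (sumC L (P n t)) (sumC L (Q n t)) (third L (P n t)) (third L (Q n t)))
      (dxL2 1 (cosH3 j : Sob L 3))) t) :
    HasRegularity L (fun t => cosSum L (u t)) (fun t => sumH3 L (u t)) fun t => (innerSL ℝ
      (field Φ Ψ (sumC L (p t)) (sumC L (q t)) (third L (p t)) (third L (q t)))).comp (dxL2 1) where
  represents := hu.represents
  memLp_top_H1 _ _ := hu.memLp_top_toH1 _
  memLp_two_H3 _ hT := hu.memLp_sumH3 hT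
  contHolder _ _ _ hα := hu.contHolder _ hα
  memLp_two_dual _ hT := memLp_innerSL_comp_dxL2 1 (h.memLp_field_limit k Φ Ψ hT)
  isTimeDeriv _ hT := hu.isTimeDeriv h k Φ Ψ hd hT

theorem IsCoeffLimit.ofC_sumC_eq {C : ℝ} {P : ℕ → ℝ → ℕ → ℝ} {p : ℝ → ℕ → ℝ} (h : IsCoeffLimit L C P p)
    {u : Lp ℝ 2 (leb L)} {t : ℝ} (hu : ∀ k, p t k = inner ℝ u (cosE k)) :
    cosSum L (p t) =ᵐ[leb L] u := by
  have : ofC (sumC L (p t)) = u := by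
    rw [← sub_eq_zero]
    refine eq_zero_of_inner_cosE _ fun k => ?_
    rw [inner_sub_left, h.inner_cosE, hu, sub_self]
  rw [← this]
  exact (ofC_sumC_coeFn (h.summable_abs t)).symm

/-- The integral depends only on the constant mode, and the sign of `u` identifies it with the `L₁`
norm. -/
theorem IsCoeffLimit.integral_cosSum {C : ℝ} {P : ℕ → ℝ → ℕ → ℝ} {p : ℝ → ℕ → ℝ} (h : IsCoeffLimit L C P p)
    {u : Lp ℝ 2 (leb L)} (hu0 : 0 ≤ᵐ[leb L] u) {t : ℝ} (hu : p t 0 = inner ℝ u (cosE 0)) :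
    ∫ x, cosSum L (p t) x ∂(leb L) = ∫ x, |u x| ∂(leb L) := by
  have e : ∫ x, |u x| ∂(leb L) = ∫ x, u x ∂(leb L) := by
    refine integral_congr_ae ?_
    filter_upwards [hu0] with x hx
    exact abs_of_nonneg hx
  rw [e, integral_eq_mul_inner_cosE, ← hu, ← h.inner_cosE, ← integral_eq_mul_inner_cosE]
  exact integral_congr_ae (ofC_sumC_coeFn (h.summable_abs t)).symm

end

end ThinFilm

/-! ### Assembly of the solution -/

open ThinFilm
theorem theorem2p1 (L R μ ε : ℝ) (hL : 0 < L) (hR : 0 < R) (hμ : 0 < μ)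
    (hε : 0 < ε) (hε1 : ε ≤ 1) (f₀ g₀ : Sob L 1)
    (hf₀ : 0 ≤ᵐ[leb L] dx 0 f₀) (hg₀ : 0 ≤ᵐ[leb L] dx 0 g₀) :
    ∃ (f g : ℝ → ℝ → ℝ) (F G : ℝ → Sob L 3) (ft gt : ℝ → StrongDual ℝ (Sob L 1)),
      -- regularity
      HasRegularity L f F ft ∧ HasRegularity L g G gt ∧
      -- weak formulation
      (∀ T > 0, ∀ ξ : ℝ → Sob L 1, MemLp ξ 2 (leb T) →
        ∫ t, ft t (ξ t) ∂(leb T)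
          = ∫ t, ∫ x, fluxF R (mob ε (f t x)) (mob ε (g t x)) (dx 3 (F t) x) (dx 3 (G t) x)
              * dx 1 (ξ t) x ∂(leb L) ∂(leb T) ∧
        ∫ t, gt t (ξ t) ∂(leb T)
          = ∫ t, ∫ x, fluxG R μ (mob ε (f t x)) (mob ε (g t x)) (dx 3 (F t) x) (dx 3 (G t) x)
              * dx 1 (ξ t) x ∂(leb L) ∂(leb T)) ∧
      -- initial data
      f 0 =ᵐ[leb L] dx 0 f₀ ∧ g 0 =ᵐ[leb L] dx 0 g₀ ∧
      -- conservation of mass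
      (∀ T ≥ 0, ∫ x, f T x ∂(leb L) = ∫ x, |dx 0 f₀ x| ∂(leb L) ∧
        ∫ x, g T x ∂(leb L) = ∫ x, |dx 0 g₀ x| ∂(leb L)) ∧
      -- Neumann boundary conditions
      (∀ᵐ T ∂(volume.restrict (Ioi (0 : ℝ))), ∀ x ∈ ({0, L} : Set ℝ),
        HasDerivWithinAt (f T) 0 (Icc 0 L) x ∧ HasDerivWithinAt (g T) 0 (Icc 0 L) x) ∧
      -- energy inequality
      (∀ᵐ T ∂(volume.restrict (Ioi (0 : ℝ))),
        energy R (toH1 (F T)) (toH1 (G T))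
          + ∫ t, ∫ x, mob ε (f t x) *
              |mob ε (f t x) * dx 3 (F t) x
                + R / 2 * (2 * mob ε (f t x) + 3 * mob ε (g t x))
                  * (dx 3 (F t) x + dx 3 (G t) x)| ^ 2 ∂(leb L) ∂(leb T)
          + μ * R ^ 2 * ∫ t, ∫ x, mob ε (g t x) ^ 3
              * |dx 3 (F t) x + dx 3 (G t) x| ^ 2 ∂(leb L) ∂(leb T)
          + 3 * R ^ 2 / 4 * ∫ t, ∫ x, mob ε (f t x) * mob ε (g t x) ^ 2
              * |dx 3 (F t) x + dx 3 (G t) x| ^ 2 ∂(leb L) ∂(leb T)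
          ≤ energy R f₀ g₀) ∧
      -- the solution is the limit of a subsequence of global Galerkin approximations
      (∃ (u v : ℕ → ℝ → ℝ → ℝ) (ν : ℕ → ℕ),
        (∀ n, IsGalerkin R μ ε f₀ g₀ n (u n) (v n)) ∧ StrictMono ν ∧
        ∀ T > 0, ∀ α : ℝ≥0, α < 1 / 2 →
          Tendsto (fun n => ⨆ t ∈ Icc 0 T, holderENorm L α (u (ν n) t - f t)) atTop (𝓝 0) ∧
          Tendsto (fun n => ⨆ t ∈ Icc 0 T, holderENorm L α (v (ν n) t - g t)) atTop (𝓝 0)) := by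
  have : Fact (0 < L) := ⟨hL⟩
  set c₀ : ℕ → ℝ := fun k => inner ℝ (dxL2 0 f₀) (cosE k) with hc₀
  set d₀ : ℕ → ℝ := fun k => inner ℝ (dxL2 0 g₀) (cosE k) with hd₀
  have hE (n : ℕ) : modeEnergy L R n c₀ d₀ ≤ energy R f₀ g₀ := modeEnergy_le_energy hR f₀ g₀ n
  choose P Q hPQ using exists_isGalerkinCurve (L := L) hR hμ hε c₀ d₀
  obtain ⟨C, ν, p, q, hν, hp, hq⟩ := exists_subseq_isCoeffLimit hR hμ hε hE hPQ
  have hge (j : ℕ) : ∀ᶠ n in atTop, j ≤ ν n := hν.tendsto_atTop.eventually_ge_atTop j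
  -- Mode `k` of the approximate initial value is exact as soon as the order reaches `k`.
  have hinit (k : ℕ) : p 0 k = c₀ k ∧ q 0 k = d₀ k :=
    ⟨tendsto_nhds_unique_of_eventuallyEq (hp.tendsto_apply 0 k) tendsto_const_nhds
        ((hge k).mono fun n hn => ((hPQ (ν n)).init k hn).1),
      tendsto_nhds_unique_of_eventuallyEq (hq.tendsto_apply 0 k) tendsto_const_nhds
        ((hge k).mono fun n hn => ((hPQ (ν n)).init k hn).2)⟩
  have hmass (t : ℝ) : p t 0 = c₀ 0 ∧ q t 0 = d₀ 0 :=
    ⟨tendsto_nhds_unique_of_eventuallyEq (hp.tendsto_apply t 0) tendsto_const_nhds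
        (Eventually.of_forall fun n => ((hPQ (ν n)).coeff_zero t).1),
      tendsto_nhds_unique_of_eventuallyEq (hq.tendsto_apply t 0) tendsto_const_nhds
        (Eventually.of_forall fun n => ((hPQ (ν n)).coeff_zero t).2)⟩
  -- On the null set of times at which the `H^3` series diverges, `sumH3` has the default value `0`.
  -- The functions `cosSum` are genuine limits at every time.
  refine ⟨fun t => cosSum L (p t), fun t => cosSum L (q t), fun t => sumH3 L (p t), fun t => sumH3 L (q t),
    fun t => (innerSL ℝ (seqF L R ε (p t) (q t))).comp (dxL2 1),
    fun t => (innerSL ℝ (seqG L R μ ε (p t) (q t))).comp (dxL2 1), ?_, ?_, fun T _ ξ _ => ⟨?_, ?_⟩,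
    hp.ofC_sumC_eq fun k => (hinit k).1, hq.ofC_sumC_eq fun k => (hinit k).2,
    fun T _ => ⟨hp.integral_cosSum hf₀ (hmass T).1, hq.integral_cosSum hg₀ (hmass T).2⟩, ?_, ?_,
    fun n t => cosSum L (P n t), fun n t => cosSum L (Q n t), ν,
    fun n => (hPQ n).isGalerkin (fun k => rfl) fun k => rfl, hν,
    fun T _ α hα => ⟨hp.tendsto_iSup_holderENorm T hα, hq.tendsto_iSup_holderENorm T hα⟩⟩
  · exact hp.hasRegularity hp hq _ _ fun j =>
      (hge j).mono fun n hn t ht => (hPQ (ν n)).hasDerivAt_fst hn ht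
  · exact hq.hasRegularity hp hq _ _ fun j =>
      (hge j).mono fun n hn t ht => (hPQ (ν n)).hasDerivAt_snd hn ht
  -- The functionals were defined by pairing the flux with `∂_x ξ`, so the weak formulation is
  -- immediate; that they are the time derivatives is part of the regularity proved above.
  · exact integral_congr_ae (Eventually.of_forall fun t =>
      inner_seqF_dxL2_one R ε (hp.summable_abs t) (hq.summable_abs t) (ξ t))
  · exact integral_congr_ae (Eventually.of_forall fun t =>
      inner_seqG_dxL2_one R μ ε (hp.summable_abs t) (hq.summable_abs t) (ξ t))
  · filter_upwards [hp.ae_summable_wave_six, hq.ae_summable_wave_six] with t h1 h2 x hx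
    exact ⟨(hasDerivAt_cosSum_boundary h1 hx).hasDerivWithinAt,
      (hasDerivAt_cosSum_boundary h2 hx).hasDerivWithinAt⟩
  · filter_upwards [hp.ae_summable_wave_six, hq.ae_summable_wave_six, ae_restrict_mem measurableSet_Ioi]
      with T h1 h2 hT
    have := hp.energy_inequality hq hR hμ hε hE hν (fun n => hPQ (ν n)) hT h1 h2
    simpa only [fun t => (norm_sq_fieldY_cosSum (L := L) R hε (hp.summable_abs t) (hq.summable_abs t)).1,
      fun t => (norm_sq_fieldY_cosSum (L := L) R hε (hp.summable_abs t) (hq.summable_abs t)).2.1,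
      fun t => (norm_sq_fieldY_cosSum (L := L) R hε (hp.summable_abs t) (hq.summable_abs t)).2.2] using this
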